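/- Let $G=(V,E)$ be a connected, locally finite, quasi-transitive (simple) graph. For $p\in[0,1]$ let $\mathbf P_p$, $\mathbf E_p$ denote the law of, and expectation for, Bernoulli-$p$ bond percolation on $G$, let $K_u$ be the cluster of $u$, let $d_{\mathrm{int}}$ be the graph distance in the open subgraph, let $B_{\mathrm{int}}(u,r)=\{v\in K_u: d_{\mathrm{int}}(u,v)\le r\}$, and let $p_c$ be the supremum of those $p$ for which there is $\mathbf P_p$-almost surely no infinite cluster. Let $T_p(u,v)=\mathbf P_p(u\leftrightarrow v)$, let $P$ be the transition matrix of simple random walk on $G$ (which by convention stays put at an isolated vertex), and let $$I_\nabla=\Bigl\{p\in[0,1]:\ \lim_{k\to\infty}\sup_{v\in V}\,(T_p^2P^kT_p)(v,v)=0\Bigr\}$$ be the set of $p$ at which the modified open triangle condition holds. For $u\in V$ and $\alpha\ge 0$ define, with values in $[0,\infty]$, $$\mathscr G(p,\alpha,u)=\mathbf E_p\Bigl[\sum_{v\in K_u}\alpha^{d_{\mathrm{int}}(u,v)}\Bigr],\qquad \frac{\partial}{\partial\alpha}\mathscr G(p,\alpha,u):=\mathbf E_p\Bigl[\sum_{v\in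 K_u}d_{\mathrm{int}}(u,v)\,\alpha^{d_{\mathrm{int}}(u,v)-1}\Bigr],\qquad \mathscr G^*(p,\alpha)=\sup_{u\in V}\mathscr G(p,\alpha,u),$$ $$\alpha_p=\sup\{\alpha\ge0:\mathscr G^*(p,\alpha)<\infty\},\qquad \gamma_{\mathrm{int}}(p)=\inf_{r\ge1}\frac1r\log\sup_{v\in V}\mathbf E_p\bigl[\#B_{\mathrm{int}}(v,r)\bigr].$$ Then: 1. There is a continuous function $\eta:(I_\nabla\setminus\{0\})\times(0,1]\to(0,1]$ such that $$\frac{\partial}{\partial\alpha}\mathscr G(p,\alpha,u)\ \ge\ \eta(p,\alpha)\,\mathscr G(p,\alpha,u)^2$$ for every $p\in I_\nabla$ with $p>0$, every $u\in V$ and every $0<\alpha\le1$ such that $\mathscr G^*(p,\alpha)<\infty$. 2. For every $p\in I_\nabla$ with $p\ge p_c$ one has $\alpha_p=e^{-\gamma_{\mathrm{int}}(p)}$. 3. There is a continuous function $\kappa:I_\nabla\to(0,\infty)$ such that $$\mathscr G^*(p,\alpha)\le\frac{\kappa(p)}{\alpha_p-\alpha}$$ for every $p\in I_\nabla$ with $p\ge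 p_c$ and every $0\le\alpha<1\wedge\alpha_p$. -/

import Mathlib

open MeasureTheory ProbabilityTheory Filter Topology unitInterval
open scoped ENNReal NNReal

namespace Percolation

variable {V : Type*} (G : SimpleGraph V)

/-- The automorphism group of `G` acts on the vertices with finitely many orbits. -/
def QuasiTransitive : Prop :=
  ∃ S : Finset V, ∀ v : V, ∃ u ∈ S, ∃ φ : G ≃g G, φ u = v

/-! ### Bernoulli bond percolation -/

/-- The law of Bernoulli-`p` bond percolation: the edges of `G` are open (`true`) independently
with probability `p`. -/
noncomputable def law (p : I) : Measure (G.edgeSet → Bool) :=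
  Measure.infinitePi fun _ : G.edgeSet => bernoulliMeasure true false p

variable {G} in
/-- The subgraph formed by the open edges of a configuration. Clusters are its connected
components, and the intrinsic distance is its graph distance. -/
def openGraph (ω : G.edgeSet → Bool) : SimpleGraph V :=
  SimpleGraph.fromEdgeSet {e | ∃ h : e ∈ G.edgeSet, ω ⟨e, h⟩ = true}

variable {G} in
/-- The cluster `K_u` of `u`. -/
def cluster (ω : G.edgeSet → Bool) (u : V) : Set V :=
  {v | (openGraph ω).Reachable u v}

variable {G} in
/-- The intrinsic distance; it is only used for vertices in the same cluster. -/
noncomputable def dInt (ω : G.edgeSet → Bool) (u v : V) : ℕ :=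
  (openGraph ω).dist u v

variable {G} in
/-- The intrinsic ball of radius `r` around `u`. -/
def ballInt (ω : G.edgeSet → Bool) (u : V) (r : ℕ) : Set V :=
  {v | v ∈ cluster ω u ∧ dInt ω u v ≤ r}

/-- The critical probability. -/
noncomputable def pc : I :=
  sSup {p : I | ∀ᵐ ω ∂(law G p), ∀ u : V, (cluster ω u).Finite}

/-- The two-point matrix `T_p(u,v)`, the probability that `u` and `v` are connected. -/
noncomputable def T (p : I) (u v : V) : ℝ≥0∞ :=
  law G p {ω | v ∈ cluster ω u}

/-! ### The modified open triangle condition -/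

/-- Product of non-negative matrices indexed by `V`. -/
noncomputable def mmul (A B : V → V → ℝ≥0∞) (u v : V) : ℝ≥0∞ :=
  ∑' w, A u w * B w v

open Classical in
/-- Powers of a non-negative matrix indexed by `V`. -/
noncomputable def mpow (A : V → V → ℝ≥0∞) : ℕ → V → V → ℝ≥0∞
  | 0 => fun u v => if u = v then 1 else 0
  | k + 1 => mmul (mpow A k) A

open Classical in
/-- Transition matrix of simple random walk on `G`; the walk stays put at an isolated vertex
(which a connected graph has only if it is a single vertex). -/
noncomputable def srw [G.LocallyFinite] (u v : V) : ℝ≥0∞ :=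
  if G.degree u = 0 then (if u = v then 1 else 0)
  else if G.Adj u v then (G.degree u : ℝ≥0∞)⁻¹ else 0

/-- The set of `p` at which the modified open triangle condition holds:
`sup_v (T_p ^ 2 P ^ k T_p)(v,v) → 0` as `k → ∞`. -/
noncomputable def INabla [G.LocallyFinite] : Set I :=
  {p : I | Tendsto
    (fun k : ℕ => ⨆ v : V, mmul (mmul (mmul (T G p) (T G p)) (mpow (srw G) k)) (T G p) v v)
    atTop (𝓝 0)}

/-! ### Growth and generating functions -/

/-- `Gr_p(r)`, the supremal expected volume of an intrinsic ball of radius `r`. -/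
noncomputable def Gr (p : I) (r : ℕ) : ℝ≥0∞ :=
  ⨆ v : V, ∫⁻ ω, ((ballInt ω v r).encard : ℝ≥0∞) ∂(law G p)

/-- The exponential growth rate `inf_{r ≥ 1} (1/r) log Gr_p(r)`. -/
noncomputable def gammaInt (p : I) : ℝ :=
  ⨅ r : {r : ℕ // 1 ≤ r}, Real.log (Gr G p r).toReal / (r : ℕ)

/-- The generating function `E_p [∑_{v ∈ K_u} α ^ d_int(u,v)]`. -/
noncomputable def gen (p : I) (α : ℝ≥0) (u : V) : ℝ≥0∞ :=
  ∫⁻ ω, ∑' v : cluster ω u, (α : ℝ≥0∞) ^ dInt ω u v ∂(law G p)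

/-- The formal derivative in `α`, `E_p [∑_{v ∈ K_u} d_int(u,v) α ^ (d_int(u,v) - 1)]`.
The term with `d_int(u,v) = 0` vanishes. -/
noncomputable def derivGen (p : I) (α : ℝ≥0) (u : V) : ℝ≥0∞ :=
  ∫⁻ ω, ∑' v : cluster ω u, (dInt ω u v : ℝ≥0∞) * (α : ℝ≥0∞) ^ (dInt ω u v - 1) ∂(law G p)

/-- The supremum of the generating function over the base vertex. -/
noncomputable def genSup (p : I) (α : ℝ≥0) : ℝ≥0∞ :=
  ⨆ u : V, gen G p α u

/-- `α_p`, the supremal `α` such that `genSup G p α` is finite. -/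
noncomputable def alphaCrit (p : I) : ℝ≥0∞ :=
  ⨆ (α : ℝ≥0) (_ : genSup G p α < ∞), (α : ℝ≥0∞)

end Percolation

open MeasureTheory ProbabilityTheory Filter Topology unitInterval
open scoped ENNReal NNReal

/-! Write `g(u,v)` for the mean of `α ^ d_int(u,v)` on `u ↔ v`. The differential inequality compares
the product `g(u,w) g(w',v)` of two independent samples with one sample in which `w ∈ K_u` and `v ∈
K_{w'}` for two distinct clusters (`meanWeight_mul_meanWeight_le`). To compare them, `K_u` is
explored in the first sample and the unexplored edges are read from the second. What is lost is the
case in which the second geodesic hits `K_u` at some `x`. By the van den Berg–Kesten inequality this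
costs at most the sum over `z`, `x` of `g(u,z) T(z,w) T(z,x) T(w',x) g(x,v)`. Weighting by
`P^k(w',w)` and summing makes the closed loop `(T^2 P^k T)(z,z)` appear, so the loss is at most
`sup_z (T^2 P^k T)(z,z)` times `𝒢* 𝒢(u)` (`genSup_mul_gen_le`). Under the open triangle condition
this is absorbed for large `k`.

The remaining term is turned into the derivative by surgery. Opening a path of length at most `k`
from `w'` to `w` costs at most a factor `(pα)^k` and joins `u` to `v`, and only through that path. A
geodesic from `u` to `v` has `d_int(u,v)` edges, each of which lies on paths of total weight at most
`D^k`. The surgery sum is therefore bounded by `D^k E[d α^d]` (`pow_mul_tsum_tsum_sepWeight_le`).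
Quasi-transitivity makes `𝒢(u)` and `𝒢*` comparable. Since `T_p` increases with `p`, one `k` serves
all smaller parameters; the constants are thus locally uniform, and a partition of unity makes them
continuous.

For the identity, van den Berg–Kesten makes `Gr` submultiplicative, so `𝒢*` converges as soon as
`α^r Gr(r) < 1` for one `r`; conversely `α^r Gr(r) ≤ 𝒢*`. Both use `α ≤ 1`. For the second this is
automatic once the susceptibility is infinite, which holds at `p ≥ p_c` because its finiteness is an
open condition (`exists_gt_genSup_one_lt_top`) and forces `p ≤ p_c`. The value `p = 1` is not in
`INabla`.

For the last estimate, `F' ≥ c F^2` makes `F` explode within distance `2 / (c F)`. As `F` is finite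
below `α_p`, `F(α) ≤ 2 / (c (α_p - α))` (`genSup_le_div`). -/

namespace Percolation

/-! ### Resampling and exchanging independent coins -/

section ProductMeasure

variable {ι : Type*}

/-- The law of independent coin flips, the coin `i` having bias `q i`. -/
noncomputable abbrev bern (q : ι → I) : Measure (ι → Bool) :=
  Measure.infinitePi fun i => bernoulliMeasure true false (q i)

open Classical in
/-- The configuration that agrees with `y` on `S` and with `x` off `S`. -/
noncomputable def splice (S : Set ι) (x y : ι → Bool) (i : ι) : Bool :=
  if i ∈ S then y i else x i

lemma splice_of_mem {S : Set ι} {i : ι} (h : i ∈ S) (x y : ι → Bool) : splice S x y i = y i :=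
  if_pos h

lemma splice_of_notMem {S : Set ι} {i : ι} (h : i ∉ S) (x y : ι → Bool) :
    splice S x y i = x i :=
  if_neg h

lemma measurable_splice_random {S : (ι → Bool) → Set ι} (hS : ∀ i, MeasurableSet {x | i ∈ S x}) :
    Measurable fun z : (ι → Bool) × (ι → Bool) => splice (S z.1) z.1 z.2 := by
  classical
  refine measurable_pi_lambda _ fun i => ?_
  unfold splice
  exact Measurable.ite (measurable_fst (hS i)) (by fun_prop) (by fun_prop)

lemma measurable_splice (S : Set ι) :
    Measurable fun z : (ι → Bool) × (ι → Bool) => splice S z.1 z.2 :=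
  measurable_splice_random (S := fun _ => S) fun _ => MeasurableSet.const _

/-- Resampling the coins in a fixed set does not change the law. -/
lemma lintegral_splice (q : ι → I) (S : Set ι) {f : (ι → Bool) → ℝ≥0∞} (hf : Measurable f) :
    ∫⁻ x, ∫⁻ y, f (splice S x y) ∂(bern q) ∂(bern q) = ∫⁻ x, f x ∂(bern q) := by
  classical
  have key : ((bern q).prod (bern q)).map (fun z => splice S z.1 z.2) = bern q := by
    refine Measure.eq_infinitePi _ fun s t ht => ?_
    rw [Measure.map_apply (measurable_splice S)
      (MeasurableSet.pi s.countable_toSet fun i _ => ht i)]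
    have : (fun z : (ι → Bool) × (ι → Bool) => splice S z.1 z.2) ⁻¹' (Set.pi s t)
        = (Set.pi ((s.filter (· ∉ S) : Finset ι) : Set ι) t) ×ˢ
          (Set.pi ((s.filter (· ∈ S) : Finset ι) : Set ι) t) := by
      ext z
      simp only [Set.mem_preimage, Set.mem_pi, Finset.mem_coe, Set.mem_prod, Finset.mem_filter]
      constructor
      · intro h
        refine ⟨fun i hi => ?_, fun i hi => ?_⟩
        · simpa [splice_of_notMem hi.2] using h i hi.1
        · simpa [splice_of_mem hi.2] using h i hi.1
      · intro h i hi
        by_cases hS : i ∈ S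
        · simpa [splice_of_mem hS] using h.2 i ⟨hi, hS⟩
        · simpa [splice_of_notMem hS] using h.1 i ⟨hi, hS⟩
    rw [this, Measure.prod_prod, Measure.infinitePi_pi _ fun i _ => ht i,
      Measure.infinitePi_pi _ fun i _ => ht i, mul_comm, Finset.prod_filter_mul_prod_filter_not]
  conv_rhs => rw [← key]
  rw [lintegral_map hf (measurable_splice S), lintegral_prod]
  exact (hf.comp (measurable_splice S)).aemeasurable

/-- Resampling the coins outside a set that is explored by looking only at the coins in it does
not change the law. -/
lemma lintegral_splice_random (q : ι → I) {S : (ι → Bool) → Set ι}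
    (hS : ∀ i, MeasurableSet {x | i ∈ S x})
    (hstab : ∀ x y, (∀ i ∈ S x, x i = y i) → S y = S x)
    {f : (ι → Bool) → ℝ≥0∞} (hf : Measurable f) :
    ∫⁻ x, ∫⁻ y, f (splice (S x)ᶜ x y) ∂(bern q) ∂(bern q) = ∫⁻ x, f x ∂(bern q) := by
  classical
  have hm : Measurable fun z : (ι → Bool) × (ι → Bool) => splice (S z.1)ᶜ z.1 z.2 :=
    measurable_splice_random (S := fun x => (S x)ᶜ) fun i => (hS i).compl
  have key : ((bern q).prod (bern q)).map (fun z => splice (S z.1)ᶜ z.1 z.2) = bern q := by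
    refine Measure.eq_infinitePi _ fun s t ht => ?_
    have hmt : ∀ r : Finset ι, MeasurableSet (Set.pi (r : Set ι) t) := fun r =>
      MeasurableSet.pi r.countable_toSet fun i _ => ht i
    rw [Measure.map_apply hm (hmt s), ← Measure.infinitePi_pi _ fun i _ => ht i,
      ← lintegral_indicator_one (hmt s), ← lintegral_indicator_one (hm (hmt s)),
      lintegral_prod _ ((measurable_one.indicator (hm (hmt s))).aemeasurable)]
    -- Split according to the explored part `A` of the finite window `s`: constraints on `A` are
    -- read from `x`, those on `s \ A` from `y`.
    let f : Finset ι → (ι → Bool) → ℝ≥0∞ := fun A =>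
      ({x | s.filter (· ∈ S x) = A} ∩ Set.pi (A : Set ι) t).indicator 1
    let g : Finset ι → (ι → Bool) → ℝ≥0∞ := fun A =>
      (Set.pi ((s \ A : Finset ι) : Set ι) t).indicator 1
    have hfm : ∀ A, Measurable (f A) := by
      intro A
      refine measurable_one.indicator (MeasurableSet.inter ?_ (hmt A))
      have : {x | s.filter (· ∈ S x) = A}
          = {x | A ⊆ s} ∩ ⋂ i ∈ s, {x | i ∈ S x ↔ i ∈ A} := by
        ext x
        simp only [Set.mem_ofPred_eq, Set.mem_inter_iff, Set.mem_iInter]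
        constructor
        · rintro rfl
          exact ⟨Finset.filter_subset _ _, fun i hi => by simp [hi]⟩
        · rintro ⟨h1, h2⟩
          ext i
          rw [Finset.mem_filter]
          exact ⟨fun h => (h2 i h.1).1 h.2, fun h => ⟨h1 h, (h2 i (h1 h)).2 h⟩⟩
      rw [this]
      refine (MeasurableSet.const _).inter (Finset.measurableSet_biInter _ fun i _ => ?_)
      by_cases hi : i ∈ A
      · simpa [hi] using hS i
      · rw [show {x | i ∈ S x ↔ i ∈ A} = {x | i ∈ S x}ᶜ by ext x; simp [hi]]
        exact (hS i).compl
    have hgm : ∀ A, Measurable (g A) := fun A => measurable_one.indicator (hmt _)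
    have hsum : ∀ x y, ((fun z : (ι → Bool) × (ι → Bool) => splice (S z.1)ᶜ z.1 z.2) ⁻¹'
        (Set.pi s t)).indicator (1 : (ι → Bool) × (ι → Bool) → ℝ≥0∞) (x, y) =
          ∑ A ∈ s.powerset, f A x * g A y := by
      intro x y
      rw [Finset.sum_eq_single (s.filter (· ∈ S x))]
      · simp only [f, g, Set.indicator_apply, Set.mem_preimage, Set.mem_inter_iff,
          Set.mem_ofPred_eq, true_and, Pi.one_apply]
        have : (splice (S x)ᶜ x y ∈ Set.pi (s : Set ι) t) ↔
            (x ∈ Set.pi ((s.filter (· ∈ S x) : Finset ι) : Set ι) t ∧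
              y ∈ Set.pi ((s \ s.filter (· ∈ S x) : Finset ι) : Set ι) t) := by
          simp only [Set.mem_pi, Finset.mem_coe, Finset.mem_filter, Finset.mem_sdiff, not_and]
          constructor
          · intro h
            refine ⟨fun i hi => ?_, fun i hi => ?_⟩
            · simpa [splice_of_notMem (S := (S x)ᶜ) (not_not.2 hi.2)] using h i hi.1
            · simpa [splice_of_mem (S := (S x)ᶜ) (hi.2 hi.1)] using h i hi.1
          · intro h i hi
            by_cases hx : i ∈ S x
            · simpa [splice_of_notMem (S := (S x)ᶜ) (not_not.2 hx)] using h.1 i ⟨hi, hx⟩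
            · simpa [splice_of_mem (S := (S x)ᶜ) hx] using h.2 i ⟨hi, fun _ => hx⟩
        rw [if_congr this rfl rfl, ite_and]
        split_ifs <;> simp
      · intro A _ hA
        simp [f, Ne.symm hA]
      · intro h
        exact absurd (Finset.mem_powerset.2 (Finset.filter_subset _ _)) h
    have hsum2 : ∀ x, (Set.pi (s : Set ι) t).indicator (1 : (ι → Bool) → ℝ≥0∞) x
        = ∑ A ∈ s.powerset, f A x * g A x := by
      intro x
      rw [← hsum x x]
      have : splice (S x)ᶜ x x = x := by
        ext i
        by_cases h : i ∈ (S x)ᶜ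
        · rw [splice_of_mem h]
        · rw [splice_of_notMem h]
      simp only [Set.indicator_apply, Set.mem_preimage, this]
      rfl
    simp only [hsum, hsum2]
    have hr : ∫⁻ x, ∑ A ∈ s.powerset, f A x * g A x ∂(bern q)
        = ∑ A ∈ s.powerset, ∫⁻ x, f A x * g A x ∂(bern q) :=
      lintegral_finsetSum _ fun A _ => (hfm A).mul (hgm A)
    rw [hr]
    have : ∀ x, ∫⁻ y, ∑ A ∈ s.powerset, f A x * g A y ∂(bern q)
        = ∑ A ∈ s.powerset, f A x * ∫⁻ y, g A y ∂(bern q) := by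
      intro x
      rw [lintegral_finsetSum _ fun A _ => (hgm A).const_mul _]
      exact Finset.sum_congr rfl fun A _ => lintegral_const_mul _ (hgm A)
    simp only [this]
    rw [lintegral_finsetSum _ fun A _ => (hfm A).mul_const _]
    refine Finset.sum_congr rfl fun A _ => ?_
    have hr2 : ∫⁻ x, f A x * g A x ∂(bern q) = ∫⁻ x, ∫⁻ y,
        f A (splice ((s \ A : Finset ι) : Set ι) x y) * g A (splice ((s \ A : Finset ι) : Set ι) x y)
          ∂(bern q) ∂(bern q) :=
      (lintegral_splice q ((s \ A : Finset ι) : Set ι) ((hfm A).mul (hgm A))).symm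
    rw [lintegral_mul_const _ (hfm A), hr2]
    -- By `hstab`, the event that exactly `A` is explored inside `s` does not depend on the coins of
    -- `s \ A`. Hence `f A` and `g A` are independent.
    have hf' : ∀ x y, f A (splice ((s \ A : Finset ι) : Set ι) x y) = f A x := by
      intro x y
      set z := splice ((s \ A : Finset ι) : Set ι) x y with hz
      have hzx : ∀ i, i ∉ s \ A → z i = x i := fun i hi =>
        splice_of_notMem (by simpa using hi) _ _
      have h1 : s.filter (· ∈ S z) = A ↔ s.filter (· ∈ S x) = A := by
        constructor
        · intro h
          rw [hstab z x fun i hi => hzx i ?_]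
          · exact h
          · rintro hi'
            rw [Finset.mem_sdiff] at hi'
            exact hi'.2 (h ▸ Finset.mem_filter.2 ⟨hi'.1, hi⟩)
        · intro h
          rw [hstab x z fun i hi => (hzx i ?_).symm]
          · exact h
          · rintro hi'
            rw [Finset.mem_sdiff] at hi'
            exact hi'.2 (h ▸ Finset.mem_filter.2 ⟨hi'.1, hi⟩)
      have h2 : z ∈ Set.pi (A : Set ι) t ↔ x ∈ Set.pi (A : Set ι) t := by
        simp only [Set.mem_pi, Finset.mem_coe]
        refine forall₂_congr fun i hi => ?_
        rw [hzx i (by simp [hi])]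
      simp only [f, Set.indicator_apply, Set.mem_inter_iff, Set.mem_ofPred_eq, h1, h2, Pi.one_apply]
    have hg' : ∀ x y, g A (splice ((s \ A : Finset ι) : Set ι) x y) = g A y := by
      intro x y
      have : splice ((s \ A : Finset ι) : Set ι) x y ∈ Set.pi ((s \ A : Finset ι) : Set ι) t ↔
          y ∈ Set.pi ((s \ A : Finset ι) : Set ι) t := by
        simp only [Set.mem_pi]
        refine forall₂_congr fun i hi => ?_
        rw [splice_of_mem hi]
      simp only [g, Set.indicator_apply, this, Pi.one_apply]
    simp only [hf', hg']
    have : ∀ x, ∫⁻ y, f A x * g A y ∂(bern q) = f A x * ∫⁻ y, g A y ∂(bern q) := fun x =>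
      lintegral_const_mul _ (hgm A)
    simp only [this]
    rw [lintegral_mul_const _ (hfm A)]
  conv_rhs => rw [← key]
  rw [lintegral_map hf hm, lintegral_prod]
  exact (hf.comp hm).aemeasurable

/-- Exchanging the coins in a fixed set between two independent samples preserves their law. -/
lemma lintegral_swap (q : ι → I) (S : Set ι) {f : (ι → Bool) → (ι → Bool) → ℝ≥0∞}
    (hf : Measurable (Function.uncurry f)) :
    ∫⁻ x, ∫⁻ y, f (splice S x y) (splice S y x) ∂(bern q) ∂(bern q)
      = ∫⁻ x, ∫⁻ y, f x y ∂(bern q) ∂(bern q) := by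
  -- Resample `S` in both samples, with fresh coins `x'` and `y'`. The exchange of coins then
  -- becomes a mere renaming of `x'` and `y'`.
  have e : ∀ g : (ι → Bool) → (ι → Bool) → ℝ≥0∞, Measurable (Function.uncurry g) →
      ∫⁻ x, ∫⁻ y, g x y ∂(bern q) ∂(bern q) = ∫⁻ x, ∫⁻ y, ∫⁻ x', ∫⁻ y',
        g (splice S x x') (splice S y y') ∂(bern q) ∂(bern q) ∂(bern q) ∂(bern q) := by
    intro g hg
    have h1 : Measurable fun x => ∫⁻ y, g x y ∂(bern q) := hg.lintegral_prod_right'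
    rw [← lintegral_splice q S h1]
    refine lintegral_congr fun x => ?_
    have h2 : ∀ x', ∫⁻ y, g (splice S x x') y ∂(bern q)
        = ∫⁻ y, ∫⁻ y', g (splice S x x') (splice S y y') ∂(bern q) ∂(bern q) := fun x' =>
      (lintegral_splice q S (hg.comp measurable_prodMk_left)).symm
    simp only [h2]
    rw [lintegral_lintegral_swap]
    refine Measurable.aemeasurable (Measurable.lintegral_prod_right' (f := fun z :
      ((ι → Bool) × (ι → Bool)) × (ι → Bool) => g (splice S x z.1.1) (splice S z.1.2 z.2)) ?_)
    exact hg.comp (((measurable_splice S).comp (by fun_prop :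
      Measurable fun z : ((ι → Bool) × (ι → Bool)) × (ι → Bool) => (x, z.1.1))).prodMk
      ((measurable_splice S).comp (by fun_prop :
      Measurable fun z : ((ι → Bool) × (ι → Bool)) × (ι → Bool) => (z.1.2, z.2))))
  have hm : Measurable fun z : (ι → Bool) × (ι → Bool) => (splice S z.1 z.2, splice S z.2 z.1) :=
    (measurable_splice S).prodMk ((measurable_splice S).comp measurable_swap)
  rw [e f hf, e (fun x y => f (splice S x y) (splice S y x)) (hf.comp hm)]
  refine lintegral_congr fun x => lintegral_congr fun y => ?_
  have hs : ∀ x y x' y' : ι → Bool, splice S (splice S x x') (splice S y y') = splice S x y' := by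
    intro x y x' y'
    ext i
    by_cases h : i ∈ S <;> simp [splice, h]
  simp only [hs]
  rw [lintegral_lintegral_swap]
  exact (hf.comp (((measurable_splice S).comp (by fun_prop :
      Measurable fun z : (ι → Bool) × (ι → Bool) => (x, z.2))).prodMk
      ((measurable_splice S).comp (by fun_prop :
      Measurable fun z : (ι → Bool) × (ι → Bool) => (y, z.1))))).aemeasurable

end ProductMeasure

/-! ### Opening finitely many coins -/

section Insertion

variable {ι : Type*}

open Classical in
/-- The configuration `x` with the coins in `B` set to `true`. -/
noncomputable def raise (B : Finset ι) (x : ι → Bool) (i : ι) : Bool :=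
  if i ∈ B then true else x i

lemma raise_of_mem {B : Finset ι} {i : ι} (h : i ∈ B) (x : ι → Bool) : raise B x i = true :=
  if_pos h

lemma raise_of_notMem {B : Finset ι} {i : ι} (h : i ∉ B) (x : ι → Bool) : raise B x i = x i :=
  if_neg h

lemma le_raise (B : Finset ι) (x : ι → Bool) : x ≤ raise B x := by
  intro i
  by_cases h : i ∈ B
  · rw [raise_of_mem h]; exact le_top
  · rw [raise_of_notMem h]

/-- Opening finitely many coins costs at most the probability that they are open. -/
lemma prod_mul_lintegral_raise_le (q : ι → I) (B : Finset ι) {f : (ι → Bool) → ℝ≥0∞}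
    (hf : Measurable f) :
    (∏ i ∈ B, (toNNReal (q i) : ℝ≥0∞)) * ∫⁻ x, f (raise B x) ∂(bern q)
      ≤ ∫⁻ x, f x ∂(bern q) := by
  have hO : MeasurableSet (Set.pi (B : Set ι) fun _ => ({true} : Set Bool)) :=
    MeasurableSet.pi B.countable_toSet fun _ _ => MeasurableSet.of_discrete
  rw [← lintegral_splice q (B : Set ι) hf, mul_comm]
  calc (∫⁻ x, f (raise B x) ∂(bern q)) * ∏ i ∈ B, (toNNReal (q i) : ℝ≥0∞)
      ≤ ∫⁻ x, f (raise B x) * ∏ i ∈ B, (toNNReal (q i) : ℝ≥0∞) ∂(bern q) :=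
        lintegral_mul_const_le _ _
    _ ≤ _ := by
      refine lintegral_mono fun x => ?_
      have hp : ∏ i ∈ B, (toNNReal (q i) : ℝ≥0∞)
          = bern q (Set.pi (B : Set ι) fun _ => ({true} : Set Bool)) := by
        rw [Measure.infinitePi_pi _ fun _ _ => MeasurableSet.of_discrete]
        exact Finset.prod_congr rfl fun i _ => by
          rw [bernoulliMeasure_apply_of_mem_of_notMem _ MeasurableSet.of_discrete] <;> simp
      rw [hp, ← lintegral_indicator_const hO]
      refine lintegral_mono fun y => ?_
      -- If the fresh coins in `B` are all open, resampling `B` has the same effect as raising it.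
      by_cases hy : y ∈ Set.pi (B : Set ι) fun _ => ({true} : Set Bool)
      · rw [Set.indicator_of_mem hy]
        have : raise B x = splice (B : Set ι) x y := by
          ext i
          by_cases h : i ∈ B
          · rw [raise_of_mem h, splice_of_mem (by simpa using h)]
            exact (hy i h).symm
          · rw [raise_of_notMem h, splice_of_notMem (by simpa using h)]
        rw [this]
      · rw [Set.indicator_of_notMem hy]
        exact zero_le

end Insertion

/-! ### Coins as disjunctions of two independent coins -/

section Coupling

variable {ι : Type*}

lemma eq_bernoulliMeasure {ν : Measure Bool} [IsProbabilityMeasure ν] {r : I}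
    (h : ν {false} = toNNReal (σ r)) : ν = bernoulliMeasure true false r := by
  have h1 : bernoulliMeasure true false r {false} = toNNReal (σ r) :=
    bernoulliMeasure_apply_of_notMem_of_mem _ MeasurableSet.of_discrete (by simp) (by simp)
  refine Measure.ext_of_singleton fun b => ?_
  cases b
  · rw [h, h1]
  · have hc : ({true} : Set Bool) = {false}ᶜ := by ext b; cases b <;> simp
    rw [hc, prob_compl_eq_one_sub MeasurableSet.of_discrete,
      prob_compl_eq_one_sub MeasurableSet.of_discrete, h, h1]

/-- Two independent coins for each index, of biases `p` and `ε`. -/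
noncomputable def biasPair (p ε : I) (z : ι × Bool) : I :=
  if z.2 then ε else p

/-- If each coin is the disjunction of two independent coins, it is again a coin. -/
lemma map_or_bern {p ε r : I} (h : σ r = σ p * σ ε) :
    (bern (biasPair (ι := ι) p ε)).map (fun z i => z (i, false) || z (i, true))
      = bern fun _ : ι => r := by
  have h1 := Measure.infinitePi_map_curry
    (fun (i : ι) (b : Bool) => bernoulliMeasure true false (biasPair p ε (i, b)))
  have h2 := Measure.infinitePi_map_pi
    (fun i : ι => Measure.infinitePi fun b : Bool =>
      bernoulliMeasure true false (biasPair p ε (i, b)))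
    (f := fun _ y => y false || y true) (fun _ => measurable_of_countable _)
  have h3 : (fun i : ι => (Measure.infinitePi fun b : Bool =>
      bernoulliMeasure true false (biasPair p ε (i, b))).map fun y => y false || y true)
      = fun _ => bernoulliMeasure true false r := by
    funext i
    have : IsProbabilityMeasure ((Measure.infinitePi fun b : Bool =>
      bernoulliMeasure true false (biasPair p ε (i, b))).map fun y => y false || y true) :=
      Measure.isProbabilityMeasure_map (measurable_of_countable _).aemeasurable
    refine eq_bernoulliMeasure ?_
    rw [Measure.map_apply (measurable_of_countable _) MeasurableSet.of_discrete]
    have hs : (fun y : Bool → Bool => y false || y true) ⁻¹' {false} = {fun _ => false} := by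
      ext y
      simp only [Set.mem_preimage, Set.mem_singleton_iff, Bool.or_eq_false_iff, funext_iff,
        Bool.forall_bool]
    rw [hs, Measure.infinitePi_singleton_of_fintype, Fintype.prod_bool,
      bernoulliMeasure_apply_of_notMem_of_mem _ MeasurableSet.of_discrete (by simp) (by simp),
      bernoulliMeasure_apply_of_notMem_of_mem _ MeasurableSet.of_discrete (by simp) (by simp), h,
      ← ENNReal.coe_mul]
    congr 1
    ext
    simp [biasPair, mul_comm]
  rw [h3, ← h1, Measure.map_map (by fun_prop) (MeasurableEquiv.measurable _)] at h2
  exact h2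

lemma map_fst_bern (p ε : I) :
    (bern (biasPair (ι := ι) p ε)).map (fun z i => z (i, false)) = bern fun _ : ι => p := by
  refine Measure.eq_infinitePi _ fun s t ht => ?_
  classical
  rw [Measure.map_apply (by fun_prop) (MeasurableSet.pi s.countable_toSet fun i _ => ht i)]
  have : (fun (z : ι × Bool → Bool) i => z (i, false)) ⁻¹' (Set.pi s t)
      = Set.pi ((s.map ⟨fun i => (i, false), fun _ _ h => (Prod.ext_iff.1 h).1⟩ : Finset (ι × Bool))
        : Set (ι × Bool)) fun z => t z.1 := by
    ext z
    simp only [Set.mem_preimage, Set.mem_pi, Finset.mem_coe, Finset.forall_mem_map]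
    rfl
  rw [this, Measure.infinitePi_pi _ fun _ _ => MeasurableSet.of_discrete, Finset.prod_map]
  rfl

end Coupling

/-! ### Weights interpolating between disjoint and independent occurrence -/

section BergKesten

variable {ι : Type*}

open Classical in
/-- The largest value of `F` on a finite set of open coins. -/
noncomputable def openSup (F : Finset ι → ℝ≥0∞) (x : ι → Bool) : ℝ≥0∞ :=
  ⨆ A : Finset ι, if ∀ i ∈ A, x i = true then F A else 0

open Classical in
/-- The largest value of `F A * G B` on disjoint finite sets `A`, `B` of open coins. -/
noncomputable def disjSup (F G : Finset ι → ℝ≥0∞) (x : ι → Bool) : ℝ≥0∞ :=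
  ⨆ A : Finset ι, ⨆ B : Finset ι,
    if Disjoint A B ∧ (∀ i ∈ A, x i = true) ∧ (∀ i ∈ B, x i = true) then F A * G B else 0

/-- `A` is open in `x`, `B` is open in the configuration that uses `y` on `D` and `x` off `D`, and
the two are disjoint off `D`. -/
def PartDisj (D A B : Finset ι) (x y : ι → Bool) : Prop :=
  (∀ i ∈ A, i ∈ B → i ∈ D) ∧ (∀ i ∈ A, x i = true) ∧
    (∀ i ∈ B, (i ∈ D → y i = true) ∧ (i ∉ D → x i = true))

open Classical in
/-- The interpolation between disjoint and independent occurrence. -/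
noncomputable def partSup (F G : Finset ι → ℝ≥0∞) (D : Finset ι) (x y : ι → Bool) : ℝ≥0∞ :=
  ⨆ A : Finset ι, ⨆ B : Finset ι, if PartDisj D A B x y then F A * G B else 0

open Classical in
/-- The part of `partSup` in which `A` uses the coin `e`, which is made open. -/
noncomputable def partSupLeft (F G : Finset ι → ℝ≥0∞) (D : Finset ι) (e : ι) (x y : ι → Bool) :
    ℝ≥0∞ :=
  ⨆ A : Finset ι, ⨆ B : Finset ι,
    if e ∈ A ∧ PartDisj D A B (raise {e} x) y then F A * G B else 0

open Classical in
/-- The part of `partSup` in which `B` uses the coin `e`, which is made open. -/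
noncomputable def partSupRight (F G : Finset ι → ℝ≥0∞) (D : Finset ι) (e : ι) (x y : ι → Bool) :
    ℝ≥0∞ :=
  ⨆ A : Finset ι, ⨆ B : Finset ι,
    if e ∈ B ∧ PartDisj D A B (raise {e} x) y then F A * G B else 0

lemma measurable_iSup_ite {α β : Type*} [MeasurableSpace α] [Countable β] {P : β → α → Prop}
    [∀ b a, Decidable (P b a)] {c : β → ℝ≥0∞} (hP : ∀ b, MeasurableSet {a | P b a}) :
    Measurable fun a => ⨆ b, if P b a then c b else 0 :=
  Measurable.iSup fun b => Measurable.ite (hP b) measurable_const measurable_const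

lemma measurableSet_and {α : Type*} [MeasurableSpace α] {P Q : α → Prop}
    (hP : MeasurableSet {a | P a}) (hQ : MeasurableSet {a | Q a}) :
    MeasurableSet {a | P a ∧ Q a} :=
  hP.inter hQ

lemma measurableSet_forall_mem_finset {α : Type*} [MeasurableSpace α] (A : Finset ι)
    {P : ι → α → Prop} (hP : ∀ i, MeasurableSet {a | P i a}) :
    MeasurableSet {a | ∀ i ∈ A, P i a} := by
  have : {a | ∀ i ∈ A, P i a} = ⋂ i ∈ A, {a | P i a} := by ext; simp
  rw [this]
  exact Finset.measurableSet_biInter _ fun i _ => hP i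

lemma measurableSet_coord (i : ι) : MeasurableSet {x : ι → Bool | x i = true} :=
  measurableSet_eq_fun (measurable_pi_apply i) measurable_const

lemma measurableSet_partDisj (D A B : Finset ι) :
    MeasurableSet {z : (ι → Bool) × (ι → Bool) | PartDisj D A B z.1 z.2} := by
  refine measurableSet_and (MeasurableSet.const _) (measurableSet_and ?_ ?_)
  · exact measurableSet_forall_mem_finset A fun i => measurable_fst (measurableSet_coord i)
  · refine measurableSet_forall_mem_finset B fun i => ?_
    by_cases h : i ∈ D
    · simp only [h, true_imp_iff, not_true_eq_false, false_imp_iff, and_true]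
      exact measurable_snd (measurableSet_coord i)
    · simp only [h, true_imp_iff, not_false_eq_true, false_imp_iff, true_and]
      exact measurable_fst (measurableSet_coord i)

lemma measurable_raise (B : Finset ι) : Measurable (raise B) := by
  classical
  refine measurable_pi_lambda _ fun i => ?_
  unfold raise
  split_ifs <;> fun_prop

lemma raise_singleton_eq_self {e : ι} {x : ι → Bool} (h : x e = true) : raise {e} x = x := by
  ext i
  by_cases hi : i ∈ ({e} : Finset ι)
  · rw [raise_of_mem hi, Finset.mem_singleton.1 hi, h]
  · rw [raise_of_notMem hi]

variable [Countable ι]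

lemma measurable_openSup (F : Finset ι → ℝ≥0∞) : Measurable (openSup F) := by
  classical
  exact measurable_iSup_ite fun A => measurableSet_forall_mem_finset A measurableSet_coord

lemma measurable_disjSup (F G : Finset ι → ℝ≥0∞) : Measurable (disjSup F G) := by
  classical
  refine Measurable.iSup fun A => measurable_iSup_ite fun B => ?_
  exact measurableSet_and (MeasurableSet.const _) (measurableSet_and
    (measurableSet_forall_mem_finset A measurableSet_coord)
    (measurableSet_forall_mem_finset B measurableSet_coord))

lemma measurable_partSup (F G : Finset ι → ℝ≥0∞) (D : Finset ι) :
    Measurable (Function.uncurry (partSup F G D)) := by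
  classical
  exact Measurable.iSup fun A => measurable_iSup_ite fun B => measurableSet_partDisj D A B

lemma measurable_partSupLeft (F G : Finset ι → ℝ≥0∞) (D : Finset ι) (e : ι) :
    Measurable (Function.uncurry (partSupLeft F G D e)) := by
  classical
  refine Measurable.iSup fun A => measurable_iSup_ite fun B =>
    measurableSet_and (MeasurableSet.const _) ?_
  exact (((measurable_raise {e}).comp measurable_fst).prodMk measurable_snd)
    (measurableSet_partDisj D A B)

lemma measurable_partSupRight (F G : Finset ι → ℝ≥0∞) (D : Finset ι) (e : ι) :
    Measurable (Function.uncurry (partSupRight F G D e)) := by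
  classical
  refine Measurable.iSup fun A => measurable_iSup_ite fun B =>
    measurableSet_and (MeasurableSet.const _) ?_
  exact (((measurable_raise {e}).comp measurable_fst).prodMk measurable_snd)
    (measurableSet_partDisj D A B)

end BergKesten

/-! ### The van den Berg–Kesten inequality, one coin at a time -/

section BergKesten

variable {ι : Type*}

lemma le_partSup (F G : Finset ι → ℝ≥0∞) {D A B : Finset ι} {x y : ι → Bool}
    (h : PartDisj D A B x y) : F A * G B ≤ partSup F G D x y := by
  classical
  exact le_iSup_of_le A (le_iSup_of_le B (by rw [if_pos h]))

lemma partSupLeft_le [DecidableEq ι] (F G : Finset ι → ℝ≥0∞) {D : Finset ι} {e : ι} (he : e ∉ D)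
    {x y : ι → Bool} (hx : x e = true) :
    partSupLeft F G D e x y ≤ partSup F G (insert e D) x y := by
  classical
  refine iSup₂_le fun A B => ?_
  split_ifs with h
  · obtain ⟨heA, hd, hA, hB⟩ := h
    rw [raise_singleton_eq_self hx] at hA hB
    refine le_partSup F G ⟨fun i hi hi' => Finset.mem_insert_of_mem (hd i hi hi'), hA, ?_⟩
    intro i hi
    have hne : i ≠ e := by rintro rfl; exact he (hd i heA hi)
    simpa [Finset.mem_insert, hne] using hB i hi
  · exact zero_le

/-- Since `e ∉ D`, a witness with `e ∈ B` has `e ∉ A`. After the coins at `e` are exchanged, `A` is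
unaffected and `B` finds the open coin `x e` in the second configuration. -/
lemma partSupRight_le [DecidableEq ι] (F G : Finset ι → ℝ≥0∞) {D : Finset ι} {e : ι} (he : e ∉ D)
    {x y : ι → Bool} (hx : x e = true) :
    partSupRight F G D e x y
      ≤ partSup F G (insert e D) (splice {e} x y) (splice {e} y x) := by
  classical
  refine iSup₂_le fun A B => ?_
  split_ifs with h
  · obtain ⟨heB, hd, hA, hB⟩ := h
    rw [raise_singleton_eq_self hx] at hA hB
    refine le_partSup F G ⟨fun i hi hi' => Finset.mem_insert_of_mem (hd i hi hi'), ?_, ?_⟩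
    · intro i hi
      have hne : i ≠ e := by rintro rfl; exact he (hd i hi heB)
      rw [splice_of_notMem (by simpa using hne)]
      exact hA i hi
    · intro i hi
      by_cases hne : i = e
      · subst hne
        rw [splice_of_mem (Set.mem_singleton i)]
        simp [hx]
      · rw [splice_of_notMem (by simpa using hne), splice_of_notMem (by simpa using hne)]
        simpa [Finset.mem_insert, hne] using hB i hi
  · exact zero_le

/-- Deciding which of the two families uses the coin `e` by comparing what it can gain from it. -/
lemma partSup_le_of_le [DecidableEq ι] (F G : Finset ι → ℝ≥0∞) {D : Finset ι} {e : ι} (he : e ∉ D)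
    {x y : ι → Bool} (h : partSupRight F G D e x y ≤ partSupLeft F G D e x y) :
    partSup F G D x y ≤ partSup F G (insert e D) x y := by
  classical
  refine iSup₂_le fun A B => ?_
  split_ifs with hAB
  · by_cases heB : e ∈ B
    · have hx : x e = true := (hAB.2.2 e heB).2 he
      refine le_trans ?_ (h.trans (partSupLeft_le F G he hx))
      refine le_iSup_of_le A (le_iSup_of_le B ?_)
      rw [raise_singleton_eq_self hx, if_pos ⟨heB, hAB⟩]
    · obtain ⟨hd, hA, hB⟩ := hAB
      refine le_partSup F G ⟨fun i hi hi' => Finset.mem_insert_of_mem (hd i hi hi'), hA, ?_⟩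
      intro i hi
      have hne : i ≠ e := by rintro rfl; exact heB hi
      simpa [Finset.mem_insert, hne] using hB i hi
  · exact zero_le

lemma partSup_le_of_ge [DecidableEq ι] (F G : Finset ι → ℝ≥0∞) {D : Finset ι} {e : ι} (he : e ∉ D)
    {x y : ι → Bool} (h : partSupLeft F G D e x y ≤ partSupRight F G D e x y) :
    partSup F G D x y ≤ partSup F G (insert e D) (splice {e} x y) (splice {e} y x) := by
  classical
  refine iSup₂_le fun A B => ?_
  split_ifs with hAB
  · by_cases heA : e ∈ A
    · have hx : x e = true := hAB.2.1 e heA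
      refine le_trans ?_ (h.trans (partSupRight_le F G he hx))
      refine le_iSup_of_le A (le_iSup_of_le B ?_)
      rw [raise_singleton_eq_self hx, if_pos ⟨heA, hAB⟩]
    · obtain ⟨hd, hA, hB⟩ := hAB
      refine le_partSup F G ⟨fun i hi hi' => Finset.mem_insert_of_mem (hd i hi hi'), ?_, ?_⟩
      · intro i hi
        have hne : i ≠ e := by rintro rfl; exact heA hi
        rw [splice_of_notMem (by simpa using hne)]
        exact hA i hi
      · intro i hi
        by_cases hne : i = e
        · subst hne
          rw [splice_of_mem (Set.mem_singleton i)]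
          simp [(hB i hi).2 he]
        · rw [splice_of_notMem (by simpa using hne), splice_of_notMem (by simpa using hne)]
          simpa [Finset.mem_insert, hne] using hB i hi
  · exact zero_le

lemma raise_splice_singleton (e : ι) (x y : ι → Bool) :
    raise {e} (splice {e} x y) = raise {e} x := by
  ext i
  by_cases hi : i = e
  · rw [raise_of_mem (by simpa using hi), raise_of_mem (by simpa using hi)]
  · rw [raise_of_notMem (by simpa using hi), raise_of_notMem (by simpa using hi),
      splice_of_notMem (by simpa using hi)]

/-- Raising overwrites `x e`, and `y e` is never read because `e ∉ D`. The comparison of the two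
gains is therefore blind to the exchange, as needed for it to decide whether to exchange. -/
lemma partDisj_splice_iff {D A B : Finset ι} {e : ι} (he : e ∉ D) (x y : ι → Bool) :
    PartDisj D A B (raise {e} (splice {e} x y)) (splice {e} y x)
      ↔ PartDisj D A B (raise {e} x) y := by
  rw [raise_splice_singleton]
  refine and_congr_right fun _ => and_congr_right fun _ => forall₂_congr fun i _ =>
    and_congr_left fun _ => imp_congr_right fun hi => ?_
  rw [splice_of_notMem]
  rintro rfl
  exact he hi

lemma le_disjSup {F G : Finset ι → ℝ≥0∞} {A B : Finset ι} {x : ι → Bool} (h : Disjoint A B)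
    (hA : ∀ i ∈ A, x i = true) (hB : ∀ i ∈ B, x i = true) : F A * G B ≤ disjSup F G x := by
  classical
  exact le_iSup_of_le A (le_iSup_of_le B (by rw [if_pos ⟨h, hA, hB⟩]))

lemma partSupRight_splice (F G : Finset ι → ℝ≥0∞) {D : Finset ι} {e : ι} (he : e ∉ D)
    (x y : ι → Bool) :
    partSupRight F G D e (splice {e} x y) (splice {e} y x) = partSupRight F G D e x y := by
  classical
  exact iSup_congr fun _ => iSup_congr fun _ =>
    if_congr (and_congr_right' (partDisj_splice_iff he x y)) rfl rfl

lemma partSupLeft_splice (F G : Finset ι → ℝ≥0∞) {D : Finset ι} {e : ι} (he : e ∉ D)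
    (x y : ι → Bool) :
    partSupLeft F G D e (splice {e} x y) (splice {e} y x) = partSupLeft F G D e x y := by
  classical
  exact iSup_congr fun _ => iSup_congr fun _ =>
    if_congr (and_congr_right' (partDisj_splice_iff he x y)) rfl rfl

open Classical in
/-- The largest value of `F A * G B` for a partition of `C` into `A` and `B`. -/
noncomputable def splitSup (F G : Finset ι → ℝ≥0∞) (C : Finset ι) : ℝ≥0∞ :=
  ⨆ A : Finset ι, ⨆ B : Finset ι, if Disjoint A B ∧ A ∪ B = C then F A * G B else 0

lemma le_disjSup_splitSup {F G H : Finset ι → ℝ≥0∞} {A B C : Finset ι} {x : ι → Bool}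
    (hAB : Disjoint A B) (hAC : Disjoint A C) (hBC : Disjoint B C)
    (hA : ∀ i ∈ A, x i = true) (hB : ∀ i ∈ B, x i = true) (hC : ∀ i ∈ C, x i = true) :
    F A * G B * H C ≤ disjSup (splitSup F G) H x := by
  classical
  refine le_trans (mul_le_mul_left ?_ _) (le_disjSup (A := A ∪ B) (B := C)
    (Finset.disjoint_union_left.2 ⟨hAC, hBC⟩) ?_ hC)
  · exact le_iSup_of_le A (le_iSup_of_le B (by simp [hAB]))
  · intro i hi
    exact (Finset.mem_union.1 hi).elim (hA i) (hB i)

variable [Countable ι]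

/-- When `A` gains at least as much from `e` as `B`, a pair using `e` in `B` may be replaced by one
using it in `A`, so `B` can be given an independent coin at `e`. In the other case the same works
after exchanging the coins at `e`. The event deciding the case is invariant under the exchange,
which preserves the law, so the two cases recombine. -/
lemma lintegral_partSup_le_insert [DecidableEq ι] (q : ι → I) (F G : Finset ι → ℝ≥0∞)
    {D : Finset ι} {e : ι} (he : e ∉ D) :
    ∫⁻ x, ∫⁻ y, partSup F G D x y ∂(bern q) ∂(bern q)
      ≤ ∫⁻ x, ∫⁻ y, partSup F G (insert e D) x y ∂(bern q) ∂(bern q) := by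
  classical
  set P : (ι → Bool) → (ι → Bool) → Prop := fun x y =>
    partSupRight F G D e x y ≤ partSupLeft F G D e x y with hP
  have hPm : MeasurableSet {z : (ι → Bool) × (ι → Bool) | P z.1 z.2} :=
    measurableSet_le (measurable_partSupRight F G D e) (measurable_partSupLeft F G D e)
  have hPs : ∀ x y, P (splice {e} x y) (splice {e} y x) ↔ P x y := by
    intro x y
    simp only [hP, partSupRight_splice F G he, partSupLeft_splice F G he]
  let f₁ : (ι → Bool) → (ι → Bool) → ℝ≥0∞ := fun x y =>
    if P x y then partSup F G (insert e D) x y else 0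
  let f₂ : (ι → Bool) → (ι → Bool) → ℝ≥0∞ := fun x y =>
    if P x y then 0 else partSup F G (insert e D) x y
  have hf₁ : Measurable (Function.uncurry f₁) :=
    Measurable.ite hPm (measurable_partSup F G _) measurable_const
  have hf₂ : Measurable (Function.uncurry f₂) :=
    Measurable.ite hPm measurable_const (measurable_partSup F G _)
  have hadd : ∀ g₁ g₂ : (ι → Bool) → (ι → Bool) → ℝ≥0∞, Measurable (Function.uncurry g₁) →
      ∫⁻ x, ∫⁻ y, (g₁ x y + g₂ x y) ∂(bern q) ∂(bern q) =
        ∫⁻ x, ∫⁻ y, g₁ x y ∂(bern q) ∂(bern q) + ∫⁻ x, ∫⁻ y, g₂ x y ∂(bern q) ∂(bern q) := by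
    intro g₁ g₂ h₁
    have h1 : Measurable fun x => ∫⁻ y, g₁ x y ∂(bern q) := h₁.lintegral_prod_right'
    rw [← lintegral_add_left h1]
    exact lintegral_congr fun x => lintegral_add_left (h₁.comp measurable_prodMk_left) _
  calc ∫⁻ x, ∫⁻ y, partSup F G D x y ∂(bern q) ∂(bern q)
      ≤ ∫⁻ x, ∫⁻ y, (f₁ x y + f₂ (splice {e} x y) (splice {e} y x)) ∂(bern q) ∂(bern q) := by
        refine lintegral_mono fun x => lintegral_mono fun y => ?_
        by_cases h : P x y
        · simp only [f₁, f₂, if_pos h, if_pos ((hPs x y).2 h), add_zero]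
          exact partSup_le_of_le F G he h
        · simp only [f₁, f₂, if_neg h, if_neg (mt (hPs x y).1 h), zero_add]
          exact partSup_le_of_ge F G he (not_le.1 h).le
    _ = ∫⁻ x, ∫⁻ y, (f₁ x y + f₂ x y) ∂(bern q) ∂(bern q) := by
        rw [hadd _ _ hf₁, hadd _ _ hf₁, lintegral_swap q {e} hf₂]
    _ = _ := by
        refine lintegral_congr fun x => lintegral_congr fun y => ?_
        by_cases h : P x y <;> simp [f₁, f₂, h]

lemma lintegral_partSup_le [DecidableEq ι] (q : ι → I) (F G : Finset ι → ℝ≥0∞) (D : Finset ι) :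
    ∫⁻ x, disjSup F G x ∂(bern q)
      ≤ ∫⁻ x, ∫⁻ y, partSup F G D x y ∂(bern q) ∂(bern q) := by
  induction D using Finset.induction_on with
  | empty =>
    refine lintegral_mono fun x => ?_
    have : ∀ y, disjSup F G x ≤ partSup F G ∅ x y := by
      intro y
      refine iSup₂_le fun A B => ?_
      split_ifs with h
      · refine le_partSup F G ⟨fun i hi hi' => ?_, h.2.1, fun i hi => ⟨by simp, fun _ => h.2.2 i hi⟩⟩
        exact absurd hi' (Finset.disjoint_left.1 h.1 hi)
      · exact zero_le
    calc disjSup F G x = ∫⁻ _, disjSup F G x ∂(bern q) := by simp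
      _ ≤ _ := lintegral_mono fun y => this y
  | insert e D he ih => exact ih.trans (lintegral_partSup_le_insert q F G he)

/-- The van den Berg–Kesten inequality, for suprema of weights of disjoint sets of open coins. -/
theorem lintegral_disjSup_le (q : ι → I) (F G : Finset ι → ℝ≥0∞) :
    ∫⁻ x, disjSup F G x ∂(bern q)
      ≤ (∫⁻ x, openSup F x ∂(bern q)) * ∫⁻ x, openSup G x ∂(bern q) := by
  classical
  -- Restrict to sets inside a finite `D`; monotone convergence recovers the full supremum.
  let R : (Finset ι → ℝ≥0∞) → Finset ι → Finset ι → ℝ≥0∞ := fun F D A => if A ⊆ D then F A else 0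
  have hsup : ∀ x, disjSup F G x = ⨆ D, disjSup (R F D) (R G D) x := by
    intro x
    refine le_antisymm (iSup₂_le fun A B => ?_) (iSup_le fun D => ?_)
    · refine le_iSup_of_le (A ∪ B) (le_iSup_of_le A (le_iSup_of_le B ?_))
      simp [R]
    · refine iSup_mono fun A => iSup_mono fun B => ?_
      split_ifs
      · exact mul_le_mul' (by simp only [R]; split_ifs <;> simp)
          (by simp only [R]; split_ifs <;> simp)
      · exact le_rfl
  have hdir : Directed (· ≤ ·) fun D => disjSup (R F D) (R G D) := by
    refine Monotone.directed_le fun D D' hD x => ?_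
    have hR : ∀ (F : Finset ι → ℝ≥0∞) A, R F D A ≤ R F D' A := by
      intro F A
      by_cases h : A ⊆ D
      · simp [R, h, h.trans hD]
      · simp [R, h]
    refine iSup_mono fun A => iSup_mono fun B => ?_
    split_ifs
    · exact mul_le_mul' (hR F A) (hR G B)
    · exact le_rfl
  simp only [hsup]
  rw [lintegral_iSup_directed (fun D => (measurable_disjSup _ _).aemeasurable) hdir]
  -- With all of `D` interpolated and `B ⊆ D`, the set `B` is read from `y` alone, so the supremum
  -- is at most a product of independent factors.
  refine iSup_le fun D => (lintegral_partSup_le q _ _ D).trans ?_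
  calc ∫⁻ x, ∫⁻ y, partSup (R F D) (R G D) D x y ∂(bern q) ∂(bern q)
      ≤ ∫⁻ x, ∫⁻ y, openSup F x * openSup G y ∂(bern q) ∂(bern q) := by
        refine lintegral_mono fun x => lintegral_mono fun y => iSup₂_le fun A B => ?_
        split_ifs with h
        · by_cases hA : A ⊆ D
          · by_cases hB : B ⊆ D
            · simp only [R, if_pos hA, if_pos hB]
              refine mul_le_mul' (le_iSup_of_le A ?_) (le_iSup_of_le B ?_)
              · rw [if_pos h.2.1]
              · rw [if_pos fun i hi => (h.2.2 i hi).1 (hB hi)]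
            · simp [R, hB]
          · simp [R, hA]
        · exact zero_le
    _ = _ := by
        simp_rw [lintegral_const_mul _ (measurable_openSup G)]
        rw [lintegral_mul_const _ (measurable_openSup F)]

/-- The two-set inequality is applied twice: an open set split into two disjoint parts is a disjoint
occurrence of those parts. -/
lemma lintegral_disjSup_splitSup_le (q : ι → I) (F G H : Finset ι → ℝ≥0∞) :
    ∫⁻ x, disjSup (splitSup F G) H x ∂(bern q)
      ≤ (∫⁻ x, openSup F x ∂(bern q)) * (∫⁻ x, openSup G x ∂(bern q))
          * ∫⁻ x, openSup H x ∂(bern q) := by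
  classical
  refine (lintegral_disjSup_le q _ _).trans (mul_le_mul_left ?_ _)
  refine le_trans (lintegral_mono fun x => ?_) (lintegral_disjSup_le q F G)
  refine iSup_le fun C => ?_
  split_ifs with hC
  · refine iSup₂_le fun A B => ?_
    split_ifs with h
    · obtain ⟨h, rfl⟩ := h
      exact le_disjSup h (fun i hi => hC i (Finset.mem_union_left _ hi))
        fun i hi => hC i (Finset.mem_union_right _ hi)
    · exact zero_le
  · exact zero_le

end BergKesten

/-! ### Weights of open walks and their measurability -/

section WalkWeight

variable {V : Type*} {G : SimpleGraph V}

lemma openGraph_adj {ω : G.edgeSet → Bool} {a b : V} :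
    (openGraph ω).Adj a b ↔ ∃ h : s(a, b) ∈ G.edgeSet, ω ⟨s(a, b), h⟩ = true := by
  unfold openGraph
  rw [SimpleGraph.fromEdgeSet_adj]
  refine ⟨fun h => h.1, fun h => ⟨h, ?_⟩⟩
  obtain ⟨h, -⟩ := h
  exact G.ne_of_adj h

lemma openGraph_le (ω : G.edgeSet → Bool) : openGraph ω ≤ G := by
  intro a b h
  exact (openGraph_adj.1 h).1

lemma openGraph_mono {ω ω' : G.edgeSet → Bool} (h : ω ≤ ω') : openGraph ω ≤ openGraph ω' := by
  intro a b hab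
  obtain ⟨he, ho⟩ := openGraph_adj.1 hab
  exact openGraph_adj.2 ⟨he, Bool.eq_true_of_true_le (ho ▸ h _)⟩

/-- The edges of `G` in a list. -/
noncomputable def edgesOf (l : List (Sym2 V)) : Finset G.edgeSet :=
  Set.Finite.toFinset (s := {e : G.edgeSet | (e : Sym2 V) ∈ l})
    (Set.Finite.preimage Subtype.val_injective.injOn l.finite_toSet)

lemma mem_edgesOf {l : List (Sym2 V)} {e : G.edgeSet} : e ∈ edgesOf l ↔ (e : Sym2 V) ∈ l := by
  simp [edgesOf]

lemma card_edgesOf_le (l : List (Sym2 V)) : (edgesOf (G := G) l).card ≤ l.length := by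
  classical
  calc (edgesOf (G := G) l).card = ((edgesOf (G := G) l).image Subtype.val).card :=
        (Finset.card_image_of_injective _ Subtype.val_injective).symm
    _ ≤ l.toFinset.card := Finset.card_le_card fun e he => by
        obtain ⟨e', he', rfl⟩ := Finset.mem_image.1 he
        exact List.mem_toFinset.2 (mem_edgesOf.1 he')
    _ ≤ l.length := List.toFinset_card_le l

lemma exists_walk_of_open {H : SimpleGraph V} (hH : H ≤ G) {u v : V} (p : H.Walk u v)
    {ω : G.edgeSet → Bool} (h : ∀ e : G.edgeSet, (e : Sym2 V) ∈ p.edges → ω e = true) :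
    ∃ q : (openGraph ω).Walk u v, q.edges = p.edges := by
  refine ⟨p.transfer (openGraph ω) fun e he => ?_, SimpleGraph.Walk.edges_transfer _ _⟩
  have heG : e ∈ G.edgeSet := SimpleGraph.edgeSet_mono hH (p.edges_subset_edgeSet he)
  induction e with
  | _ a b => exact openGraph_adj.2 ⟨heG, h ⟨_, heG⟩ he⟩

lemma open_of_mem_edges {ω : G.edgeSet → Bool} {u v : V} (p : (openGraph ω).Walk u v)
    {e : G.edgeSet} (he : (e : Sym2 V) ∈ p.edges) : ω e = true := by
  obtain ⟨e, hG⟩ := e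
  induction e with
  | _ a b => exact (openGraph_adj.1 (p.adj_of_mem_edges he)).2

lemma length_eq_of_edges_eq {H H' : SimpleGraph V} {u v : V} {p : H.Walk u v} {q : H'.Walk u v}
    (h : q.edges = p.edges) : q.length = p.length := by
  rw [← SimpleGraph.Walk.length_edges, h, SimpleGraph.Walk.length_edges]

/-- The largest weight `f n` over the lengths `n` of the open walks from `u` to `v`. -/
noncomputable def walkSup (f : ℕ → ℝ≥0∞) (ω : G.edgeSet → Bool) (u v : V) : ℝ≥0∞ :=
  ⨆ p : (openGraph ω).Walk u v, f p.length

lemma le_walkSup (f : ℕ → ℝ≥0∞) {ω : G.edgeSet → Bool} {u v : V} (p : (openGraph ω).Walk u v) :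
    f p.length ≤ walkSup f ω u v :=
  le_iSup (fun p : (openGraph ω).Walk u v => f p.length) p

lemma walkSup_mono (f : ℕ → ℝ≥0∞) {ω ω' : G.edgeSet → Bool} (h : ω ≤ ω') (u v : V) :
    walkSup f ω u v ≤ walkSup f ω' u v := by
  refine iSup_le fun p => ?_
  rw [← SimpleGraph.Walk.length_mapLe (h := openGraph_mono h) p]
  exact le_walkSup f _

/-- A shortest walk is optimal for antitone `f`; for powers of `α` this is where `α ≤ 1` enters.
Unlike `dInt`, the supremum over walks is monotone in the configuration and vanishes off the
cluster. -/
lemma walkSup_of_reachable {f : ℕ → ℝ≥0∞} (hf : Antitone f) {ω : G.edgeSet → Bool} {u v : V}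
    (h : (openGraph ω).Reachable u v) : walkSup f ω u v = f (dInt ω u v) := by
  refine le_antisymm (iSup_le fun p => hf (SimpleGraph.dist_le p)) ?_
  obtain ⟨p, hp⟩ := h.exists_walk_length_eq_dist
  rw [dInt, ← hp]
  exact le_walkSup f p

lemma walkSup_of_not_reachable (f : ℕ → ℝ≥0∞) {ω : G.edgeSet → Bool} {u v : V}
    (h : ¬ (openGraph ω).Reachable u v) : walkSup f ω u v = 0 := by
  refine le_antisymm (iSup_le fun p => (h ⟨p⟩).elim) zero_le

lemma exists_walk_length_succ_iff {H : SimpleGraph V} {n : ℕ} {u v : V} :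
    (∃ p : H.Walk u v, p.length = n + 1) ↔ ∃ w, H.Adj u w ∧ ∃ p : H.Walk w v, p.length = n := by
  constructor
  · rintro ⟨p, hp⟩
    cases p with
    | nil => simp at hp
    | cons h p => exact ⟨_, h, p, by simpa using hp⟩
  · rintro ⟨w, h, p, hp⟩
    exact ⟨.cons h p, by simpa using hp⟩

lemma measurableSet_openGraph_adj (a b : V) :
    MeasurableSet {ω : G.edgeSet → Bool | (openGraph ω).Adj a b} := by
  simp only [openGraph_adj]
  by_cases h : s(a, b) ∈ G.edgeSet
  · simp only [h, exists_true_left]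
    exact measurableSet_coord _
  · simp only [h, IsEmpty.exists_iff]
    exact MeasurableSet.const _

variable [Countable V]

lemma measurableSet_exists_walk (n : ℕ) (u v : V) :
    MeasurableSet {ω : G.edgeSet → Bool | ∃ p : (openGraph ω).Walk u v, p.length = n} := by
  induction n generalizing u with
  | zero =>
    have : ∀ ω : G.edgeSet → Bool, (∃ p : (openGraph ω).Walk u v, p.length = 0) ↔ u = v := by
      intro ω
      constructor
      · rintro ⟨p, hp⟩
        exact SimpleGraph.Walk.eq_of_length_eq_zero hp
      · rintro rfl
        exact ⟨.nil, rfl⟩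
    simp only [this]
    exact MeasurableSet.const _
  | succ n ih =>
    have : {ω : G.edgeSet → Bool | ∃ p : (openGraph ω).Walk u v, p.length = n + 1}
        = ⋃ w, {ω | (openGraph ω).Adj u w ∧ ∃ p : (openGraph ω).Walk w v, p.length = n} := by
      ext ω
      simp only [exists_walk_length_succ_iff, Set.mem_iUnion, Set.mem_ofPred_eq]
    rw [this]
    exact MeasurableSet.iUnion fun w =>
      measurableSet_and (measurableSet_openGraph_adj u w) (ih w)

lemma measurable_walkSup (f : ℕ → ℝ≥0∞) (u v : V) :
    Measurable fun ω : G.edgeSet → Bool => walkSup f ω u v := by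
  classical
  have : (fun ω : G.edgeSet → Bool => walkSup f ω u v)
      = fun ω => ⨆ n, if ∃ p : (openGraph ω).Walk u v, p.length = n then f n else 0 := by
    funext ω
    refine le_antisymm (iSup_le fun p => le_iSup_of_le p.length ?_) (iSup_le fun n => ?_)
    · rw [if_pos ⟨p, rfl⟩]
    · split_ifs with h
      · obtain ⟨p, rfl⟩ := h
        exact le_walkSup f p
      · exact zero_le
  rw [this]
  exact measurable_iSup_ite fun n => measurableSet_exists_walk n u v

lemma measurableSet_reachable (u v : V) :
    MeasurableSet {ω : G.edgeSet → Bool | (openGraph ω).Reachable u v} := by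
  have : {ω : G.edgeSet → Bool | (openGraph ω).Reachable u v}
      = ⋃ n, {ω | ∃ p : (openGraph ω).Walk u v, p.length = n} := by
    ext ω
    simp only [Set.mem_iUnion, Set.mem_ofPred_eq]
    exact ⟨fun ⟨p⟩ => ⟨_, p, rfl⟩, fun ⟨_, p, _⟩ => ⟨p⟩⟩
  rw [this]
  exact MeasurableSet.iUnion fun n => measurableSet_exists_walk n u v

lemma measurable_dInt (u v : V) : Measurable fun ω : G.edgeSet → Bool => dInt ω u v := by
  refine measurable_to_countable' fun n => ?_
  -- The last piece is present because `dInt` takes the default value `0` on disconnected pairs.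
  have : (fun ω : G.edgeSet → Bool => dInt ω u v) ⁻¹' {n}
      = ({ω | ∃ p : (openGraph ω).Walk u v, p.length = n} ∩
          ⋂ m : ℕ, {ω | m < n → ¬ ∃ p : (openGraph ω).Walk u v, p.length = m})
        ∪ ({ω | n = 0} ∩ {ω | (openGraph ω).Reachable u v}ᶜ) := by
    ext ω
    simp only [Set.mem_preimage, Set.mem_singleton_iff, Set.mem_union, Set.mem_inter_iff,
      Set.mem_iInter, Set.mem_ofPred_eq, Set.mem_compl_iff]
    constructor
    · rintro rfl
      by_cases h : (openGraph ω).Reachable u v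
      · refine Or.inl ⟨h.exists_walk_length_eq_dist, ?_⟩
        rintro m hm ⟨p, rfl⟩
        exact absurd (SimpleGraph.dist_le p) (not_le.2 hm)
      · exact Or.inr ⟨SimpleGraph.dist_eq_zero_of_not_reachable h, h⟩
    · rintro (⟨⟨p, rfl⟩, h⟩ | ⟨rfl, h⟩)
      · refine le_antisymm (SimpleGraph.dist_le p) (not_lt.1 fun hlt => h _ hlt ?_)
        exact p.reachable.exists_walk_length_eq_dist
      · exact SimpleGraph.dist_eq_zero_of_not_reachable h
  rw [this]
  refine MeasurableSet.union (MeasurableSet.inter (measurableSet_exists_walk n u v) ?_)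
    ((MeasurableSet.const _).inter (measurableSet_reachable u v).compl)
  refine MeasurableSet.iInter fun m => ?_
  by_cases hm : m < n
  · simp only [hm, true_imp_iff]
    exact (measurableSet_exists_walk m u v).compl
  · simp only [hm, false_imp_iff]
    exact MeasurableSet.const _

end WalkWeight

/-! ### Mean weights and edge-disjoint connections -/

section TwoPoint

variable {V : Type*} {G : SimpleGraph V}

open Classical in
/-- The configuration whose open edges are those in `A`. -/
noncomputable def onlyOpen (A : Finset G.edgeSet) : G.edgeSet → Bool := fun e => decide (e ∈ A)

/-- The weight `walkSup` of the finite sets of edges. -/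
noncomputable def setWeight (f : ℕ → ℝ≥0∞) (u v : V) (A : Finset G.edgeSet) : ℝ≥0∞ :=
  walkSup f (onlyOpen A) u v

lemma openSup_setWeight_le (f : ℕ → ℝ≥0∞) (u v : V) (ω : G.edgeSet → Bool) :
    openSup (setWeight f u v) ω ≤ walkSup f ω u v := by
  classical
  refine iSup_le fun A => ?_
  split_ifs with h
  · refine walkSup_mono f (fun e => ?_) u v
    by_cases he : e ∈ A
    · rw [h e he]; exact le_top
    · simp [onlyOpen, he]
  · exact zero_le

lemma le_setWeight_edgesOf (f : ℕ → ℝ≥0∞) {ω : G.edgeSet → Bool} {u v : V}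
    (p : (openGraph ω).Walk u v) : f p.length ≤ setWeight (G := G) f u v (edgesOf p.edges) := by
  obtain ⟨q, hq⟩ := exists_walk_of_open (openGraph_le ω) p (ω := onlyOpen (edgesOf p.edges))
    fun e he => by simpa [onlyOpen, mem_edgesOf] using he
  rw [← length_eq_of_edges_eq hq]
  exact le_walkSup f q

lemma disjoint_edgesOf {l l' : List (Sym2 V)} (h : ∀ e ∈ l, e ∉ l') :
    Disjoint (edgesOf (G := G) l) (edgesOf l') :=
  Finset.disjoint_left.2 fun e he he' => h e (mem_edgesOf.1 he) (mem_edgesOf.1 he')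

/-- Two open walks without common edges. -/
lemma mul_le_disjSup_setWeight (f g : ℕ → ℝ≥0∞) {ω : G.edgeSet → Bool} {u v u' v' : V}
    (p : (openGraph ω).Walk u v) (p' : (openGraph ω).Walk u' v')
    (h : ∀ e ∈ p.edges, e ∉ p'.edges) :
    f p.length * g p'.length ≤ disjSup (setWeight f u v) (setWeight g u' v') ω :=
  (mul_le_mul' (le_setWeight_edgesOf f p) (le_setWeight_edgesOf g p')).trans
    (le_disjSup (disjoint_edgesOf h) (fun _ he => open_of_mem_edges p (mem_edgesOf.1 he))
      fun _ he => open_of_mem_edges p' (mem_edgesOf.1 he))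

/-- Three open walks without common edges. -/
lemma mul_mul_le_disjSup_setWeight (f g h : ℕ → ℝ≥0∞) {ω : G.edgeSet → Bool}
    {u v u' v' u'' v'' : V} (p : (openGraph ω).Walk u v) (p' : (openGraph ω).Walk u' v')
    (p'' : (openGraph ω).Walk u'' v'')
    (h1 : ∀ e ∈ p.edges, e ∉ p'.edges) (h2 : ∀ e ∈ p.edges, e ∉ p''.edges)
    (h3 : ∀ e ∈ p'.edges, e ∉ p''.edges) :
    f p.length * g p'.length * h p''.length
      ≤ disjSup (splitSup (setWeight f u v) (setWeight g u' v')) (setWeight h u'' v'') ω :=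
  (mul_le_mul' (mul_le_mul' (le_setWeight_edgesOf f p) (le_setWeight_edgesOf g p'))
    (le_setWeight_edgesOf h p'')).trans
    (le_disjSup_splitSup (disjoint_edgesOf h1) (disjoint_edgesOf h2) (disjoint_edgesOf h3)
      (fun _ he => open_of_mem_edges p (mem_edgesOf.1 he))
      (fun _ he => open_of_mem_edges p' (mem_edgesOf.1 he))
      fun _ he => open_of_mem_edges p'' (mem_edgesOf.1 he))

lemma walkSup_comm (f : ℕ → ℝ≥0∞) (ω : G.edgeSet → Bool) (u v : V) :
    walkSup f ω u v = walkSup f ω v u := by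
  have : ∀ u v, walkSup f ω u v ≤ walkSup f ω v u := fun u v => iSup_le fun p => by
    rw [← p.length_reverse]; exact le_walkSup f _
  exact le_antisymm (this u v) (this v u)

variable (G) in
/-- The expectation of `walkSup`. -/
noncomputable def meanWeight (p : I) (f : ℕ → ℝ≥0∞) (u v : V) : ℝ≥0∞ :=
  ∫⁻ ω, walkSup f ω u v ∂(law G p)

instance (p : I) : IsProbabilityMeasure (law G p) :=
  inferInstanceAs (IsProbabilityMeasure (bern fun _ : G.edgeSet => p))

variable [Countable V]

lemma lintegral_disjSup_setWeight_le (p : I) (f g : ℕ → ℝ≥0∞) (u v u' v' : V) :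
    ∫⁻ ω, disjSup (setWeight f u v) (setWeight g u' v') ω ∂(law G p)
      ≤ meanWeight G p f u v * meanWeight G p g u' v' :=
  (lintegral_disjSup_le (fun _ => p) _ _).trans
    (mul_le_mul' (lintegral_mono fun ω => openSup_setWeight_le f u v ω)
      (lintegral_mono fun ω => openSup_setWeight_le g u' v' ω))

lemma lintegral_disjSup_setWeight_le₃ (p : I) (f g h : ℕ → ℝ≥0∞) (u v u' v' u'' v'' : V) :
    ∫⁻ ω, disjSup (splitSup (setWeight f u v) (setWeight g u' v')) (setWeight h u'' v'') ω
        ∂(law G p)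
      ≤ meanWeight G p f u v * meanWeight G p g u' v' * meanWeight G p h u'' v'' :=
  (lintegral_disjSup_splitSup_le (fun _ => p) _ _ _).trans
    (mul_le_mul' (mul_le_mul' (lintegral_mono fun ω => openSup_setWeight_le f u v ω)
      (lintegral_mono fun ω => openSup_setWeight_le g u' v' ω))
      (lintegral_mono fun ω => openSup_setWeight_le h u'' v'' ω))

lemma T_eq_meanWeight (p : I) (u v : V) : T G p u v = meanWeight G p (fun _ => 1) u v := by
  unfold T meanWeight
  have hm : MeasurableSet {ω : G.edgeSet → Bool | v ∈ cluster ω u} := measurableSet_reachable u v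
  rw [← lintegral_indicator_one hm]
  refine lintegral_congr fun ω => ?_
  by_cases h : (openGraph ω).Reachable u v
  · rw [walkSup_of_reachable antitone_const h]
    exact Set.indicator_of_mem (show ω ∈ {ω : G.edgeSet → Bool | v ∈ cluster ω u} from h) _
  · rw [walkSup_of_not_reachable _ h]
    exact Set.indicator_of_notMem (show ω ∉ {ω : G.edgeSet → Bool | v ∈ cluster ω u} from h) _

lemma T_comm (p : I) (u v : V) : T G p u v = T G p v u := by
  simp only [T_eq_meanWeight, meanWeight, walkSup_comm _ _ u v]

/-- The weight `n ↦ α ^ n`. -/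
noncomputable def powWeight (α : ℝ≥0) (n : ℕ) : ℝ≥0∞ := (α : ℝ≥0∞) ^ n

lemma antitone_powWeight {α : ℝ≥0} (hα : α ≤ 1) : Antitone (powWeight α) := fun _ _ h =>
  pow_le_pow_right_of_le_one' (by exact_mod_cast hα) h

lemma powWeight_add (α : ℝ≥0) (m n : ℕ) : powWeight α (m + n) = powWeight α m * powWeight α n :=
  pow_add _ _ _

lemma gen_eq_tsum (p : I) {α : ℝ≥0} (hα : α ≤ 1) (u : V) :
    gen G p α u = ∑' v, meanWeight G p (powWeight α) u v := by
  unfold gen meanWeight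
  rw [← lintegral_tsum fun v => (measurable_walkSup (powWeight α) u v).aemeasurable]
  refine lintegral_congr fun ω => ?_
  rw [tsum_subtype (cluster ω u) fun v => (α : ℝ≥0∞) ^ dInt ω u v]
  refine tsum_congr fun v => ?_
  by_cases h : (openGraph ω).Reachable u v
  · rw [walkSup_of_reachable (antitone_powWeight hα) h]
    exact Set.indicator_of_mem (show v ∈ cluster ω u from h) _
  · rw [walkSup_of_not_reachable _ h]
    exact Set.indicator_of_notMem (show v ∉ cluster ω u from h) _

/-- For `α ≤ 1` one has `α ^ d ≤ α ^ (d - 1)`, so the surgery argument may count with the full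
power. -/
lemma tsum_lintegral_dist_le_derivGen (p : I) {α : ℝ≥0} (hα : α ≤ 1) (u : V) :
    ∑' v, ∫⁻ ω, dInt ω u v * walkSup (powWeight α) ω u v ∂(law G p) ≤ derivGen G p α u := by
  unfold derivGen
  have hm : ∀ v, Measurable fun ω : G.edgeSet → Bool =>
      (dInt ω u v : ℝ≥0∞) * walkSup (powWeight α) ω u v := by
    exact fun v => (measurable_from_top.comp (measurable_dInt u v)).mul (measurable_walkSup _ u v)
  rw [← lintegral_tsum fun v => (hm v).aemeasurable]
  refine lintegral_mono fun ω => ?_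
  rw [tsum_subtype (cluster ω u) fun v => (dInt ω u v : ℝ≥0∞) * (α : ℝ≥0∞) ^ (dInt ω u v - 1)]
  refine ENNReal.tsum_le_tsum fun v => ?_
  by_cases h : (openGraph ω).Reachable u v
  · rw [walkSup_of_reachable (antitone_powWeight hα) h]
    rw [Set.indicator_of_mem (show v ∈ cluster ω u from h)]
    exact mul_le_mul_right (antitone_powWeight hα (Nat.sub_le _ 1)) _
  · rw [walkSup_of_not_reachable _ h, mul_zero]
    exact zero_le

end TwoPoint

/-! ### Independent samples against distinct clusters -/

section Decoupling

variable {V : Type*} {G : SimpleGraph V}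

/-- Stop the walk at its first visit to the support of `p`. An edge used before that has an endpoint
off the support, so it is not an edge of `p`. -/
lemma exists_walk_to_support {H : SimpleGraph V} {a b x y : V} (p : H.Walk a b) (q : H.Walk x y)
    (hy : y ∈ p.support) : ∃ z ∈ p.support, ∃ r : H.Walk x z, ∀ e ∈ r.edges, e ∉ p.edges := by
  induction q with
  | nil => exact ⟨_, hy, .nil, by simp⟩
  | @cons x x' y h q ih =>
    by_cases hx : x ∈ p.support
    · exact ⟨x, hx, .nil, by simp⟩
    · obtain ⟨z, hz, r, hr⟩ := ih hy
      refine ⟨z, hz, .cons h r, fun e he hp => ?_⟩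
      rw [SimpleGraph.Walk.edges_cons, List.mem_cons] at he
      rcases he with rfl | he
      · exact hx (p.fst_mem_support_of_mem_edges hp)
      · exact hr e he hp

lemma exists_split_path {H : SimpleGraph V} {a b z : V} {p : H.Walk a b} (hp : p.IsPath)
    (hz : z ∈ p.support) : ∃ (p₁ : H.Walk a z) (p₂ : H.Walk z b), p₁.length + p₂.length = p.length ∧
      (∀ e ∈ p₁.edges, e ∉ p₂.edges) ∧ (∀ e ∈ p₁.edges, e ∈ p.edges) ∧
      ∀ e ∈ p₂.edges, e ∈ p.edges := by
  classical
  refine ⟨p.takeUntil z hz, p.dropUntil z hz, ?_, ?_, ?_, ?_⟩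
  · conv_rhs => rw [← p.take_spec hz]
    rw [SimpleGraph.Walk.length_append]
  · have h := hp.isTrail.edges_nodup
    rw [← p.take_spec hz, SimpleGraph.Walk.edges_append, List.nodup_append] at h
    exact fun e he he' => h.2.2 e he e he' rfl
  · exact fun e he => p.edges_takeUntil_subset_edges hz he
  · exact fun e he => p.edges_dropUntil_subset_edges hz he

lemma powWeight_le_of_le {α : ℝ≥0} (hα : α ≤ 1) {m n : ℕ} (h : m ≤ n) :
    powWeight α n ≤ powWeight α m :=
  antitone_powWeight hα h

/-- The tree-graph decomposition of three connected vertices. -/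
lemma walkSup_mul_walkSup_le {α : ℝ≥0} (hα : α ≤ 1) (ω : G.edgeSet → Bool) (u w x : V) :
    walkSup (powWeight α) ω u w * walkSup (fun _ => 1) ω u x
      ≤ ∑' z, disjSup (splitSup (setWeight (powWeight α) u z) (setWeight (fun _ => 1) z w))
          (setWeight (fun _ => 1) z x) ω := by
  by_cases hw : (openGraph ω).Reachable u w
  · by_cases hx : (openGraph ω).Reachable u x
    · rw [walkSup_of_reachable (antitone_powWeight hα) hw, walkSup_of_reachable antitone_const hx,
        mul_one]
      obtain ⟨p, hp, hlen⟩ := hw.exists_path_of_dist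
      obtain ⟨q⟩ := hx.symm
      -- The branch point `z` is where a walk from `x` first meets the geodesic from `u` to `w`.
      obtain ⟨z, hz, r, hr⟩ := exists_walk_to_support p q p.start_mem_support
      obtain ⟨p₁, p₂, hl, hd, h₁, h₂⟩ := exists_split_path hp hz
      refine le_trans ?_ (ENNReal.le_tsum z)
      have hrr : ∀ e ∈ p.edges, e ∉ r.reverse.edges := by
        intro e he he'
        rw [SimpleGraph.Walk.edges_reverse, List.mem_reverse] at he'
        exact hr e he' he
      refine le_trans ?_ (mul_mul_le_disjSup_setWeight (powWeight α) (fun _ => 1) (fun _ => 1)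
        p₁ p₂ r.reverse hd (fun e he => hrr e (h₁ e he)) fun e he => hrr e (h₂ e he))
      rw [mul_one, mul_one, dInt, ← hlen]
      -- Only the segment from `u` to `z` keeps its powers of `α`; the other two legs get weight
      -- `1`.
      exact powWeight_le_of_le hα (by omega)
    · rw [walkSup_of_not_reachable _ hx, mul_zero]
      exact zero_le
  · rw [walkSup_of_not_reachable _ hw, zero_mul]
    exact zero_le

lemma walkSup_le_disjSup {α : ℝ≥0} {ω : G.edgeSet → Bool} {a x b : V}
    {p : (openGraph ω).Walk a b} (hp : p.IsPath) (hx : x ∈ p.support) (hα : α ≤ 1)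
    (hlen : p.length = (openGraph ω).dist a b) :
    walkSup (powWeight α) ω a b
      ≤ disjSup (setWeight (fun _ => 1) a x) (setWeight (powWeight α) x b) ω := by
  rw [walkSup_of_reachable (antitone_powWeight hα) p.reachable]
  obtain ⟨p₁, p₂, hl, hd, -, -⟩ := exists_split_path hp hx
  refine le_trans ?_ (mul_le_disjSup_setWeight (fun _ => 1) (powWeight α) p₁ p₂ hd)
  rw [one_mul, dInt, ← hlen]
  exact powWeight_le_of_le hα (by omega)

/-- The edges that touch the cluster of `u`. -/
def touched (u : V) (ω : G.edgeSet → Bool) : Set G.edgeSet :=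
  {e | ∃ a ∈ (e : Sym2 V), (openGraph ω).Reachable u a}

/-- Walking out from `u`, each inspected edge touches a vertex already reached and so lies in
`touched u ω`. The cluster is thus explored by looking only at the edges that touch it. -/
lemma reachable_iff_of_agree {u : V} {ω η : G.edgeSet → Bool}
    (h : ∀ e ∈ touched u ω, ω e = η e) (a : V) :
    (openGraph η).Reachable u a ↔ (openGraph ω).Reachable u a := by
  constructor
  · intro ha
    rw [SimpleGraph.reachable_iff_reflTransGen] at ha
    induction ha with
    | refl => exact .rfl
    | tail _ hbc ih =>
      obtain ⟨he, ho⟩ := openGraph_adj.1 hbc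
      refine ih.trans (SimpleGraph.Adj.reachable (openGraph_adj.2 ⟨he, ?_⟩))
      rw [h ⟨_, he⟩ ⟨_, Sym2.mem_mk_left _ _, ih⟩, ho]
  · intro ha
    rw [SimpleGraph.reachable_iff_reflTransGen] at ha
    induction ha with
    | refl => exact .rfl
    | tail hb hbc ih =>
      obtain ⟨he, ho⟩ := openGraph_adj.1 hbc
      refine ih.trans (SimpleGraph.Adj.reachable (openGraph_adj.2 ⟨he, ?_⟩))
      rw [← h ⟨_, he⟩ ⟨_, Sym2.mem_mk_left _ _,
        (SimpleGraph.reachable_iff_reflTransGen _ _).2 hb⟩, ho]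

lemma touched_eq_of_agree {u : V} {ω η : G.edgeSet → Bool}
    (h : ∀ e ∈ touched u ω, ω e = η e) : touched u η = touched u ω := by
  ext e
  exact exists_congr fun a => and_congr_right fun _ => reachable_iff_of_agree h a

open Classical in
/-- The weight of a pair of vertices `w ∈ K_u` and `v ∈ K_{w'}` in distinct clusters. -/
noncomputable def sepWeight (α : ℝ≥0) (u w w' v : V) (ω : G.edgeSet → Bool) : ℝ≥0∞ :=
  if (openGraph ω).Reachable u w' then 0
  else walkSup (powWeight α) ω u w * walkSup (powWeight α) ω w' v

/-- Comparison of two independent configurations with the one that explores `K_u` in the first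
one and is completed by the second one. -/
lemma walkSup_mul_walkSup_le_sepWeight {α : ℝ≥0} (hα : α ≤ 1) (ω ω' : G.edgeSet → Bool)
    (u w w' v : V) :
    walkSup (powWeight α) ω u w * walkSup (powWeight α) ω' w' v
      ≤ sepWeight α u w w' v (splice (touched u ω)ᶜ ω ω')
        + ∑' x, (walkSup (powWeight α) ω u w * walkSup (fun _ => 1) ω u x)
            * disjSup (setWeight (fun _ => 1) w' x) (setWeight (powWeight α) x v) ω' := by
  by_cases hv : (openGraph ω').Reachable w' v
  · obtain ⟨p, hp, hlen⟩ := hv.exists_path_of_dist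
    by_cases hx : ∃ x ∈ p.support, (openGraph ω).Reachable u x
    · obtain ⟨x, hx, hux⟩ := hx
      refine le_add_left (le_trans ?_ (ENNReal.le_tsum x))
      rw [walkSup_of_reachable antitone_const hux, mul_one]
      exact mul_le_mul_right (walkSup_le_disjSup hp hx hα hlen) _
    · push Not at hx
      refine le_add_right ?_
      set η := splice (touched u ω)ᶜ ω ω' with hη
      have hag : ∀ e ∈ touched u ω, ω e = η e := fun e he =>
        (splice_of_notMem (S := (touched u ω)ᶜ) (not_not.2 he) ω ω').symm
      have hw' : ¬ (openGraph η).Reachable u w' := fun h =>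
        hx w' p.start_mem_support ((reachable_iff_of_agree hag w').1 h)
      rw [sepWeight, if_neg hw']
      refine mul_le_mul' (iSup_le fun r => ?_) ?_
      · obtain ⟨r', hr'⟩ := exists_walk_of_open (openGraph_le ω) r (ω := η) fun e he => by
          rw [← hag e, open_of_mem_edges r he]
          obtain ⟨e, hG⟩ := e
          induction e with
          | _ a b =>
            classical
            exact ⟨a, Sym2.mem_mk_left _ _,
              ⟨r.takeUntil a (r.fst_mem_support_of_mem_edges he)⟩⟩
        rw [← length_eq_of_edges_eq hr']
        exact le_walkSup _ r'
      · rw [walkSup_of_reachable (antitone_powWeight hα) hv]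
        obtain ⟨p', hp'⟩ := exists_walk_of_open (openGraph_le ω') p (ω := η) fun e he => by
          rw [← open_of_mem_edges p he]
          refine splice_of_mem (S := (touched u ω)ᶜ) ?_ ω ω'
          rintro ⟨a, hae, ha⟩
          exact hx a (p.mem_support_of_mem_edges he hae) ha
        rw [dInt, ← hlen, ← length_eq_of_edges_eq hp']
        exact le_walkSup _ p'
  · rw [walkSup_of_not_reachable _ hv, mul_zero]
    exact zero_le

variable [Countable V]

instance : Countable G.edgeSet := inferInstance

lemma measurable_sepWeight (α : ℝ≥0) (u w w' v : V) :
    Measurable (sepWeight (G := G) α u w w' v) := by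
  classical
  exact Measurable.ite (measurableSet_reachable u w') measurable_const
    ((measurable_walkSup _ u w).mul (measurable_walkSup _ w' v))

lemma measurableSet_mem_touched (u : V) (e : G.edgeSet) :
    MeasurableSet {ω : G.edgeSet → Bool | e ∈ touched u ω} := by
  have : {ω : G.edgeSet → Bool | e ∈ touched u ω}
      = ⋃ a, ({ω | a ∈ (e : Sym2 V)} ∩ {ω | (openGraph ω).Reachable u a}) := by
    ext ω
    simp only [touched, Set.mem_iUnion, Set.mem_inter_iff, Set.mem_ofPred_eq]
  rw [this]
  exact MeasurableSet.iUnion fun a => (MeasurableSet.const _).inter (measurableSet_reachable u a)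

lemma lintegral_walkSup_mul_walkSup_le (p : I) {α : ℝ≥0} (hα : α ≤ 1) (u w x : V) :
    ∫⁻ ω, walkSup (powWeight α) ω u w * walkSup (fun _ => 1) ω u x ∂(law G p)
      ≤ ∑' z, meanWeight G p (powWeight α) u z * T G p z w * T G p z x := by
  refine (lintegral_mono fun ω => walkSup_mul_walkSup_le hα ω u w x).trans ?_
  rw [lintegral_tsum fun z => (measurable_disjSup _ _).aemeasurable]
  refine ENNReal.tsum_le_tsum fun z => ?_
  rw [T_eq_meanWeight, T_eq_meanWeight]
  exact lintegral_disjSup_setWeight_le₃ p _ _ _ _ _ _ _ _ _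

lemma lintegral_lintegral_add_tsum {Ω β : Type*} [MeasurableSpace Ω] [Countable β]
    (μ : Measure Ω) [SFinite μ] {s : Ω → Ω → ℝ≥0∞} {a b : β → Ω → ℝ≥0∞}
    (hs : Measurable fun z : Ω × Ω => s z.1 z.2) (ha : ∀ x, Measurable (a x))
    (hb : ∀ x, Measurable (b x)) :
    ∫⁻ ω, ∫⁻ ω', (s ω ω' + ∑' x, a x ω * b x ω') ∂μ ∂μ
      = ∫⁻ ω, ∫⁻ ω', s ω ω' ∂μ ∂μ + ∑' x, (∫⁻ ω, a x ω ∂μ) * ∫⁻ ω', b x ω' ∂μ := by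
  have h1 : ∀ ω, ∫⁻ ω', (s ω ω' + ∑' x, a x ω * b x ω') ∂μ
      = ∫⁻ ω', s ω ω' ∂μ + ∑' x, a x ω * ∫⁻ ω', b x ω' ∂μ := by
    intro ω
    have hs' : Measurable (s ω) := hs.comp measurable_prodMk_left
    rw [lintegral_add_left hs', lintegral_tsum fun x => ((hb x).const_mul _).aemeasurable]
    congr 1
    exact tsum_congr fun x => lintegral_const_mul _ (hb x)
  have hs' : Measurable fun ω => ∫⁻ ω', s ω ω' ∂μ := hs.lintegral_prod_right'
  simp_rw [h1]
  rw [lintegral_add_left hs', lintegral_tsum fun x => ((ha x).mul_const _).aemeasurable]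
  congr 1
  exact tsum_congr fun x => lintegral_mul_const _ (ha x)

/-- Splicing along the exploration of `K_u` preserves the law, which gives the first term. In the
error the two samples remain independent: the first contributes a three-legged tree, the second a
geodesic cut at `x`. -/
lemma meanWeight_mul_meanWeight_le (p : I) {α : ℝ≥0} (hα : α ≤ 1) (u w w' v : V) :
    meanWeight G p (powWeight α) u w * meanWeight G p (powWeight α) w' v
      ≤ ∫⁻ ω, sepWeight α u w w' v ω ∂(law G p)
        + ∑' x, (∑' z, meanWeight G p (powWeight α) u z * T G p z w * T G p z x)
            * (T G p w' x * meanWeight G p (powWeight α) x v) := by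
  have hm : ∀ (f : ℕ → ℝ≥0∞) (a b : V), Measurable fun ω : G.edgeSet → Bool => walkSup f ω a b :=
    measurable_walkSup
  have e1 : meanWeight G p (powWeight α) u w * meanWeight G p (powWeight α) w' v
      = ∫⁻ ω, ∫⁻ ω', walkSup (powWeight α) ω u w * walkSup (powWeight α) ω' w' v
          ∂(law G p) ∂(law G p) := by
    simp_rw [lintegral_const_mul _ (hm (powWeight α) w' v)]
    rw [lintegral_mul_const _ (hm _ u w)]
    rfl
  have hms : Measurable fun z : (G.edgeSet → Bool) × (G.edgeSet → Bool) =>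
      sepWeight α u w w' v (splice (touched u z.1)ᶜ z.1 z.2) :=
    (measurable_sepWeight α u w w' v).comp
      (measurable_splice_random (S := fun ω => (touched u ω)ᶜ)
        fun e => (measurableSet_mem_touched u e).compl)
  have hmt : ∀ x, Measurable (disjSup (setWeight (G := G) (fun _ => 1) w' x)
      (setWeight (powWeight α) x v)) := fun x => measurable_disjSup _ _
  rw [e1]
  refine (lintegral_mono fun ω => lintegral_mono fun ω' =>
    walkSup_mul_walkSup_le_sepWeight hα ω ω' u w w' v).trans ?_
  have hmm : ∀ x, Measurable fun ω : G.edgeSet → Bool =>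
      walkSup (powWeight α) ω u w * walkSup (fun _ => 1) ω u x := fun x =>
    (hm _ u w).mul (hm _ u x)
  rw [lintegral_lintegral_add_tsum _ hms hmm hmt]
  refine add_le_add (le_of_eq (lintegral_splice_random (fun _ => p)
    (measurableSet_mem_touched u) (fun x y h => touched_eq_of_agree h)
    (measurable_sepWeight α u w w' v))) ?_
  refine ENNReal.tsum_le_tsum fun x => ?_
  refine mul_le_mul' (lintegral_walkSup_mul_walkSup_le p hα u w x) ?_
  rw [T_eq_meanWeight]
  exact lintegral_disjSup_setWeight_le p _ _ _ _ _ _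

end Decoupling

/-! ### Joining two clusters by opening a short path -/

section Surgery

variable {V : Type*} {G : SimpleGraph V}

lemma walkSup_mul_walkSup_le_trans {α : ℝ≥0} (hα : α ≤ 1) (ω : G.edgeSet → Bool) (u v w : V) :
    walkSup (powWeight α) ω u v * walkSup (powWeight α) ω v w ≤ walkSup (powWeight α) ω u w := by
  by_cases h1 : (openGraph ω).Reachable u v
  · by_cases h2 : (openGraph ω).Reachable v w
    · rw [walkSup_of_reachable (antitone_powWeight hα) h1,
        walkSup_of_reachable (antitone_powWeight hα) h2, dInt, dInt, ← powWeight_add]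
      obtain ⟨p, hp⟩ := h1.exists_walk_length_eq_dist
      obtain ⟨q, hq⟩ := h2.exists_walk_length_eq_dist
      rw [← hp, ← hq, ← SimpleGraph.Walk.length_append]
      exact le_walkSup _ _
    · rw [walkSup_of_not_reachable _ h2, mul_zero]
      exact zero_le
  · rw [walkSup_of_not_reachable _ h1, zero_mul]
    exact zero_le

open Classical in
/-- The configuration `ω` with the edges in `B` closed. -/
noncomputable def lower (B : Finset G.edgeSet) (ω : G.edgeSet → Bool) (e : G.edgeSet) : Bool :=
  if e ∈ B then false else ω e

open Classical in
/-- The weight of a pair of vertices that are connected only through `B`. -/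
noncomputable def cutWeight (α : ℝ≥0) (B : Finset G.edgeSet) (u v : V) (ω : G.edgeSet → Bool) :
    ℝ≥0∞ :=
  if (openGraph (lower B ω)).Reachable u v then 0 else walkSup (powWeight α) ω u v

lemma lower_raise_le (B : Finset G.edgeSet) (ω : G.edgeSet → Bool) : lower B (raise B ω) ≤ ω := by
  intro e
  by_cases h : e ∈ B
  · simp [lower, h]
  · simp [lower, h, raise]

lemma pow_length_le_walkSup_raise (α : ℝ≥0) {w w' : V} (γ : G.Walk w w') (ω : G.edgeSet → Bool) :
    (α : ℝ≥0∞) ^ γ.length ≤ walkSup (powWeight α) (raise (edgesOf γ.edges) ω) w w' := by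
  obtain ⟨q, hq⟩ := exists_walk_of_open le_rfl γ (ω := raise (edgesOf γ.edges) ω) fun e he =>
    raise_of_mem (mem_edgesOf.2 he) ω
  rw [← length_eq_of_edges_eq hq]
  exact le_walkSup (powWeight α) q

/-- With `γ` open, the legs `u`–`w`, `γ` and `w'`–`v` concatenate to a connection from `u` to `v`.
Closing `γ` again leaves a configuration below `ω`, in which `v` still lies in the cluster of `w'`
or is cut off further, so `u` and `v` are separated. -/
lemma pow_mul_sepWeight_le {α : ℝ≥0} (hα : α ≤ 1) {k : ℕ} {u w w' v : V} (γ : G.Walk w' w)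
    (hγ : γ.length ≤ k) (ω : G.edgeSet → Bool) :
    (α : ℝ≥0∞) ^ k * sepWeight α u w w' v ω
      ≤ cutWeight α (edgesOf γ.edges) u v (raise (edgesOf γ.edges) ω) := by
  unfold sepWeight
  split_ifs with h
  · simp
  · by_cases hv : (openGraph ω).Reachable w' v
    · have hcut : ¬ (openGraph (lower (edgesOf γ.edges)
          (raise (edgesOf γ.edges) ω))).Reachable u v := fun hr =>
        h ((hr.mono (openGraph_mono (lower_raise_le _ _))).trans hv.symm)
      rw [cutWeight, if_neg hcut]
      set η := raise (edgesOf γ.edges) ω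
      calc (α : ℝ≥0∞) ^ k * (walkSup (powWeight α) ω u w * walkSup (powWeight α) ω w' v)
          ≤ walkSup (powWeight α) η w' w *
              (walkSup (powWeight α) η u w * walkSup (powWeight α) η w' v) :=
            mul_le_mul' ((powWeight_le_of_le hα hγ).trans (pow_length_le_walkSup_raise α γ ω))
              (mul_le_mul' (walkSup_mono _ (le_raise _ _) _ _)
                (walkSup_mono _ (le_raise _ _) _ _))
        _ = walkSup (powWeight α) η u w * walkSup (powWeight α) η w w'
              * walkSup (powWeight α) η w' v := by
            rw [walkSup_comm _ _ w' w]; ring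
        _ ≤ _ := (mul_le_mul_left (walkSup_mul_walkSup_le_trans hα η u w w') _).trans
            (walkSup_mul_walkSup_le_trans hα η u w' v)
    · rw [walkSup_of_not_reachable _ hv]
      simp

lemma exists_mem_edgesOf_of_cut {B : Finset G.edgeSet} {u v : V} {ω : G.edgeSet → Bool}
    (h : ¬ (openGraph (lower B ω)).Reachable u v) (q : (openGraph ω).Walk u v) :
    ∃ e ∈ edgesOf (G := G) q.edges, e ∈ B := by
  by_contra! hB
  obtain ⟨q', -⟩ := exists_walk_of_open (openGraph_le ω) q (ω := lower B ω) fun e he => by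
    rw [lower, if_neg (hB e (mem_edgesOf.2 he)), open_of_mem_edges q he]
  exact h ⟨q'⟩

open Classical in
/-- A geodesic meets few of the sets of edges of a family that covers each edge a bounded number
of times. -/
lemma tsum_mul_cutWeight_le {β : Type*} {α : ℝ≥0} (c : β → ℝ≥0∞)
    (B : β → Finset G.edgeSet) {M : ℝ≥0∞}
    (hM : ∀ e, ∑' b, c b * (if e ∈ B b then 1 else 0) ≤ M) (u v : V) (ω : G.edgeSet → Bool) :
    ∑' b, c b * cutWeight α (B b) u v ω ≤ M * (dInt ω u v * walkSup (powWeight α) ω u v) := by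
  by_cases h : (openGraph ω).Reachable u v
  -- Fix one geodesic. Every cut set that counts must contain one of its edges, so a union bound
  -- over its `dInt` edges suffices.
  · obtain ⟨q, hq⟩ := h.exists_walk_length_eq_dist
    have hb : ∀ b, cutWeight α (B b) u v ω ≤ ∑ e ∈ edgesOf (G := G) q.edges,
        (if e ∈ B b then 1 else 0) * walkSup (powWeight α) ω u v := by
      intro b
      unfold cutWeight
      split_ifs with hc
      · exact zero_le
      · obtain ⟨e, he, heB⟩ := exists_mem_edgesOf_of_cut hc q
        refine le_trans ?_ (Finset.single_le_sum (fun _ _ => zero_le) he)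
        simp [heB]
    calc ∑' b, c b * cutWeight α (B b) u v ω
        ≤ ∑' b, ∑ e ∈ edgesOf (G := G) q.edges,
            (c b * (if e ∈ B b then 1 else 0)) * walkSup (powWeight α) ω u v := by
          refine ENNReal.tsum_le_tsum fun b => (mul_le_mul_right (hb b) _).trans (le_of_eq ?_)
          rw [Finset.mul_sum]
          exact Finset.sum_congr rfl fun e _ => (mul_assoc _ _ _).symm
      _ = ∑ e ∈ edgesOf (G := G) q.edges,
            (∑' b, c b * (if e ∈ B b then 1 else 0)) * walkSup (powWeight α) ω u v := by
          rw [Summable.tsum_finsetSum fun _ _ => ENNReal.summable]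
          exact Finset.sum_congr rfl fun e _ => ENNReal.tsum_mul_right
      _ ≤ ∑ e ∈ edgesOf (G := G) q.edges, M * walkSup (powWeight α) ω u v :=
          Finset.sum_le_sum fun e _ => mul_le_mul_left (hM e) _
      _ = (edgesOf (G := G) q.edges).card * (M * walkSup (powWeight α) ω u v) := by
          rw [Finset.sum_const, nsmul_eq_mul]
      _ ≤ dInt ω u v * (M * walkSup (powWeight α) ω u v) := by
          refine mul_le_mul_left ?_ _
          rw [dInt, ← hq, ← SimpleGraph.Walk.length_edges]
          exact_mod_cast card_edgesOf_le _
      _ = _ := by ring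
  · have : ∀ b, cutWeight α (B b) u v ω = 0 := by
      intro b
      unfold cutWeight
      split_ifs
      · rfl
      · exact walkSup_of_not_reachable _ h
    simp [this]

lemma measurable_lower (B : Finset G.edgeSet) : Measurable (lower B) := by
  classical
  refine measurable_pi_lambda _ fun i => ?_
  unfold lower
  split_ifs <;> fun_prop

lemma pow_mul_lintegral_raise_le [Countable V] (p : I) {k : ℕ} {w w' : V} (γ : G.Walk w' w)
    (hγ : γ.length ≤ k) {f : (G.edgeSet → Bool) → ℝ≥0∞} (hf : Measurable f) :
    (toNNReal p : ℝ≥0∞) ^ k * ∫⁻ ω, f (raise (edgesOf γ.edges) ω) ∂(law G p)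
      ≤ ∫⁻ ω, f ω ∂(law G p) := by
  refine le_trans (mul_le_mul_left ?_ _)
    (prod_mul_lintegral_raise_le (fun _ => p) (edgesOf γ.edges) hf)
  rw [Finset.prod_const]
  refine pow_le_pow_right_of_le_one' ?_ ((card_edgesOf_le _).trans
    (by rwa [SimpleGraph.Walk.length_edges]))
  exact_mod_cast p.2.2

variable [Countable V]

lemma measurable_cutWeight (α : ℝ≥0) (B : Finset G.edgeSet) (u v : V) :
    Measurable (cutWeight α B u v) := by
  classical
  exact Measurable.ite (measurable_lower B (measurableSet_reachable u v)) measurable_const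
    (measurable_walkSup _ u v)

lemma pow_mul_lintegral_sepWeight_le (p : I) {α : ℝ≥0} (hα : α ≤ 1) {k : ℕ} {u w w' v : V}
    (γ : G.Walk w' w) (hγ : γ.length ≤ k) :
    ((toNNReal p * α : ℝ≥0) : ℝ≥0∞) ^ k * ∫⁻ ω, sepWeight α u w w' v ω ∂(law G p)
      ≤ ∫⁻ ω, cutWeight α (edgesOf γ.edges) u v ω ∂(law G p) := by
  refine le_trans ?_ (pow_mul_lintegral_raise_le p γ hγ (measurable_cutWeight α _ u v))
  rw [ENNReal.coe_mul, mul_pow, mul_assoc]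
  refine mul_le_mul_right ?_ _
  rw [← lintegral_const_mul _ (measurable_sepWeight α u w w' v)]
  exact lintegral_mono fun ω => pow_mul_sepWeight_le hα γ hγ ω

end Surgery

/-! ### Random walk kernels and counting of short walks -/

section RandomWalk

variable {V : Type*} {G : SimpleGraph V}

lemma tsum_ite_le_card {β : Type*} {P : β → Prop} [DecidablePred P] (s : Finset β)
    (h : ∀ b, P b → b ∈ s) :
    ∑' b, (if P b then (1 : ℝ≥0∞) else 0) ≤ s.card := by
  rw [tsum_eq_sum (s := s) fun b hb => if_neg fun hP => hb (h b hP)]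
  calc ∑ b ∈ s, (if P b then (1 : ℝ≥0∞) else 0) ≤ ∑ b ∈ s, 1 :=
        Finset.sum_le_sum fun b _ => by split_ifs <;> simp
    _ = s.card := by simp

variable [G.LocallyFinite]

open Classical in
lemma tsum_adj_or_eq_le {D : ℕ} (hD : ∀ v, G.degree v + 1 ≤ D) (c : V) :
    ∑' b, (if c = b ∨ G.Adj c b then (1 : ℝ≥0∞) else 0) ≤ D := by
  refine (tsum_ite_le_card (insert c (G.neighborFinset c)) fun b hb => ?_).trans ?_
  · rcases hb with rfl | hb
    · exact Finset.mem_insert_self _ _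
    · exact Finset.mem_insert_of_mem ((G.mem_neighborFinset _ _).2 hb)
  · exact_mod_cast (Finset.card_insert_le _ _).trans (by
      rw [SimpleGraph.card_neighborFinset_eq_degree]; exact hD c)

open Classical in
lemma tsum_exists_walk_le {D : ℕ} (hD : ∀ v, G.degree v + 1 ≤ D) (k : ℕ) (a : V) :
    ∑' b, (if ∃ p : G.Walk b a, p.length ≤ k then (1 : ℝ≥0∞) else 0) ≤ (D : ℝ≥0∞) ^ k := by
  induction k with
  | zero =>
    refine (tsum_ite_le_card {a} fun b hb => ?_).trans (by simp)
    obtain ⟨p, hp⟩ := hb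
    exact Finset.mem_singleton.2 (SimpleGraph.Walk.eq_of_length_eq_zero (Nat.le_zero.1 hp))
  | succ k ih =>
    calc ∑' b, (if ∃ p : G.Walk b a, p.length ≤ k + 1 then (1 : ℝ≥0∞) else 0)
        ≤ ∑' b, ∑' c, (if ∃ p : G.Walk c a, p.length ≤ k then (1 : ℝ≥0∞) else 0)
            * (if c = b ∨ G.Adj c b then 1 else 0) := by
          refine ENNReal.tsum_le_tsum fun b => ?_
          split_ifs with h
          · obtain ⟨p, hp⟩ := h
            have : ∃ c, (∃ p : G.Walk c a, p.length ≤ k) ∧ (c = b ∨ G.Adj c b) := by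
              cases p with
              | nil => exact ⟨_, ⟨.nil, by simp⟩, Or.inl rfl⟩
              | cons hadj p => exact ⟨_, ⟨p, by simpa using hp⟩, Or.inr hadj.symm⟩
            obtain ⟨c, h1, h2⟩ := this
            refine le_trans ?_ (ENNReal.le_tsum c)
            rw [if_pos h1, if_pos h2, mul_one]
          · exact zero_le
      _ = ∑' c, (if ∃ p : G.Walk c a, p.length ≤ k then (1 : ℝ≥0∞) else 0)
            * ∑' b, (if c = b ∨ G.Adj c b then 1 else 0) := by
          rw [ENNReal.tsum_comm]
          exact tsum_congr fun c => ENNReal.tsum_mul_left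
      _ ≤ ∑' c, (if ∃ p : G.Walk c a, p.length ≤ k then (1 : ℝ≥0∞) else 0) * D :=
          ENNReal.tsum_le_tsum fun c => mul_le_mul_right (tsum_adj_or_eq_le hD c) _
      _ ≤ _ := by
          rw [ENNReal.tsum_mul_right, pow_succ]
          exact mul_le_mul_left ih _

lemma srw_ne_zero {u v : V} (h : srw G u v ≠ 0) : u = v ∨ G.Adj u v := by
  unfold srw at h
  split_ifs at h <;> simp_all

lemma exists_walk_of_mpow_srw_ne_zero {k : ℕ} {u v : V} (h : mpow (srw G) k u v ≠ 0) :
    ∃ p : G.Walk u v, p.length ≤ k := by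
  induction k generalizing v with
  | zero =>
    have : u = v := by by_contra hne; simp [mpow, hne] at h
    subst this
    exact ⟨.nil, by simp⟩
  | succ k ih =>
    simp only [mpow, mmul, ne_eq, ENNReal.tsum_eq_zero, not_forall, mul_eq_zero, not_or] at h
    obtain ⟨w, h1, h2⟩ := h
    obtain ⟨p, hp⟩ := ih h1
    rcases srw_ne_zero h2 with rfl | hadj
    · exact ⟨p, by omega⟩
    · exact ⟨p.concat hadj, by simpa using hp⟩

lemma tsum_adj (u : V) (c : ℝ≥0∞) [DecidablePred (G.Adj u)] :
    ∑' v, (if G.Adj u v then c else 0) = G.degree u * c := by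
  rw [tsum_eq_sum (s := G.neighborFinset u) fun v hv => if_neg fun h =>
    hv ((G.mem_neighborFinset _ _).2 h)]
  rw [Finset.sum_congr rfl fun v hv => if_pos ((G.mem_neighborFinset _ _).1 hv), Finset.sum_const,
    nsmul_eq_mul, SimpleGraph.card_neighborFinset_eq_degree]

lemma tsum_srw (u : V) : ∑' v, srw G u v = 1 := by
  classical
  unfold srw
  split_ifs with h
  · simp
  · rw [tsum_adj u, ENNReal.mul_inv_cancel (by exact_mod_cast h) (by simp)]

lemma tsum_mpow_srw (k : ℕ) (u : V) : ∑' v, mpow (srw G) k u v = 1 := by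
  classical
  induction k with
  | zero => simp [mpow]
  | succ k ih =>
    simp only [mpow, mmul]
    rw [ENNReal.tsum_comm]
    simp_rw [ENNReal.tsum_mul_left, tsum_srw, mul_one]
    exact ih

/-- The degree, or `1` at an isolated vertex: an invariant measure of simple random walk. -/
noncomputable def srwMass (G : SimpleGraph V) [G.LocallyFinite] (v : V) : ℝ≥0∞ :=
  max (G.degree v) 1

lemma tsum_srwMass_mul_srw (v : V) : ∑' u, srwMass G u * srw G u v = srwMass G v := by
  classical
  by_cases hv : G.degree v = 0
  · rw [tsum_eq_single v]
    · simp [srw, hv]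
    · intro u hu
      have : ¬ G.Adj u v := fun h => by
        rw [← SimpleGraph.card_neighborFinset_eq_degree, Finset.card_eq_zero] at hv
        have := (G.mem_neighborFinset v u).2 h.symm
        simp [hv] at this
      simp [srw, hu, this]
  · have : ∀ u, srwMass G u * srw G u v = if G.Adj v u then 1 else 0 := by
      intro u
      by_cases hadj : G.Adj v u
      · have hu : G.degree u ≠ 0 := by
          rw [← SimpleGraph.card_neighborFinset_eq_degree]
          exact Finset.card_ne_zero_of_mem ((G.mem_neighborFinset u v).2 hadj.symm)
        have h1 : (1 : ℝ≥0∞) ≤ G.degree u := by exact_mod_cast Nat.one_le_iff_ne_zero.2 hu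
        rw [if_pos hadj, srw, if_neg hu, if_pos hadj.symm, srwMass, max_eq_left h1,
          ENNReal.mul_inv_cancel (by exact_mod_cast hu) (by simp)]
      · have hne : srw G u v = 0 := by
          by_contra h
          rcases srw_ne_zero h with rfl | h
          · exact h (by simp [srw, hv])
          · exact hadj h.symm
        rw [hne, mul_zero, if_neg hadj]
    simp_rw [this]
    have h1 : (1 : ℝ≥0∞) ≤ G.degree v := by exact_mod_cast Nat.one_le_iff_ne_zero.2 hv
    rw [tsum_adj, mul_one, srwMass, max_eq_left h1]

lemma tsum_srwMass_mul_mpow (k : ℕ) (v : V) :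
    ∑' u, srwMass G u * mpow (srw G) k u v = srwMass G v := by
  classical
  induction k generalizing v with
  | zero => simp [mpow]
  | succ k ih =>
    simp only [mpow, mmul]
    simp_rw [← ENNReal.tsum_mul_left]
    rw [ENNReal.tsum_comm]
    simp_rw [← mul_assoc, ENNReal.tsum_mul_right, ih]
    exact tsum_srwMass_mul_srw v

/-- The powers of the kernel have unit row sums but need not have unit column sums. The invariant
measure `srwMass` lies between `1` and `D`, which bounds the column sums below by `1 / D`. -/
lemma one_le_mul_tsum_mpow {D : ℕ} (hD : ∀ v, G.degree v + 1 ≤ D) (k : ℕ) (v : V) :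
    1 ≤ (D : ℝ≥0∞) * ∑' u, mpow (srw G) k u v := by
  rw [← ENNReal.tsum_mul_left]
  calc (1 : ℝ≥0∞) ≤ srwMass G v := le_max_right _ _
    _ = ∑' u, srwMass G u * mpow (srw G) k u v := (tsum_srwMass_mul_mpow k v).symm
    _ ≤ _ := ENNReal.tsum_le_tsum fun u => mul_le_mul_left (max_le
        (by exact_mod_cast (Nat.le_succ _).trans (hD u))
        (by exact_mod_cast (Nat.le_add_left 1 _).trans (hD u))) _

end RandomWalk

/-! ### Automorphism invariance and comparison of base vertices -/

section Automorphism

variable {V : Type*} {G : SimpleGraph V}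

/-- The image of a configuration under an automorphism. -/
def pull (φ : G ≃g G) (ω : G.edgeSet → Bool) (e : G.edgeSet) : Bool := ω (φ.mapEdgeSet e)

lemma map_pull_law (p : I) (φ : G ≃g G) : (law G p).map (pull φ) = law G p := by
  have h := Measure.infinitePi_map_piCongrLeft
    (μ := fun _ : G.edgeSet => bernoulliMeasure true false p) φ.mapEdgeSet.symm
  have hf : (MeasurableEquiv.piCongrLeft (fun _ : G.edgeSet => Bool) φ.mapEdgeSet.symm
      : (G.edgeSet → Bool) → (G.edgeSet → Bool)) = pull φ := by
    funext ω e
    obtain ⟨e, rfl⟩ := φ.mapEdgeSet.symm.surjective e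
    rw [MeasurableEquiv.coe_piCongrLeft, Equiv.piCongrLeft_apply_apply, pull,
      Equiv.apply_symm_apply]
  rw [hf] at h
  exact h

lemma measurable_pull (φ : G ≃g G) : Measurable (pull φ) := by
  refine measurable_pi_lambda _ fun e => ?_
  unfold pull
  fun_prop

lemma openGraph_pull_adj (φ : G ≃g G) (ω : G.edgeSet → Bool) (a b : V) :
    (openGraph (pull φ ω)).Adj a b ↔ (openGraph ω).Adj (φ a) (φ b) := by
  rw [openGraph_adj, openGraph_adj]
  constructor
  · rintro ⟨h, ho⟩
    exact ⟨φ.map_adj_iff.2 h, ho⟩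
  · rintro ⟨h, ho⟩
    exact ⟨φ.map_adj_iff.1 h, ho⟩

lemma walkSup_pull (φ : G ≃g G) (f : ℕ → ℝ≥0∞) (ω : G.edgeSet → Bool) (u v : V) :
    walkSup f (pull φ ω) u v = walkSup f ω (φ u) (φ v) := by
  let ψ : openGraph (pull φ ω) ≃g openGraph ω :=
    ⟨φ.toEquiv, fun {a b} => (openGraph_pull_adj φ ω a b).symm⟩
  refine le_antisymm (iSup_le fun p => ?_) (iSup_le fun p => ?_)
  · rw [← SimpleGraph.Walk.length_map ψ.toHom p]
    exact le_walkSup f (p.map ψ.toHom)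
  · rw [← SimpleGraph.Walk.length_map ψ.symm.toHom p]
    have h1 : ∀ a, ψ.symm.toHom (φ a) = a := fun a => φ.toEquiv.symm_apply_apply a
    rw [← SimpleGraph.Walk.length_copy (p.map ψ.symm.toHom) (h1 u) (h1 v)]
    exact le_walkSup f _

variable [Countable V]

lemma meanWeight_automorphism (p : I) (f : ℕ → ℝ≥0∞) (φ : G ≃g G) (u v : V) :
    meanWeight G p f (φ u) (φ v) = meanWeight G p f u v := by
  unfold meanWeight
  simp_rw [← walkSup_pull]
  conv_rhs => rw [← map_pull_law p φ]
  rw [lintegral_map (measurable_walkSup f u v) (measurable_pull φ)]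

lemma tsum_meanWeight_automorphism (p : I) (f : ℕ → ℝ≥0∞) (φ : G ≃g G) (u : V) :
    ∑' v, meanWeight G p f (φ u) v = ∑' v, meanWeight G p f u v := by
  rw [← φ.toEquiv.tsum_eq]
  exact tsum_congr fun v => meanWeight_automorphism p f φ u v

lemma gen_automorphism (p : I) {α : ℝ≥0} (hα : α ≤ 1) (φ : G ≃g G) (u : V) :
    gen G p α (φ u) = gen G p α u := by
  rw [gen_eq_tsum p hα, gen_eq_tsum p hα, tsum_meanWeight_automorphism]

/-- Open `γ` at cost at most `p ^ R` and prepend it to the walk from `u'`, losing at most `α ^ R`.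
-/
lemma pow_mul_meanWeight_le (p : I) {α : ℝ≥0} (hα : α ≤ 1) {R : ℕ} {u u' : V} (γ : G.Walk u u')
    (hγ : γ.length ≤ R) (v : V) :
    ((toNNReal p * α : ℝ≥0) : ℝ≥0∞) ^ R * meanWeight G p (powWeight α) u' v
      ≤ meanWeight G p (powWeight α) u v := by
  refine le_trans ?_ (pow_mul_lintegral_raise_le p γ hγ (measurable_walkSup _ u v))
  rw [ENNReal.coe_mul, mul_pow, mul_assoc]
  refine mul_le_mul_right ?_ _
  rw [meanWeight, ← lintegral_const_mul _ (measurable_walkSup _ u' v)]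
  refine lintegral_mono fun ω => ?_
  exact (mul_le_mul' ((powWeight_le_of_le hα hγ).trans (pow_length_le_walkSup_raise α γ ω))
    (walkSup_mono _ (le_raise _ _) _ _)).trans (walkSup_mul_walkSup_le_trans hα _ _ _ _)

lemma pow_mul_gen_le_of_walk (p : I) {α : ℝ≥0} (hα : α ≤ 1) {R : ℕ} {u u' : V} (γ : G.Walk u u')
    (hγ : γ.length ≤ R) :
    ((toNNReal p * α : ℝ≥0) : ℝ≥0∞) ^ R * gen G p α u' ≤ gen G p α u := by
  rw [gen_eq_tsum p hα, gen_eq_tsum p hα, ← ENNReal.tsum_mul_left]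
  exact ENNReal.tsum_le_tsum fun v => pow_mul_meanWeight_le p hα γ hγ v

/-- The generating functions at different vertices are comparable. -/
lemma exists_pow_mul_genSup_le (hconn : G.Connected) (hqt : QuasiTransitive G) :
    ∃ R : ℕ, ∀ (p : I) (α : ℝ≥0), α ≤ 1 → ∀ u,
      ((toNNReal p * α : ℝ≥0) : ℝ≥0∞) ^ R * genSup G p α ≤ gen G p α u := by
  obtain ⟨S, hS⟩ := hqt
  -- `R` is the largest distance between two orbit representatives.
  refine ⟨(S ×ˢ S).sup fun z => G.dist z.1 z.2, fun p α hα u => ?_⟩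
  rw [genSup, ENNReal.mul_iSup]
  refine iSup_le fun u' => ?_
  obtain ⟨s, hs, φ, rfl⟩ := hS u
  obtain ⟨s', hs', φ', rfl⟩ := hS u'
  rw [gen_automorphism p hα, gen_automorphism p hα]
  obtain ⟨γ, hγ⟩ := hconn.exists_walk_length_eq_dist s s'
  refine pow_mul_gen_le_of_walk p hα γ ?_
  rw [hγ]
  exact Finset.le_sup (f := fun z : V × V => G.dist z.1 z.2) (Finset.mk_mem_product hs hs')

end Automorphism

/-! ### Summing the surgery and the open triangle error -/

section DifferentialInequality

variable {V : Type*} {G : SimpleGraph V}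

open Classical in
/-- The edges of a short walk between two vertices, if there is one. -/
noncomputable def shortWalkEdges (G : SimpleGraph V) (k : ℕ) (z : V × V) : Finset G.edgeSet :=
  if h : ∃ γ : G.Walk z.1 z.2, γ.length ≤ k then edgesOf h.choose.edges else ∅

lemma exists_walk_of_mem_shortWalkEdges {k : ℕ} {z : V × V} {e : G.edgeSet}
    (he : e ∈ shortWalkEdges G k z) {a : V} (ha : a ∈ (e : Sym2 V)) :
    ∃ γ : G.Walk z.1 a, γ.length ≤ k := by
  classical
  unfold shortWalkEdges at he
  split_ifs at he with h
  · have hmem := h.choose.mem_support_of_mem_edges (mem_edgesOf.1 he) ha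
    exact ⟨h.choose.takeUntil a hmem,
      (SimpleGraph.Walk.length_takeUntil_le_length _ _).trans h.choose_spec⟩
  · simp at he

/-- The diagonal of `T ^ 2 P ^ k T`, as a sum over closed walks. -/
lemma mmul_T_eq [Countable V] (p : I) (A : V → V → ℝ≥0∞) (z : V) :
    mmul (mmul (mmul (T G p) (T G p)) A) (T G p) z z
      = ∑' w, ∑' w', ∑' x, A w' w * T G p z w * T G p z x * T G p w' x := by
  simp only [mmul]
  refine tsum_congr fun w => ?_
  rw [← ENNReal.tsum_mul_right]
  refine tsum_congr fun w' => ?_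
  rw [mul_assoc, ← ENNReal.tsum_mul_right]
  refine tsum_congr fun x => ?_
  rw [T_comm p x w', T_comm p w z]
  ring

variable [G.LocallyFinite]

-- If the chosen path of `z` uses `e`, its starting vertex is within `k` steps of an endpoint of
-- `e`. There are at most `D ^ k` such starting vertices, and each row of the kernel has mass one.
open Classical in
lemma tsum_mpow_mul_mem_shortWalkEdges_le {D : ℕ} (hD : ∀ v, G.degree v + 1 ≤ D) (k : ℕ)
    (e : G.edgeSet) :
    ∑' z : V × V, mpow (srw G) k z.1 z.2 * (if e ∈ shortWalkEdges G k z then 1 else 0)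
      ≤ (D : ℝ≥0∞) ^ k := by
  obtain ⟨a, ha⟩ : ∃ a, a ∈ (e : Sym2 V) := ⟨_, Sym2.out_fst_mem _⟩
  let N : V → ℝ≥0∞ := fun w => if ∃ γ : G.Walk w a, γ.length ≤ k then 1 else 0
  calc ∑' z : V × V, mpow (srw G) k z.1 z.2 * (if e ∈ shortWalkEdges G k z then 1 else 0)
      ≤ ∑' z : V × V, N z.1 * mpow (srw G) k z.1 z.2 := by
        refine ENNReal.tsum_le_tsum fun z => ?_
        rw [mul_comm]
        refine mul_le_mul_left ?_ _
        simp only [N]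
        split_ifs with h1 h2
        · exact le_rfl
        · exact absurd (exists_walk_of_mem_shortWalkEdges h1 ha) h2
        · exact zero_le
        · exact le_rfl
    _ = ∑' w, N w := by
        rw [ENNReal.tsum_prod']
        refine tsum_congr fun w => ?_
        change ∑' b, N w * mpow (srw G) k w b = N w
        rw [ENNReal.tsum_mul_left, tsum_mpow_srw, mul_one]
    _ ≤ _ := tsum_exists_walk_le hD k a

variable [Countable V]

/-- A pair `z` of positive weight is joined by a walk of length at most `k`, so surgery applies
along it; the edge count along a geodesic then bounds all cuts at once. -/
lemma pow_mul_tsum_sepWeight_le {D : ℕ} (hD : ∀ v, G.degree v + 1 ≤ D) (k : ℕ) (p : I) {α : ℝ≥0}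
    (hα : α ≤ 1) (u v : V) :
    ((toNNReal p * α : ℝ≥0) : ℝ≥0∞) ^ k * ∑' z : V × V, mpow (srw G) k z.1 z.2
        * ∫⁻ ω, sepWeight α u z.2 z.1 v ω ∂(law G p)
      ≤ (D : ℝ≥0∞) ^ k * ∫⁻ ω, dInt ω u v * walkSup (powWeight α) ω u v ∂(law G p) := by
  classical
  have hmd : Measurable fun ω : G.edgeSet → Bool =>
      (dInt ω u v : ℝ≥0∞) * walkSup (powWeight α) ω u v :=
    (measurable_from_top.comp (measurable_dInt u v)).mul (measurable_walkSup _ u v)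
  rw [← ENNReal.tsum_mul_left, ← lintegral_const_mul _ hmd]
  calc ∑' z : V × V, ((toNNReal p * α : ℝ≥0) : ℝ≥0∞) ^ k * (mpow (srw G) k z.1 z.2
        * ∫⁻ ω, sepWeight α u z.2 z.1 v ω ∂(law G p))
      ≤ ∑' z : V × V, mpow (srw G) k z.1 z.2
          * ∫⁻ ω, cutWeight α (shortWalkEdges G k z) u v ω ∂(law G p) := by
        refine ENNReal.tsum_le_tsum fun z => ?_
        by_cases hz : mpow (srw G) k z.1 z.2 = 0
        · simp [hz]
        · have h := exists_walk_of_mpow_srw_ne_zero hz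
          rw [mul_left_comm, shortWalkEdges, dif_pos h]
          exact mul_le_mul_right
            (pow_mul_lintegral_sepWeight_le p hα h.choose h.choose_spec) _
    _ = ∫⁻ ω, ∑' z : V × V, mpow (srw G) k z.1 z.2 * cutWeight α (shortWalkEdges G k z) u v ω
          ∂(law G p) := by
        rw [lintegral_tsum fun z => ((measurable_cutWeight α _ u v).const_mul _).aemeasurable]
        exact tsum_congr fun z => (lintegral_const_mul _ (measurable_cutWeight α _ u v)).symm
    _ ≤ _ := lintegral_mono fun ω => by
        refine (tsum_mul_cutWeight_le _ _ (M := (D : ℝ≥0∞) ^ k) (fun e => ?_) u v ω)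
        exact tsum_mpow_mul_mem_shortWalkEdges_le hD k e

lemma pow_mul_tsum_tsum_sepWeight_le {D : ℕ} (hD : ∀ v, G.degree v + 1 ≤ D) (k : ℕ) (p : I)
    {α : ℝ≥0} (hα : α ≤ 1) (u : V) :
    ((toNNReal p * α : ℝ≥0) : ℝ≥0∞) ^ k * ∑' v, ∑' z : V × V, mpow (srw G) k z.1 z.2
        * ∫⁻ ω, sepWeight α u z.2 z.1 v ω ∂(law G p)
      ≤ (D : ℝ≥0∞) ^ k * derivGen G p α u := by
  rw [← ENNReal.tsum_mul_left]
  refine (ENNReal.tsum_le_tsum fun v => pow_mul_tsum_sepWeight_le hD k p hα u v).trans ?_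
  rw [ENNReal.tsum_mul_left]
  exact mul_le_mul_right (tsum_lintegral_dist_le_derivGen p hα u) _

/-- Main term plus open triangle error, before any choice of `k`. The hypothesis `hc` allows the
second base point to be any `w'`. -/
lemma genSup_mul_gen_le {D : ℕ} (hD : ∀ v, G.degree v + 1 ≤ D) (k : ℕ) (p : I) {α : ℝ≥0}
    (hα : α ≤ 1) {c : ℝ≥0∞} (hc : ∀ u, c * genSup G p α ≤ gen G p α u) (u : V) :
    c * genSup G p α * gen G p α u
      ≤ D * (∑' v, ∑' z : V × V, mpow (srw G) k z.1 z.2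
          * ∫⁻ ω, sepWeight α u z.2 z.1 v ω ∂(law G p)
        + (⨆ v, mmul (mmul (mmul (T G p) (T G p)) (mpow (srw G) k)) (T G p) v v)
          * genSup G p α * gen G p α u) := by
  set g := meanWeight G p (powWeight α) with hg
  set P := mpow (srw G) k with hP
  set ε := ⨆ v, mmul (mmul (mmul (T G p) (T G p)) P) (T G p) v v with hε
  have hgen : ∀ u, gen G p α u = ∑' v, g u v := gen_eq_tsum p hα
  -- Insert the column sum of `P` at `w`, at the price of a factor `D`, and bound `c * genSup` by
  -- the generating function at each `w'`.
  have lower_bound : c * genSup G p α * gen G p α u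
      ≤ D * ∑' v, ∑' z : V × V, P z.1 z.2 * (g u z.2 * g z.1 v) := by
    calc c * genSup G p α * gen G p α u
        = ∑' w, c * genSup G p α * (1 * g u w) := by
          rw [hgen, ← ENNReal.tsum_mul_left]; simp
      _ ≤ ∑' w, c * genSup G p α * ((D * ∑' w', P w' w) * g u w) :=
          ENNReal.tsum_le_tsum fun w =>
            mul_le_mul_right (mul_le_mul_left (one_le_mul_tsum_mpow hD k w) _) _
      _ = D * ∑' w, ∑' w', P w' w * g u w * (c * genSup G p α) := by
          rw [← ENNReal.tsum_mul_left]
          refine tsum_congr fun w => ?_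
          rw [ENNReal.tsum_mul_right, ENNReal.tsum_mul_right]
          ring
      _ ≤ D * ∑' w, ∑' w', P w' w * g u w * ∑' v, g w' v :=
          mul_le_mul_right (ENNReal.tsum_le_tsum fun w => ENNReal.tsum_le_tsum fun w' =>
            mul_le_mul_right ((hc w').trans (hgen w').le) _) _
      _ = _ := by
          congr 1
          rw [ENNReal.tsum_comm]
          simp_rw [← ENNReal.tsum_mul_left]
          rw [← ENNReal.tsum_prod' (f := fun z : V × V => ∑' v, P z.1 z.2 * g u z.2 * g z.1 v),
            ENNReal.tsum_comm]
          simp_rw [mul_assoc]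
  refine lower_bound.trans (mul_le_mul_right ?_ _)
  calc ∑' v, ∑' z : V × V, P z.1 z.2 * (g u z.2 * g z.1 v)
      ≤ ∑' v, ∑' z : V × V, (P z.1 z.2 * ∫⁻ ω, sepWeight α u z.2 z.1 v ω ∂(law G p)
          + P z.1 z.2 * ∑' x, (∑' y, g u y * T G p y z.2 * T G p y x)
            * (T G p z.1 x * g x v)) := by
        refine ENNReal.tsum_le_tsum fun v => ENNReal.tsum_le_tsum fun z => ?_
        rw [← mul_add]
        exact mul_le_mul_right (meanWeight_mul_meanWeight_le p hα u z.2 z.1 v) _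
    _ = ∑' v, ∑' z : V × V, P z.1 z.2 * ∫⁻ ω, sepWeight α u z.2 z.1 v ω ∂(law G p)
          + ∑' v, ∑' z : V × V, P z.1 z.2 * ∑' x, (∑' y, g u y * T G p y z.2 * T G p y x)
            * (T G p z.1 x * g x v) := by
        rw [← ENNReal.tsum_add]
        exact tsum_congr fun v => ENNReal.tsum_add
    _ ≤ _ := add_le_add le_rfl ?_
  -- Summing over `v` leaves the generating function at `x`, bounded by its supremum. Summing over
  -- `z` and `x` then closes the loop at `y`.
  calc ∑' v, ∑' z : V × V, P z.1 z.2 * ∑' x, (∑' y, g u y * T G p y z.2 * T G p y x)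
            * (T G p z.1 x * g x v)
      = ∑' z : V × V, ∑' x, ∑' y, g u y * (P z.1 z.2 * T G p y z.2 * T G p y x * T G p z.1 x)
          * gen G p α x := by
        rw [ENNReal.tsum_comm]
        refine tsum_congr fun z => ?_
        rw [ENNReal.tsum_mul_left, ENNReal.tsum_comm, ← ENNReal.tsum_mul_left]
        refine tsum_congr fun x => ?_
        rw [ENNReal.tsum_mul_left, ENNReal.tsum_mul_left, hgen, ← ENNReal.tsum_mul_right,
          ← ENNReal.tsum_mul_left]
        refine tsum_congr fun y => ?_
        ring
    _ ≤ ∑' z : V × V, ∑' x, ∑' y, g u y * (P z.1 z.2 * T G p y z.2 * T G p y x * T G p z.1 x)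
          * genSup G p α :=
        ENNReal.tsum_le_tsum fun z => ENNReal.tsum_le_tsum fun x => ENNReal.tsum_le_tsum fun y =>
          mul_le_mul_right (le_iSup (gen G p α) x) _
    _ = ∑' y, g u y * mmul (mmul (mmul (T G p) (T G p)) P) (T G p) y y * genSup G p α := by
        have h1 : ∀ z : V × V, ∑' x, ∑' y, g u y *
            (P z.1 z.2 * T G p y z.2 * T G p y x * T G p z.1 x) * genSup G p α
            = ∑' y, ∑' x, g u y *
            (P z.1 z.2 * T G p y z.2 * T G p y x * T G p z.1 x) * genSup G p α := fun z =>
          ENNReal.tsum_comm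
        simp_rw [h1]
        rw [ENNReal.tsum_comm]
        refine tsum_congr fun y => ?_
        rw [mmul_T_eq, ENNReal.tsum_prod', ENNReal.tsum_comm]
        simp_rw [ENNReal.tsum_mul_right, ENNReal.tsum_mul_left]
    _ ≤ ∑' y, g u y * ε * genSup G p α :=
        ENNReal.tsum_le_tsum fun y => mul_le_mul_left (mul_le_mul_right
          (le_iSup (fun v => mmul (mmul (mmul (T G p) (T G p)) P) (T G p) v v) y) _) _
    _ = ε * genSup G p α * gen G p α u := by
        rw [ENNReal.tsum_mul_right, ENNReal.tsum_mul_right, ← hgen]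
        ring

end DifferentialInequality

/-! ### Bounded degrees and countability -/

section Structure

variable {V : Type*} {G : SimpleGraph V} [G.LocallyFinite]

lemma exists_degree_bound (hqt : QuasiTransitive G) : ∃ D : ℕ, ∀ v, G.degree v + 1 ≤ D := by
  obtain ⟨S, hS⟩ := hqt
  refine ⟨S.sup (fun v => G.degree v) + 1, fun v => Nat.add_le_add_right ?_ 1⟩
  obtain ⟨s, hs, φ, rfl⟩ := hS v
  rw [φ.degree_eq]
  exact Finset.le_sup (f := fun v => G.degree v) hs

lemma countable_of_connected {D : ℕ} (hconn : G.Connected) (hD : ∀ v, G.degree v + 1 ≤ D) :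
    Countable V := by
  classical
  obtain ⟨a⟩ := hconn.nonempty
  have hc : ∀ k : ℕ, {b | ∃ p : G.Walk b a, p.length ≤ k}.Countable := by
    intro k
    have h := Summable.countable_support_ennreal
      (ne_top_of_le_ne_top (ENNReal.pow_ne_top (ENNReal.natCast_ne_top D))
        (tsum_exists_walk_le hD k a))
    refine h.mono fun b hb => ?_
    have hb : ∃ p : G.Walk b a, p.length ≤ k := hb
    rw [Function.mem_support, if_pos hb]
    exact one_ne_zero
  rw [← Set.countable_univ_iff]
  refine (Set.countable_iUnion hc).mono fun b _ => ?_
  obtain ⟨p, hp⟩ := hconn.exists_walk_length_eq_dist b a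
  exact Set.mem_iUnion.2 ⟨_, p, le_rfl⟩

end Structure

/-! ### Monotonicity in the percolation parameter -/

section Monotonicity

variable {V : Type*} {G : SimpleGraph V}

lemma measurable_or_pair {ι : Type*} :
    Measurable fun (z : ι × Bool → Bool) (i : ι) => z (i, false) || z (i, true) :=
  measurable_pi_lambda _ fun i => (measurable_of_countable fun b : Bool × Bool => b.1 || b.2).comp
    (by fun_prop : Measurable fun z : ι × Bool → Bool => (z (i, false), z (i, true)))

lemma mmul_mono {A A' B B' : V → V → ℝ≥0∞} (hA : ∀ u v, A u v ≤ A' u v)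
    (hB : ∀ u v, B u v ≤ B' u v) (u v : V) : mmul A B u v ≤ mmul A' B' u v :=
  ENNReal.tsum_le_tsum fun w => mul_le_mul' (hA u w) (hB w v)

/-- The sprinkling density satisfies `1 - ε = (1 - p') / (1 - p)`; at `p = 1` also `p' = 1`, and `ε
= 0` works. -/
lemma exists_symm_eq_mul {p p' : I} (h : p ≤ p') : ∃ ε : I, σ p' = σ p * σ ε := by
  by_cases hp : (p : ℝ) = 1
  · refine ⟨0, ?_⟩
    have hp' : (p' : ℝ) = 1 := le_antisymm p'.2.2 (hp ▸ h)
    ext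
    simp [hp, hp']
  · have h1 : 0 < 1 - (p : ℝ) := sub_pos.2 (lt_of_le_of_ne p.2.2 hp)
    have h2 : (p : ℝ) ≤ p' := h
    refine ⟨σ ⟨(1 - p') / (1 - p), div_nonneg (sub_nonneg.2 p'.2.2) h1.le,
      (div_le_one h1).2 (by linarith)⟩, ?_⟩
    ext
    simp only [unitInterval.symm_symm, unitInterval.coe_symm_eq, Set.Icc.coe_mul]
    field_simp

lemma lintegral_law_le_of_monotone {p p' : I} (h : p ≤ p') {f : (G.edgeSet → Bool) → ℝ≥0∞}
    (hf : Measurable f) (hmono : Monotone f) :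
    ∫⁻ ω, f ω ∂(law G p) ≤ ∫⁻ ω, f ω ∂(law G p') := by
  obtain ⟨ε, hε⟩ := exists_symm_eq_mul h
  have h1 : law G p = (bern (biasPair (ι := G.edgeSet) p ε)).map fun z i => z (i, false) :=
    (map_fst_bern p ε).symm
  have h2 : law G p' = (bern (biasPair (ι := G.edgeSet) p ε)).map
      fun z i => z (i, false) || z (i, true) := (map_or_bern hε).symm
  rw [h1, h2, lintegral_map hf (by fun_prop),
    lintegral_map hf measurable_or_pair]
  refine lintegral_mono fun z => hmono fun i => ?_
  exact Bool.left_le_or _ _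

lemma T_mono [Countable V] {p p' : I} (h : p ≤ p') (u v : V) : T G p u v ≤ T G p' u v := by
  rw [T_eq_meanWeight, T_eq_meanWeight]
  exact lintegral_law_le_of_monotone h (measurable_walkSup _ u v)
    fun _ _ hω => walkSup_mono _ hω u v

end Monotonicity

/-! ### Locally uniform constants and continuous choices -/

section Uniform

/-- Order-connected sets of reals are convex, so a partition of unity glues locally constant
admissible values. -/
lemma exists_continuousOn_forall_mem {X : Type*} [MetricSpace X] {A : Set X} {t : X → Set ℝ}
    (ht : ∀ x, (t x).OrdConnected) (H : ∀ x ∈ A, ∃ c, ∀ᶠ y in 𝓝[A] x, c ∈ t y) :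
    ∃ f : X → ℝ, ContinuousOn f A ∧ ∀ x ∈ A, f x ∈ t x := by
  classical
  obtain ⟨g, hg⟩ := exists_continuous_forall_mem_convex_of_local_const (X := A)
    (t := fun x => t x) (fun x => (ht x).convex) fun x => by
      obtain ⟨c, hc⟩ := H x x.2
      exact ⟨c, eventually_nhds_subtype_iff A x (fun y => c ∈ t y) |>.2 hc⟩
  refine ⟨fun x => if hx : x ∈ A then g ⟨x, hx⟩ else 0, ?_, fun x hx => ?_⟩
  · rw [continuousOn_iff_continuous_domRestrict]
    convert g.continuous using 1
    funext z
    simp [z.2]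
  · simpa only [dif_pos hx] using hg ⟨x, hx⟩

/-- Every point of `INabla` has a neighbourhood in `INabla` with an upper bound in `INabla`. -/
lemma exists_eventually_le_of_mem {V : Type*} (G : SimpleGraph V) [G.LocallyFinite] {p₀ : I}
    (h₀ : p₀ ∈ INabla G) :
    ∃ p₁ ∈ INabla G, ∀ᶠ p in 𝓝 p₀, p ∈ INabla G → p ≤ p₁ := by
  by_cases h : ∃ p₁ ∈ INabla G, p₀ < p₁
  · obtain ⟨p₁, h₁, hlt⟩ := h
    exact ⟨p₁, h₁, (eventually_lt_nhds hlt).mono fun p hp _ => hp.le⟩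
  · push Not at h
    exact ⟨p₀, h₀, Eventually.of_forall fun p hp => h p hp⟩


variable {V : Type*} {G : SimpleGraph V} [G.LocallyFinite] [Countable V]

/-- The differential inequality, with a constant that is uniform in `p ≤ p₁` and `p α ≥ δ`. -/
lemma exists_forall_mul_gen_sq_le (hconn : G.Connected) (hqt : QuasiTransitive G) {p₁ : I}
    (hp₁ : p₁ ∈ INabla G) {δ : ℝ≥0} (hδ : 0 < δ) :
    ∃ c : ℝ, 0 < c ∧ c ≤ 1 ∧ ∀ p ≤ p₁, ∀ α : ℝ≥0, α ≤ 1 → δ ≤ toNNReal p * α →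
      genSup G p α < ∞ → ∀ u, ENNReal.ofReal c * gen G p α u ^ 2 ≤ derivGen G p α u := by
  obtain ⟨D, hD⟩ := exists_degree_bound hqt
  obtain ⟨R, hR⟩ := exists_pow_mul_genSup_le hconn hqt
  obtain ⟨v₀⟩ := hconn.nonempty
  have hD1 : 1 ≤ D := (Nat.le_add_left 1 _).trans (hD v₀)
  have hD0 : (D : ℝ≥0∞) ≠ 0 := by exact_mod_cast (by omega : D ≠ 0)
  have hDt : (D : ℝ≥0∞) ≠ ∞ := ENNReal.natCast_ne_top D
  have hδ0 : (δ : ℝ≥0∞) ≠ 0 := by exact_mod_cast hδ.ne'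
  -- Multiplied by the factor `D` of `genSup_mul_gen_le`, this threshold is half of the comparison
  -- constant `δ ^ R`, so the error is half of the left side.
  have hpos : (0 : ℝ≥0∞) < (δ : ℝ≥0∞) ^ R / 2 / D :=
    ENNReal.div_pos (ENNReal.div_pos (pow_ne_zero _ hδ0) (by simp)).ne' hDt
  obtain ⟨k, hk⟩ := ((tendsto_order.1 hp₁).2 _ hpos).exists
  set c₀ : ℝ≥0 := δ ^ (k + R) / 2 / D ^ (k + 1) with hc₀
  have hc₀pos : 0 < c₀ := by
    have : (0 : ℝ≥0) < D := by exact_mod_cast hD1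
    positivity
  refine ⟨min c₀ 1, lt_min (by exact_mod_cast hc₀pos) one_pos, min_le_right _ _,
    fun p hp α hα hpα hfin u => ?_⟩
  set K : ℝ≥0 := toNNReal p * α with hK
  set S := ∑' v, ∑' z : V × V, mpow (srw G) k z.1 z.2
          * ∫⁻ ω, sepWeight α u z.2 z.1 v ω ∂(law G p) with hS
  have hδK : (δ : ℝ≥0∞) ≤ K := by exact_mod_cast hpα
  -- The `k` chosen at `p₁` works for every `p ≤ p₁`, since `T` increases with the parameter.
  have hε : (⨆ v, mmul (mmul (mmul (T G p) (T G p)) (mpow (srw G) k)) (T G p) v v)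
      ≤ (δ : ℝ≥0∞) ^ R / 2 / D := by
    refine le_trans (iSup_mono fun v => ?_) hk.le
    exact mmul_mono (mmul_mono (mmul_mono (T_mono hp) (T_mono hp)) fun _ _ => le_rfl)
      (T_mono hp) v v
  have h1 := genSup_mul_gen_le hD k p hα (c := (δ : ℝ≥0∞) ^ R)
    (fun u => (mul_le_mul_left (pow_le_pow_left' hδK R) _).trans (hR p α hα u)) u
  have h2 : (δ : ℝ≥0∞) ^ k * S ≤ (D : ℝ≥0∞) ^ k * derivGen G p α u :=
    (mul_le_mul_left (pow_le_pow_left' hδK k) _).trans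
      (pow_mul_tsum_tsum_sepWeight_le hD k p hα u)
  have hgu : gen G p α u ≤ genSup G p α := le_iSup (gen G p α) u
  set X := genSup G p α * gen G p α u with hX
  have hXt : X ≠ ∞ := ENNReal.mul_ne_top hfin.ne (hgu.trans_lt hfin).ne
  set Y := (δ : ℝ≥0∞) ^ (k + R) * X with hY
  have hYt : Y ≠ ∞ := ENNReal.mul_ne_top (ENNReal.pow_ne_top ENNReal.coe_ne_top) hXt
  have h3 : Y ≤ (D : ℝ≥0∞) ^ (k + 1) * derivGen G p α u + Y / 2 := by
    calc Y = (δ : ℝ≥0∞) ^ k * ((δ : ℝ≥0∞) ^ R * genSup G p α * gen G p α u) := by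
          rw [hY, hX, pow_add]; ring
      _ ≤ (δ : ℝ≥0∞) ^ k * (D * (S + (δ : ℝ≥0∞) ^ R / 2 / D
            * genSup G p α * gen G p α u)) :=
          mul_le_mul_right (h1.trans (mul_le_mul_right (add_le_add le_rfl
            (mul_le_mul_left (mul_le_mul_left hε _) _)) _)) _
      _ = D * ((δ : ℝ≥0∞) ^ k * S)
            + (δ : ℝ≥0∞) ^ k * (D * ((δ : ℝ≥0∞) ^ R / 2 / D)) * X := by
          rw [hX]; ring
      _ ≤ D * ((D : ℝ≥0∞) ^ k * derivGen G p α u) + Y / 2 := by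
          refine add_le_add (mul_le_mul_right h2 _) (le_of_eq ?_)
          rw [ENNReal.mul_div_cancel hD0 hDt, hY, pow_add, div_eq_mul_inv, div_eq_mul_inv]
          ring
      _ = _ := by rw [pow_succ]; ring
  have h4 : Y / 2 ≤ (D : ℝ≥0∞) ^ (k + 1) * derivGen G p α u := by
    -- Cancelling `Y / 2` requires it to be finite, which follows from finiteness of `genSup`.
    refine ENNReal.le_of_add_le_add_right (ENNReal.div_ne_top hYt (by simp) : Y / 2 ≠ ∞) ?_
    rwa [ENNReal.add_halves]
  calc ENNReal.ofReal (min (c₀ : ℝ) 1) * gen G p α u ^ 2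
      ≤ c₀ * X := by
        refine mul_le_mul' ?_ ?_
        · rw [← ENNReal.ofReal_coe_nnreal]
          exact ENNReal.ofReal_le_ofReal (min_le_left _ _)
        · rw [sq]
          exact mul_le_mul_left hgu _
    _ = Y / 2 / (D : ℝ≥0∞) ^ (k + 1) := by
        have : (D : ℝ≥0) ^ (k + 1) ≠ 0 := pow_ne_zero _ (by exact_mod_cast (by omega : D ≠ 0))
        rw [hc₀, ENNReal.coe_div this, ENNReal.coe_div (by simp), hY]
        simp only [div_eq_mul_inv, ENNReal.coe_pow, ENNReal.coe_natCast, ENNReal.coe_ofNat]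
        ring
    _ ≤ derivGen G p α u := by
        refine ENNReal.div_le_of_le_mul ?_
        rwa [mul_comm]

theorem exists_continuousOn_mul_gen_sq_le (hconn : G.Connected) (hqt : QuasiTransitive G) :
    ∃ η : I × ℝ≥0 → ℝ, ContinuousOn η ((INabla G \ {0}) ×ˢ Set.Ioc 0 1) ∧
      (∀ z ∈ (INabla G \ {0}) ×ˢ Set.Ioc (0 : ℝ≥0) 1, η z ∈ Set.Ioc (0 : ℝ) 1) ∧
      ∀ p ∈ INabla G, 0 < p → ∀ α : ℝ≥0, 0 < α → α ≤ 1 → genSup G p α < ∞ → ∀ u,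
        ENNReal.ofReal (η (p, α)) * gen G p α u ^ 2 ≤ derivGen G p α u := by
  let t : I × ℝ≥0 → Set ℝ := fun z => {c | (0 < c ∧ c ≤ 1) ∧ (genSup G z.1 z.2 < ∞ → ∀ u,
    ENNReal.ofReal c * gen G z.1 z.2 u ^ 2 ≤ derivGen G z.1 z.2 u)}
  have H : ∀ z ∈ (INabla G \ {0}) ×ˢ Set.Ioc (0 : ℝ≥0) 1,
      ∃ c, ∀ᶠ y in 𝓝[(INabla G \ {0}) ×ˢ Set.Ioc (0 : ℝ≥0) 1] z, c ∈ t y := by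
    rintro ⟨p₀, α₀⟩ ⟨⟨hp₀, hp₀0⟩, hα₀⟩
    obtain ⟨p₁, hp₁, hev⟩ := exists_eventually_le_of_mem G hp₀
    have hpos : 0 < toNNReal p₀ * α₀ := by
      refine mul_pos ?_ hα₀.1
      have : (0 : ℝ) < p₀ := lt_of_le_of_ne p₀.2.1 fun h => hp₀0 (by ext; exact h.symm)
      exact_mod_cast this
    -- With `δ` equal to half of `p₀ α₀`, the requirement `δ ≤ p α` holds near `(p₀, α₀)`.
    obtain ⟨c, hc0, hc1, hc⟩ := exists_forall_mul_gen_sq_le hconn hqt hp₁ (half_pos hpos)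
    have hcont : Continuous fun y : I × ℝ≥0 => toNNReal y.1 * y.2 :=
      (unitInterval.toNNReal_continuous.comp continuous_fst).mul continuous_snd
    have e1 := (hcont.tendsto (p₀, α₀)).eventually (lt_mem_nhds (NNReal.half_lt_self hpos.ne'))
    have e2 := (continuous_fst.tendsto (p₀, α₀)).eventually hev
    refine ⟨c, ?_⟩
    filter_upwards [e1.filter_mono nhdsWithin_le_nhds, e2.filter_mono nhdsWithin_le_nhds,
      self_mem_nhdsWithin] with y h1 h2 h3
    exact ⟨⟨hc0, hc1⟩, fun hf u => hc _ (h2 h3.1.1) _ h3.2.2 h1.le hf u⟩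
  obtain ⟨η, hη, h⟩ := exists_continuousOn_forall_mem
    (A := (INabla G \ {0}) ×ˢ Set.Ioc (0 : ℝ≥0) 1) (t := t)
    (fun z => ⟨fun a ha b hb c hc => ⟨⟨ha.1.1.trans_le hc.1, hc.2.trans hb.1.2⟩, fun hf u =>
      (mul_le_mul_left (ENNReal.ofReal_le_ofReal hc.2) _).trans (hb.2 hf u)⟩⟩) H
  exact ⟨η, hη, fun z hz => (h z hz).1, fun p hp hp0 α hα0 hα1 hfin u =>
    (h (p, α) ⟨⟨hp, hp0.ne'⟩, hα0, hα1⟩).2 hfin u⟩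

end Uniform

/-! ### Growth of intrinsic balls and the radius of convergence -/

section Growth

variable {V : Type*} {G : SimpleGraph V}

/-- The weight of the walks of length at most `r`. -/
noncomputable def ballWeight (r n : ℕ) : ℝ≥0∞ := if n ≤ r then 1 else 0

lemma antitone_ballWeight (r : ℕ) : Antitone (ballWeight r) := by
  intro m n h
  unfold ballWeight
  split_ifs with h1 h2
  · exact le_rfl
  · exact absurd (h.trans h1) h2
  · exact zero_le
  · exact le_rfl

lemma ballWeight_of_le {r n : ℕ} (h : n ≤ r) : ballWeight r n = 1 := if_pos h

lemma walkSup_ballWeight_eq_one {r : ℕ} {ω : G.edgeSet → Bool} {u v : V}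
    (h : (openGraph ω).Reachable u v) (hd : dInt ω u v ≤ r) : walkSup (ballWeight r) ω u v = 1 := by
  rw [walkSup_of_reachable (antitone_ballWeight r) h, ballWeight_of_le hd]

lemma walkSup_ballWeight_eq_zero {r : ℕ} {ω : G.edgeSet → Bool} {u v : V}
    (h : ¬ ((openGraph ω).Reachable u v ∧ dInt ω u v ≤ r)) :
    walkSup (ballWeight r) ω u v = 0 := by
  by_cases hr : (openGraph ω).Reachable u v
  · rw [walkSup_of_reachable (antitone_ballWeight r) hr, ballWeight, if_neg fun hd => h ⟨hr, hd⟩]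
  · exact walkSup_of_not_reachable _ hr

/-- Cut a geodesic after `r` steps. It is a path, so the two pieces share no edge; with van den
Berg–Kesten this makes `Gr` submultiplicative. -/
lemma walkSup_ballWeight_add_le (r s : ℕ) (ω : G.edgeSet → Bool) (u v : V) :
    walkSup (ballWeight (r + s)) ω u v
      ≤ ∑' x, disjSup (setWeight (ballWeight r) u x) (setWeight (ballWeight s) x v) ω := by
  by_cases h : (openGraph ω).Reachable u v ∧ dInt ω u v ≤ r + s
  · rw [walkSup_ballWeight_eq_one h.1 h.2]
    obtain ⟨p, hp, hlen⟩ := h.1.exists_path_of_dist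
    have hl : p.length ≤ r + s := hlen ▸ h.2
    refine le_trans ?_ (ENNReal.le_tsum (p.getVert r))
    refine le_trans (le_of_eq ?_) (mul_le_disjSup_setWeight (ballWeight r) (ballWeight s)
      (p.take r) (p.drop r) ?_)
    · rw [ballWeight_of_le (by rw [SimpleGraph.Walk.take_length]; exact min_le_left _ _),
        ballWeight_of_le (by rw [SimpleGraph.Walk.drop_length]; omega), mul_one]
    · have hn := hp.isTrail.edges_nodup
      rw [SimpleGraph.Walk.edges_take, SimpleGraph.Walk.edges_drop]
      rw [← List.take_append_drop r p.edges, List.nodup_append] at hn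
      exact fun e he he' => hn.2.2 e he e he' rfl
  · rw [walkSup_ballWeight_eq_zero h]
    exact zero_le

lemma walkSup_powWeight_le_tsum {α : ℝ≥0} (hα : α ≤ 1) {r : ℕ} (hr : 0 < r)
    (ω : G.edgeSet → Bool) (u v : V) :
    walkSup (powWeight α) ω u v
      ≤ ∑' j : ℕ, ((α : ℝ≥0∞) ^ r) ^ j * walkSup (ballWeight ((j + 1) * r)) ω u v := by
  by_cases h : (openGraph ω).Reachable u v
  -- The index `j` is that of the block `j r ≤ d < (j + 1) r` containing the distance.
  · refine le_trans ?_ (ENNReal.le_tsum (dInt ω u v / r))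
    rw [walkSup_ballWeight_eq_one h, mul_one, walkSup_of_reachable (antitone_powWeight hα) h,
      ← pow_mul]
    · exact powWeight_le_of_le hα (Nat.mul_div_le _ _)
    · rw [mul_comm]
      exact (Nat.lt_mul_div_succ _ hr).le
  · rw [walkSup_of_not_reachable _ h]
    exact zero_le

lemma genSup_mono (p : I) {α β : ℝ≥0} (h : α ≤ β) : genSup G p α ≤ genSup G p β :=
  iSup_mono fun _ => lintegral_mono fun _ => ENNReal.tsum_le_tsum fun _ =>
    pow_le_pow_left' (by exact_mod_cast h) _

variable [Countable V]

lemma Gr_eq (p : I) (r : ℕ) : Gr G p r = ⨆ u, ∑' v, meanWeight G p (ballWeight r) u v := by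
  unfold Gr meanWeight
  refine iSup_congr fun u => ?_
  rw [← lintegral_tsum fun v => (measurable_walkSup (ballWeight r) u v).aemeasurable]
  refine lintegral_congr fun ω => ?_
  rw [← ENNReal.tsum_set_one, tsum_subtype (ballInt ω u r) fun _ => (1 : ℝ≥0∞)]
  refine tsum_congr fun v => ?_
  by_cases h : (openGraph ω).Reachable u v ∧ dInt ω u v ≤ r
  · rw [walkSup_ballWeight_eq_one h.1 h.2]
    exact Set.indicator_of_mem (show v ∈ ballInt ω u r from h) _
  · rw [walkSup_ballWeight_eq_zero h]
    exact Set.indicator_of_notMem (show v ∉ ballInt ω u r from h) _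

lemma tsum_meanWeight_ballWeight_le (p : I) (r : ℕ) (u : V) :
    ∑' v, meanWeight G p (ballWeight r) u v ≤ Gr G p r := by
  rw [Gr_eq]
  exact le_iSup (fun u => ∑' v, meanWeight G p (ballWeight r) u v) u

lemma Gr_add_le (p : I) (r s : ℕ) : Gr G p (r + s) ≤ Gr G p r * Gr G p s := by
  rw [Gr_eq p (r + s)]
  refine iSup_le fun u => ?_
  calc ∑' v, meanWeight G p (ballWeight (r + s)) u v
      ≤ ∑' v, ∑' x, meanWeight G p (ballWeight r) u x * meanWeight G p (ballWeight s) x v := by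
        refine ENNReal.tsum_le_tsum fun v =>
          (lintegral_mono fun ω => walkSup_ballWeight_add_le r s ω u v).trans ?_
        rw [lintegral_tsum fun x => (measurable_disjSup _ _).aemeasurable]
        exact ENNReal.tsum_le_tsum fun x => lintegral_disjSup_setWeight_le p _ _ _ _ _ _
    _ = ∑' x, meanWeight G p (ballWeight r) u x * ∑' v, meanWeight G p (ballWeight s) x v := by
        rw [ENNReal.tsum_comm]
        exact tsum_congr fun x => ENNReal.tsum_mul_left
    _ ≤ ∑' x, meanWeight G p (ballWeight r) u x * Gr G p s :=
        ENNReal.tsum_le_tsum fun x => mul_le_mul_right (tsum_meanWeight_ballWeight_le p s x) _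
    _ ≤ _ := by
        rw [ENNReal.tsum_mul_right]
        exact mul_le_mul_left (tsum_meanWeight_ballWeight_le p r u) _

lemma Gr_succ_mul_le (p : I) (r k : ℕ) : Gr G p ((k + 1) * r) ≤ Gr G p r ^ (k + 1) := by
  induction k with
  | zero => simp
  | succ k ih =>
    rw [Nat.succ_mul, pow_succ]
    exact (Gr_add_le p _ _).trans (mul_le_mul_left ih _)

lemma one_le_Gr [Nonempty V] (p : I) (r : ℕ) : 1 ≤ Gr G p r := by
  obtain ⟨u⟩ := ‹Nonempty V›
  refine le_trans ?_ (tsum_meanWeight_ballWeight_le p r u)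
  refine le_trans ?_ (ENNReal.le_tsum u)
  calc (1 : ℝ≥0∞) = ∫⁻ _, 1 ∂(law G p) := by simp
    _ ≤ _ := lintegral_mono fun ω => by
        rw [walkSup_ballWeight_eq_one .rfl]
        simp [dInt]

lemma Gr_le_pow [G.LocallyFinite] {D : ℕ} (hD : ∀ v, G.degree v + 1 ≤ D) (p : I) (r : ℕ) :
    Gr G p r ≤ (D : ℝ≥0∞) ^ r := by
  classical
  rw [Gr_eq]
  refine iSup_le fun u => le_trans (ENNReal.tsum_le_tsum fun v => ?_) (tsum_exists_walk_le hD r u)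
  split_ifs with h
  · calc meanWeight G p (ballWeight r) u v ≤ ∫⁻ _, 1 ∂(law G p) := lintegral_mono fun ω =>
          iSup_le fun q => by unfold ballWeight; split_ifs <;> simp
      _ = 1 := by simp
  · refine le_of_eq ((lintegral_congr fun ω => ?_).trans lintegral_zero)
    refine walkSup_ballWeight_eq_zero ?_
    rintro ⟨hr, hd⟩
    obtain ⟨q, hq⟩ := hr.exists_walk_length_eq_dist
    obtain ⟨q', hq'⟩ := exists_walk_of_open le_rfl ((q.mapLe (openGraph_le ω)).reverse)
      (ω := fun _ : G.edgeSet => true) fun _ _ => rfl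
    refine h ⟨q'.mapLe (openGraph_le _), ?_⟩
    rw [SimpleGraph.Walk.length_mapLe, length_eq_of_edges_eq hq', SimpleGraph.Walk.length_reverse,
      SimpleGraph.Walk.length_mapLe, hq]
    exact hd

/-- Group distances into blocks of length `r`. Submultiplicativity dominates the sum by `Gr(r)`
times a geometric series of ratio `α ^ r * Gr(r)`. -/
lemma genSup_lt_top_of_pow_mul_Gr_lt_one {p : I} {α : ℝ≥0} (hα : α ≤ 1) {r : ℕ} (hr : 0 < r)
    (h : (α : ℝ≥0∞) ^ r * Gr G p r < 1) (hG : Gr G p r < ∞) : genSup G p α < ∞ := by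
  refine lt_of_le_of_lt (iSup_le fun u => ?_)
    (ENNReal.mul_lt_top hG (ENNReal.inv_lt_top.2 (tsub_pos_of_lt h)))
  rw [gen_eq_tsum p hα]
  calc ∑' v, meanWeight G p (powWeight α) u v
      ≤ ∑' v, ∑' j : ℕ, ((α : ℝ≥0∞) ^ r) ^ j * meanWeight G p (ballWeight ((j + 1) * r)) u v := by
        refine ENNReal.tsum_le_tsum fun v =>
          (lintegral_mono fun ω => walkSup_powWeight_le_tsum hα hr ω u v).trans ?_
        rw [lintegral_tsum fun j => ((measurable_walkSup _ u v).const_mul _).aemeasurable]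
        exact ENNReal.tsum_le_tsum fun j =>
          (lintegral_const_mul _ (measurable_walkSup _ u v)).le
    _ = ∑' j : ℕ, ((α : ℝ≥0∞) ^ r) ^ j * ∑' v, meanWeight G p (ballWeight ((j + 1) * r)) u v := by
        rw [ENNReal.tsum_comm]
        exact tsum_congr fun j => ENNReal.tsum_mul_left
    _ ≤ ∑' j : ℕ, Gr G p r * ((α : ℝ≥0∞) ^ r * Gr G p r) ^ j := by
        refine ENNReal.tsum_le_tsum fun j => ?_
        refine (mul_le_mul_right ((tsum_meanWeight_ballWeight_le p _ u).trans
          (Gr_succ_mul_le p r j)) _).trans (le_of_eq ?_)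
        rw [mul_pow, pow_succ]
        ring
    _ = _ := by rw [ENNReal.tsum_mul_left, ENNReal.tsum_geometric]

lemma pow_mul_Gr_le_genSup (p : I) {α : ℝ≥0} (hα : α ≤ 1) (r : ℕ) :
    (α : ℝ≥0∞) ^ r * Gr G p r ≤ genSup G p α := by
  rw [Gr_eq, ENNReal.mul_iSup]
  refine iSup_mono fun u => ?_
  rw [gen_eq_tsum p hα, ← ENNReal.tsum_mul_left]
  refine ENNReal.tsum_le_tsum fun v => ?_
  rw [meanWeight, ← lintegral_const_mul _ (measurable_walkSup _ u v)]
  refine lintegral_mono fun ω => ?_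
  by_cases h : (openGraph ω).Reachable u v ∧ dInt ω u v ≤ r
  · rw [walkSup_ballWeight_eq_one h.1 h.2, mul_one,
      walkSup_of_reachable (antitone_powWeight hα) h.1]
    exact powWeight_le_of_le hα h.2
  · rw [walkSup_ballWeight_eq_zero h, mul_zero]
    exact zero_le

section Rate

variable [G.LocallyFinite] [Nonempty V] {D : ℕ}

lemma one_le_toReal_Gr (hD : ∀ v, G.degree v + 1 ≤ D) (p : I) (r : ℕ) :
    1 ≤ (Gr G p r).toReal := by
  have h := ENNReal.toReal_mono
    (ne_top_of_le_ne_top (ENNReal.pow_ne_top (ENNReal.natCast_ne_top D)) (Gr_le_pow hD p r))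
    (one_le_Gr (G := G) p r)
  simpa using h

lemma log_Gr_div_nonneg (hD : ∀ v, G.degree v + 1 ≤ D) (p : I) (r : {r : ℕ // 1 ≤ r}) :
    0 ≤ Real.log (Gr G p r).toReal / (r : ℕ) :=
  div_nonneg (Real.log_nonneg (one_le_toReal_Gr hD p r)) (Nat.cast_nonneg _)

lemma gammaInt_nonneg (hD : ∀ v, G.degree v + 1 ≤ D) (p : I) : 0 ≤ gammaInt G p :=
  Real.iInf_nonneg (log_Gr_div_nonneg hD p)

lemma gammaInt_le (hD : ∀ v, G.degree v + 1 ≤ D) (p : I) (r : {r : ℕ // 1 ≤ r}) :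
    gammaInt G p ≤ Real.log (Gr G p r).toReal / (r : ℕ) :=
  ciInf_le ⟨0, by rintro _ ⟨r, rfl⟩; exact log_Gr_div_nonneg hD p r⟩ r

lemma gammaInt_le_log (hD : ∀ v, G.degree v + 1 ≤ D) (p : I) : gammaInt G p ≤ Real.log D := by
  refine (gammaInt_le hD p ⟨1, le_rfl⟩).trans ?_
  have h : (Gr G p 1).toReal ≤ D := by
    have := ENNReal.toReal_mono (ENNReal.pow_ne_top (ENNReal.natCast_ne_top D))
      (Gr_le_pow (G := G) hD p 1)
    simpa using this
  simpa using Real.log_le_log (one_pos.trans_le (one_le_toReal_Gr hD p 1)) h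

lemma genSup_lt_top_of_lt_exp (hD : ∀ v, G.degree v + 1 ≤ D) (p : I) {α : ℝ≥0}
    (hα : (α : ℝ) < Real.exp (-gammaInt G p)) : genSup G p α < ∞ := by
  have hfin : ∀ r, Gr G p r < ∞ := fun r =>
    (Gr_le_pow hD p r).trans_lt (ENNReal.pow_lt_top (ENNReal.natCast_lt_top D))
  have hα1 : α ≤ 1 := by
    have : Real.exp (-gammaInt G p) ≤ 1 :=
      Real.exp_le_one_iff.2 (neg_nonpos.2 (gammaInt_nonneg hD p))
    exact_mod_cast (hα.le.trans this)
  -- The value `α = 0` is treated apart, because the other case takes logarithms.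
  rcases eq_or_lt_of_le (zero_le (a := α)) with h0 | h0
  · exact genSup_lt_top_of_pow_mul_Gr_lt_one hα1 one_pos (by simp [← h0]) (hfin 1)
  · have h1 : gammaInt G p < -Real.log α := by
      have := (Real.log_lt_iff_lt_exp (by exact_mod_cast h0)).2 hα
      linarith
    obtain ⟨⟨r, hr⟩, h2⟩ := exists_lt_of_ciInf_lt h1
    refine genSup_lt_top_of_pow_mul_Gr_lt_one hα1 hr ?_ (hfin r)
    have hr0 : (0 : ℝ) < r := by exact_mod_cast hr
    have hg := one_le_toReal_Gr hD p r
    have hg0 : 0 < (Gr G p r).toReal := one_pos.trans_le hg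
    have h3 : (α : ℝ) ^ r * (Gr G p r).toReal < 1 := by
      have hα0 : (0 : ℝ) < α := by exact_mod_cast h0
      rw [← Real.log_lt_log_iff (by positivity) one_pos, Real.log_one,
        Real.log_mul (by positivity) hg0.ne', Real.log_pow]
      have := (div_lt_iff₀ hr0).1 h2
      linarith
    rw [← ENNReal.toReal_lt_toReal (ENNReal.mul_ne_top (by finiteness) (hfin r).ne) (by simp)]
    simpa using h3

/-- The rate is an infimum, so `Gr(r) ≥ exp (γ r)` for every `r ≥ 1`, and `(α exp γ) ^ r ≤ genSup`
stays bounded. Infinite susceptibility is what rules out `α > 1`, by monotonicity in `α`. -/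
lemma le_exp_of_genSup_lt_top (hD : ∀ v, G.degree v + 1 ≤ D) {p : I} (hχ : genSup G p 1 = ∞)
    {α : ℝ≥0} (hα : genSup G p α < ∞) : (α : ℝ) ≤ Real.exp (-gammaInt G p) := by
  have hα1 : α ≤ 1 := by
    by_contra! h
    exact absurd ((genSup_mono p h.le).trans_lt hα) (by simp [hχ])
  by_contra! hlt
  have hone : 1 < (α : ℝ) * Real.exp (gammaInt G p) := by
    rw [Real.exp_neg] at hlt
    exact (inv_lt_iff_one_lt_mul₀ (Real.exp_pos _)).1 hlt
  obtain ⟨r, hr⟩ := ((tendsto_pow_atTop_atTop_of_one_lt hone).eventually_gt_atTop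
    (genSup G p α).toReal).and (eventually_ge_atTop 1) |>.exists
  have h1 := ENNReal.toReal_mono hα.ne (pow_mul_Gr_le_genSup (G := G) p hα1 r)
  rw [ENNReal.toReal_mul, ENNReal.toReal_pow, ENNReal.coe_toReal] at h1
  have hr0 : (0 : ℝ) < r := by exact_mod_cast hr.2
  have h2 : Real.exp (gammaInt G p) ^ r ≤ (Gr G p r).toReal := by
    rw [← Real.exp_nat_mul, ← Real.le_log_iff_exp_le (one_pos.trans_le (one_le_toReal_Gr hD p r))]
    have := (le_div_iff₀ hr0).1 (gammaInt_le hD p ⟨r, hr.2⟩)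
    linarith
  have h3 := mul_le_mul_of_nonneg_left h2 (pow_nonneg α.2 r)
  rw [← mul_pow] at h3
  exact absurd (hr.1.trans_le (h3.trans h1)) (lt_irrefl _)

/-- The radius of convergence is the inverse of the growth rate when the susceptibility is
infinite. -/
lemma alphaCrit_eq (hD : ∀ v, G.degree v + 1 ≤ D) {p : I} (hχ : genSup G p 1 = ∞) :
    alphaCrit G p = ENNReal.ofReal (Real.exp (-gammaInt G p)) := by
  refine le_antisymm (iSup₂_le fun α hα => ?_) (le_of_forall_lt fun a ha => ?_)
  · rw [← ENNReal.ofReal_coe_nnreal]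
    exact ENNReal.ofReal_le_ofReal (le_exp_of_genSup_lt_top hD hχ hα)
  · obtain ⟨b, hab, hb⟩ := ENNReal.lt_iff_exists_nnreal_btwn.1 ha
    refine hab.trans_le (le_iSup₂_of_le b (genSup_lt_top_of_lt_exp hD p ?_) le_rfl)
    rw [← ENNReal.ofReal_coe_nnreal] at hb
    exact (ENNReal.ofReal_lt_ofReal_iff (Real.exp_pos _)).1 hb

end Rate
end Growth

/-! ### Sprinkling and openness of finite susceptibility -/

section Sprinkling

variable {V : Type*} {G : SimpleGraph V}

/-- The coins of the first family. -/
def firstCoins (z : G.edgeSet × Bool → Bool) (e : G.edgeSet) : Bool := z (e, false)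

/-- An edge is open if one of its two coins is. -/
def bothCoins (z : G.edgeSet × Bool → Bool) (e : G.edgeSet) : Bool := z (e, false) || z (e, true)

open Classical in
/-- The configuration whose open coins are those in `A`. -/
noncomputable def onlyCoins (A : Finset (G.edgeSet × Bool)) (i : G.edgeSet × Bool) : Bool :=
  decide (i ∈ A)

/-- The walk weight, as a function of finite sets of coins of the first family. -/
noncomputable def firstWeight (u a : V) (A : Finset (G.edgeSet × Bool)) : ℝ≥0∞ :=
  walkSup (fun _ => 1) (firstCoins (onlyCoins A)) u a

/-- The walk weight, as a function of finite sets of coins. -/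
noncomputable def bothWeight (n : ℕ) (b v : V) (A : Finset (G.edgeSet × Bool)) : ℝ≥0∞ :=
  walkSup (ballWeight n) (bothCoins (onlyCoins A)) b v

open Classical in
/-- The indicator of the coin of the second family at the edge `e`. -/
noncomputable def coinWeight (e : G.edgeSet) (A : Finset (G.edgeSet × Bool)) : ℝ≥0∞ :=
  if (e, true) ∈ A then 1 else 0

lemma onlyCoins_le {A : Finset (G.edgeSet × Bool)} {z : G.edgeSet × Bool → Bool}
    (h : ∀ i ∈ A, z i = true) : onlyCoins A ≤ z := by
  intro i
  by_cases hi : i ∈ A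
  · rw [h i hi]; exact le_top
  · simp [onlyCoins, hi]

lemma openSup_firstWeight_le (u a : V) (z : G.edgeSet × Bool → Bool) :
    openSup (firstWeight u a) z ≤ walkSup (fun _ => 1) (firstCoins z) u a := by
  classical
  refine iSup_le fun A => ?_
  split_ifs with h
  · exact walkSup_mono _ (fun e => onlyCoins_le h (e, false)) _ _
  · exact zero_le

lemma openSup_bothWeight_le (n : ℕ) (b v : V) (z : G.edgeSet × Bool → Bool) :
    openSup (bothWeight n b v) z ≤ walkSup (ballWeight n) (bothCoins z) b v := by
  classical
  refine iSup_le fun A => ?_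
  split_ifs with h
  · exact walkSup_mono _ (fun e => sup_le_sup (onlyCoins_le h (e, false))
      (onlyCoins_le h (e, true))) _ _
  · exact zero_le

lemma openSup_coinWeight_le (e : G.edgeSet) (z : G.edgeSet × Bool → Bool) :
    openSup (coinWeight e) z ≤ if z (e, true) = true then 1 else 0 := by
  classical
  refine iSup_le fun A => ?_
  unfold coinWeight
  split_ifs with h1 h2 h3
  · exact le_rfl
  · exact absurd (h1 _ h2) h3
  · exact zero_le
  · exact le_rfl
  · exact zero_le
  · exact le_rfl

lemma exists_first_edge {H : SimpleGraph V} {u v : V} (p : H.Walk u v) (Q : Sym2 V → Prop) :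
    (∀ e ∈ p.edges, Q e) ∨ ∃ (a b : V) (_ : H.Adj a b) (p₁ : H.Walk u a) (p₂ : H.Walk b v),
      p.edges = p₁.edges ++ s(a, b) :: p₂.edges ∧ (∀ e ∈ p₁.edges, Q e) ∧ ¬ Q s(a, b) := by
  induction p with
  | nil => exact Or.inl (by simp)
  | @cons u w v h p ih =>
    by_cases hQ : Q s(u, w)
    · rcases ih with ih | ⟨a, b, hab, p₁, p₂, h1, h2, h3⟩
      · refine Or.inl fun e he => ?_
        rw [SimpleGraph.Walk.edges_cons, List.mem_cons] at he
        rcases he with rfl | he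
        · exact hQ
        · exact ih e he
      · refine Or.inr ⟨a, b, hab, .cons h p₁, p₂, by simp [h1], fun e he => ?_, h3⟩
        rw [SimpleGraph.Walk.edges_cons, List.mem_cons] at he
        rcases he with rfl | he
        · exact hQ
        · exact h2 e he
    · exact Or.inr ⟨u, w, h, .nil, p, by simp, by simp, hQ⟩

open Classical in
/-- A walk in the sprinkled configuration either uses no sprinkled edge, or has a first one. -/
lemma walkSup_bothCoins_le (n : ℕ) (z : G.edgeSet × Bool → Bool) (u v : V) :
    walkSup (ballWeight n) (bothCoins z) u v ≤ walkSup (fun _ => 1) (firstCoins z) u v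
      + ∑' c : V × V, if h : G.Adj c.1 c.2 then
          disjSup (splitSup (firstWeight u c.1) (coinWeight ⟨s(c.1, c.2), h⟩))
            (bothWeight n c.2 v) z else 0 := by
  by_cases hr : (openGraph (bothCoins z)).Reachable u v ∧ dInt (bothCoins z) u v ≤ n
  · rw [walkSup_ballWeight_eq_one hr.1 hr.2]
    obtain ⟨p, hp, hlen⟩ := hr.1.exists_path_of_dist
    have hpn : p.length ≤ n := hlen ▸ hr.2
    have hnd := hp.isTrail.edges_nodup
    -- Look for the first edge whose first coin is closed; it can be open only through its second
    -- coin.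
    rcases exists_first_edge p (fun e => ∃ h : e ∈ G.edgeSet, z (⟨e, h⟩, false) = true) with
      hall | ⟨a, b, hab, p₁, p₂, hedges, hfirst, hnot⟩
    · obtain ⟨q, -⟩ := exists_walk_of_open (openGraph_le _) p (ω := firstCoins z) fun e he => by
        obtain ⟨hG, h⟩ := hall _ he
        exact h
      exact le_add_right (le_walkSup (fun _ => 1) q)
    · have hG : G.Adj a b := openGraph_le _ hab
      refine le_add_left (le_trans ?_ (ENNReal.le_tsum (a, b)))
      rw [dif_pos hG]
      set e : G.edgeSet := ⟨s(a, b), hG⟩ with he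
      have hze : z (e, true) = true := by
        obtain ⟨h, ho⟩ := openGraph_adj.1 hab
        have h0 : z (e, false) ≠ true := fun h => hnot ⟨_, h⟩
        exact (by simpa [bothCoins] using ho :
          z (e, false) = true ∨ z (e, true) = true).resolve_left h0
      rw [hedges, List.nodup_append, List.nodup_cons] at hnd
      have hlen2 : p₂.length ≤ n := by
        have := congrArg List.length hedges
        simp only [SimpleGraph.Walk.length_edges, List.length_append, List.length_cons] at this
        omega
      set A : Finset (G.edgeSet × Bool) := edgesOf p₁.edges ×ˢ {false} with hA
      -- An edge of `p₂` may be open through only one of its two coins, so only the open ones are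
      -- kept.
      set C : Finset (G.edgeSet × Bool) :=
        (edgesOf p₂.edges ×ˢ Finset.univ).filter fun i => z i = true with hC
      have hmemA : ∀ i ∈ A, (i.1 : Sym2 V) ∈ p₁.edges ∧ i.2 = false := fun i hi => by
        rw [hA, Finset.mem_product, Finset.mem_singleton] at hi
        exact ⟨mem_edgesOf.1 hi.1, hi.2⟩
      have hmemC : ∀ i ∈ C, (i.1 : Sym2 V) ∈ p₂.edges ∧ z i = true := fun i hi => by
        rw [hC, Finset.mem_filter, Finset.mem_product] at hi
        exact ⟨mem_edgesOf.1 hi.1.1, hi.2⟩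
      have hAo : ∀ i ∈ A, z i = true := by
        rintro ⟨i, c⟩ hi
        obtain ⟨h1, h2⟩ := hmemA _ hi
        obtain ⟨hG, h3⟩ := hfirst _ h1
        simp only at h2
        rw [h2]
        exact h3
      have hAB : Disjoint A {(e, true)} := by
        rw [Finset.disjoint_singleton_right]
        intro hi
        simpa using (hmemA _ hi).2
      have hAC : Disjoint A C := Finset.disjoint_left.2 fun i hi hi' =>
        hnd.2.2 _ (hmemA i hi).1 _ (List.mem_cons_of_mem _ (hmemC i hi').1) rfl
      have hBC : Disjoint {(e, true)} C := by
        rw [Finset.disjoint_singleton_left]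
        exact fun hi => hnd.2.1.1 (hmemC _ hi).1
      refine le_trans ?_ (le_disjSup_splitSup (F := firstWeight u a) (G := coinWeight e)
        (H := bothWeight n b v) hAB hAC hBC hAo (by simp [hze]) fun i hi => (hmemC i hi).2)
      have h1 : 1 ≤ firstWeight u a A := by
        obtain ⟨q, -⟩ := exists_walk_of_open (openGraph_le _) p₁
          (ω := firstCoins (onlyCoins A)) fun i hi => by
            simp [firstCoins, onlyCoins, hA, mem_edgesOf, hi]
        exact le_walkSup (fun _ => 1) q
      have h2 : coinWeight e {(e, true)} = 1 := by simp [coinWeight]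
      have h3 : 1 ≤ bothWeight n b v C := by
        obtain ⟨q, hq⟩ := exists_walk_of_open (openGraph_le _) p₂
          (ω := bothCoins (onlyCoins C)) fun i hi => by
            have ho := open_of_mem_edges p₂ hi
            simpa [bothCoins, onlyCoins, hC, mem_edgesOf, hi] using ho
        rw [← ballWeight_of_le hlen2, ← length_eq_of_edges_eq hq]
        exact le_walkSup (ballWeight n) q
      rw [h2, mul_one]
      exact one_le_mul h1 h3
  · rw [walkSup_ballWeight_eq_zero hr]
    exact zero_le

lemma lintegral_firstCoins (p ε : I) {f : (G.edgeSet → Bool) → ℝ≥0∞} (hf : Measurable f) :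
    ∫⁻ z, f (firstCoins z) ∂(bern (biasPair p ε)) = ∫⁻ ω, f ω ∂(law G p) := by
  have h : law G p = (bern (biasPair (ι := G.edgeSet) p ε)).map fun z i => z (i, false) :=
    (map_fst_bern p ε).symm
  rw [h, lintegral_map hf (by fun_prop)]
  rfl

lemma lintegral_bothCoins {p ε p' : I} (h : σ p' = σ p * σ ε) {f : (G.edgeSet → Bool) → ℝ≥0∞}
    (hf : Measurable f) :
    ∫⁻ z, f (bothCoins z) ∂(bern (biasPair p ε)) = ∫⁻ ω, f ω ∂(law G p') := by
  have h : law G p' = (bern (biasPair (ι := G.edgeSet) p ε)).map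
      fun z i => z (i, false) || z (i, true) := (map_or_bern h).symm
  rw [h, lintegral_map hf measurable_or_pair]
  rfl

lemma lintegral_openSup_coinWeight_le (p ε : I) (e : G.edgeSet) :
    ∫⁻ z, openSup (coinWeight e) z ∂(bern (biasPair p ε)) ≤ toNNReal ε := by
  have hm : MeasurableSet {z : G.edgeSet × Bool → Bool | z (e, true) = true} :=
    measurableSet_coord _
  calc ∫⁻ z, openSup (coinWeight e) z ∂(bern (biasPair p ε))
      ≤ ∫⁻ z, {z : G.edgeSet × Bool → Bool | z (e, true) = true}.indicator 1 z
          ∂(bern (biasPair p ε)) := lintegral_mono fun z => by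
        refine (openSup_coinWeight_le e z).trans ?_
        simp [Set.indicator_apply]
    _ = bern (biasPair p ε) {z | z (e, true) = true} := lintegral_indicator_one hm
    _ = bernoulliMeasure true false (biasPair p ε (e, true)) {true} := by
        rw [← (measurePreserving_eval_infinitePi (fun i : G.edgeSet × Bool =>
          bernoulliMeasure true false (biasPair p ε i)) (e, true)).measure_preimage
          MeasurableSet.of_discrete.nullMeasurableSet]
        rfl
    _ = _ := by
        rw [bernoulliMeasure_apply_of_mem_of_notMem _ MeasurableSet.of_discrete (by simp)
          (by simp)]
        simp [biasPair]

variable [Countable V]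

open Classical in
lemma meanWeight_sprinkle_le {p ε p' : I} (h : σ p' = σ p * σ ε) (n : ℕ) (u v : V) :
    meanWeight G p' (ballWeight n) u v ≤ T G p u v
      + ∑' c : V × V, if G.Adj c.1 c.2 then
          T G p u c.1 * toNNReal ε * meanWeight G p' (ballWeight n) c.2 v else 0 := by
  rw [meanWeight, ← lintegral_bothCoins h (measurable_walkSup _ u v)]
  refine (lintegral_mono fun z => walkSup_bothCoins_le n z u v).trans ?_
  have hm1 : Measurable fun z : G.edgeSet × Bool → Bool =>
      walkSup (fun _ => 1) (firstCoins z) u v :=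
    (measurable_walkSup (fun _ => 1) u v).comp (show Measurable (firstCoins (G := G)) from
      measurable_pi_lambda _ fun e => measurable_pi_apply (e, false))
  rw [lintegral_add_left hm1, lintegral_firstCoins p ε (measurable_walkSup _ u v),
    T_eq_meanWeight]
  refine add_le_add le_rfl ?_
  rw [lintegral_tsum fun c => ?_]
  · refine ENNReal.tsum_le_tsum fun c => ?_
    split_ifs with hc
    · refine (lintegral_disjSup_splitSup_le _ _ _ _).trans
        (mul_le_mul' (mul_le_mul' ?_ (lintegral_openSup_coinWeight_le p ε _)) ?_)
      · rw [T_eq_meanWeight, meanWeight, ← lintegral_firstCoins p ε (measurable_walkSup _ u c.1)]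
        exact lintegral_mono fun z => openSup_firstWeight_le u c.1 z
      · rw [meanWeight, ← lintegral_bothCoins h (measurable_walkSup _ c.2 v)]
        exact lintegral_mono fun z => openSup_bothWeight_le n c.2 v z
    · simp
  · split_ifs with hc
    · exact (measurable_disjSup _ _).aemeasurable
    · exact aemeasurable_const

lemma genSup_one_eq (p : I) : genSup G p 1 = ⨆ u, ∑' v, T G p u v := by
  refine iSup_congr fun u => ?_
  rw [gen_eq_tsum p le_rfl]
  refine tsum_congr fun v => ?_
  rw [T_eq_meanWeight]
  congr 1
  funext n
  simp [powWeight]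

/-- Before the first sprinkled edge the walk is open at `p`, giving the susceptibility at `p`; the
edge costs `ε` and has at most `D` directions; the rest is again an intrinsic ball at `p'`.
Truncating at radius `n` keeps the quantity on both sides finite. -/
lemma Gr_sprinkle_le [G.LocallyFinite] {D : ℕ} (hD : ∀ v, G.degree v + 1 ≤ D) {p ε p' : I}
    (h : σ p' = σ p * σ ε) (n : ℕ) :
    Gr G p' n ≤ genSup G p 1 + genSup G p 1 * toNNReal ε * D * Gr G p' n := by
  classical
  rw [Gr_eq p' n]
  refine iSup_le fun u => ?_
  have hT : ∑' v, T G p u v ≤ genSup G p 1 := by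
    rw [genSup_one_eq]
    exact le_iSup (fun u => ∑' v, T G p u v) u
  calc ∑' v, meanWeight G p' (ballWeight n) u v
      ≤ ∑' v, T G p u v + ∑' v, ∑' c : V × V, if G.Adj c.1 c.2 then
          T G p u c.1 * toNNReal ε * meanWeight G p' (ballWeight n) c.2 v else 0 := by
        rw [← ENNReal.tsum_add]
        exact ENNReal.tsum_le_tsum fun v => meanWeight_sprinkle_le h n u v
    _ ≤ genSup G p 1 + ∑' c : V × V, if G.Adj c.1 c.2 then
          T G p u c.1 * toNNReal ε * Gr G p' n else 0 := by
        refine add_le_add hT ?_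
        rw [ENNReal.tsum_comm]
        refine ENNReal.tsum_le_tsum fun c => ?_
        split_ifs
        · rw [ENNReal.tsum_mul_left]
          exact mul_le_mul_right (tsum_meanWeight_ballWeight_le p' n c.2) _
        · simp
    _ = genSup G p 1 + ∑' a, G.degree a * (T G p u a * toNNReal ε * Gr G p' n) := by
        rw [ENNReal.tsum_prod']
        congr 1
        exact tsum_congr fun a => by convert tsum_adj (G := G) a _; rfl
    _ ≤ genSup G p 1 + ∑' a, T G p u a * (toNNReal ε * D * Gr G p' n) := by
        refine add_le_add le_rfl (ENNReal.tsum_le_tsum fun a => ?_)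
        calc (G.degree a : ℝ≥0∞) * (T G p u a * toNNReal ε * Gr G p' n)
            ≤ D * (T G p u a * toNNReal ε * Gr G p' n) :=
              mul_le_mul_left (by exact_mod_cast (Nat.le_succ _).trans (hD a)) _
          _ = _ := by ring
    _ ≤ _ := by
        rw [ENNReal.tsum_mul_right, ← Gr_eq]
        refine add_le_add le_rfl ((mul_le_mul_left hT _).trans (le_of_eq ?_))
        ring

lemma T_eq_iSup (p : I) (u v : V) : T G p u v = ⨆ n, meanWeight G p (ballWeight n) u v := by
  rw [T_eq_meanWeight]
  unfold meanWeight
  rw [← lintegral_iSup (fun n => measurable_walkSup _ u v)]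
  · refine lintegral_congr fun ω => ?_
    by_cases h : (openGraph ω).Reachable u v
    · rw [walkSup_of_reachable antitone_const h]
      refine le_antisymm (le_iSup_of_le (dInt ω u v) ?_) (iSup_le fun n => ?_)
      · rw [walkSup_ballWeight_eq_one h le_rfl]
      · refine iSup_le fun q => ?_
        unfold ballWeight
        split_ifs <;> simp
    · simp only [walkSup_of_not_reachable _ h, iSup_const]
  · intro m n hmn ω
    refine iSup_mono fun q => ?_
    unfold ballWeight
    split_ifs with h1 h2
    · exact le_rfl
    · exact absurd (h1.trans hmn) h2
    · exact zero_le
    · exact le_rfl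

lemma genSup_one_le_of_Gr_le {p : I} {c : ℝ≥0∞} (h : ∀ n, Gr G p n ≤ c) : genSup G p 1 ≤ c := by
  rw [genSup_one_eq]
  refine iSup_le fun u => ?_
  rw [ENNReal.tsum_eq_iSup_sum]
  refine iSup_le fun s => ?_
  simp_rw [T_eq_iSup]
  have hmono : ∀ v, Monotone fun n => meanWeight G p (ballWeight n) u v := by
    intro v m n hmn
    refine lintegral_mono fun ω => iSup_mono fun q => ?_
    unfold ballWeight
    split_ifs with h1 h2
    · exact le_rfl
    · exact absurd (h1.trans hmn) h2
    · exact zero_le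
    · exact le_rfl
  rw [ENNReal.finsetSum_iSup_of_monotone hmono]
  exact iSup_le fun n => (ENNReal.sum_le_tsum s).trans
    ((tsum_meanWeight_ballWeight_le p n u).trans (h n))

/-- Finiteness of the susceptibility is an open condition. -/
lemma exists_gt_genSup_one_lt_top [G.LocallyFinite] {D : ℕ} (hD : ∀ v, G.degree v + 1 ≤ D)
    {p : I} (hp : p < 1) (h : genSup G p 1 < ∞) : ∃ p' > p, genSup G p' 1 < ∞ := by
  set x : ℝ := (genSup G p 1).toReal * D with hx
  have hx0 : 0 ≤ x := by positivity
  -- Chosen so that the coefficient of `Gr` in `Gr_sprinkle_le` is at most one half.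
  set ε : I := ⟨1 / (2 * x + 2), by positivity, by
    rw [div_le_one (by positivity)]; linarith⟩ with hε
  have hε0 : (0 : ℝ) < ε := by
    change 0 < 1 / (2 * x + 2)
    positivity
  have hsmall : genSup G p 1 * toNNReal ε * D ≤ 2⁻¹ := by
    have hfin : genSup G p 1 * toNNReal ε * D ≠ ∞ :=
      ENNReal.mul_ne_top (ENNReal.mul_ne_top h.ne ENNReal.coe_ne_top) (ENNReal.natCast_ne_top D)
    rw [← ENNReal.toReal_le_toReal hfin (by simp)]
    have : (genSup G p 1 * toNNReal ε * D).toReal = x * (1 / (2 * x + 2)) := by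
      rw [ENNReal.toReal_mul, ENNReal.toReal_mul, hx, ENNReal.coe_toReal,
        unitInterval.coe_toNNReal, ENNReal.toReal_natCast, hε]
      ring
    rw [this, ENNReal.toReal_inv, ENNReal.toReal_ofNat, mul_one_div,
      div_le_iff₀ (by positivity)]
    linarith
  refine ⟨σ (σ p * σ ε), ?_, ?_⟩
  · have hp1 : (p : ℝ) < 1 := hp
    change (p : ℝ) < _
    simp only [unitInterval.coe_symm_eq, Set.Icc.coe_mul]
    nlinarith
  · refine (genSup_one_le_of_Gr_le (c := 2 * genSup G p 1) fun n => ?_).trans_lt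
      (ENNReal.mul_lt_top (by simp) h)
    -- Finiteness of the truncated volume permits its absorption into the left side; the resulting
    -- bound does not depend on `n`.
    have hG : Gr G (σ (σ p * σ ε)) n ≠ ∞ :=
      ne_top_of_le_ne_top (ENNReal.pow_ne_top (ENNReal.natCast_ne_top D)) (Gr_le_pow hD _ n)
    have h1 := Gr_sprinkle_le hD (p := p) (ε := ε) (p' := σ (σ p * σ ε))
      (unitInterval.symm_symm _) n
    set g := Gr G (σ (σ p * σ ε)) n
    have h2 : g / 2 + g / 2 ≤ genSup G p 1 + g / 2 := by
      rw [ENNReal.add_halves]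
      refine h1.trans (add_le_add le_rfl ?_)
      rw [div_eq_mul_inv, mul_comm g]
      exact mul_le_mul_left hsmall _
    have h3 := ENNReal.le_of_add_le_add_right (ENNReal.div_ne_top hG (by simp)) h2
    rw [mul_comm]
    exact (ENNReal.div_le_iff_le_mul (by simp) (by simp)).1 h3

end Sprinkling

/-! ### Infinite susceptibility at and above the critical point -/

section Critical

variable {V : Type*} {G : SimpleGraph V} [Countable V]

lemma le_pc_of_genSup_one_lt_top {p : I} (h : genSup G p 1 < ∞) : p ≤ pc G := by
  refine le_sSup ?_
  change ∀ᵐ ω ∂(law G p), ∀ u : V, (cluster ω u).Finite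
  rw [ae_all_iff]
  intro u
  have hm : Measurable fun ω : G.edgeSet → Bool => ∑' v, walkSup (fun _ => 1) ω u v :=
    Measurable.tsum fun v => measurable_walkSup _ u v
  have hfin : ∫⁻ ω, ∑' v, walkSup (fun _ => 1) ω u v ∂(law G p) ≠ ∞ := by
    rw [lintegral_tsum fun v => (measurable_walkSup _ u v).aemeasurable]
    rw [genSup_one_eq] at h
    refine ne_top_of_le_ne_top ((le_iSup (fun u => ∑' v, T G p u v) u).trans_lt h).ne ?_
    exact ENNReal.tsum_le_tsum fun v => (T_eq_meanWeight p u v).ge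
  filter_upwards [ae_lt_top hm hfin] with ω hω
  by_contra hinf
  have : ∑' _ : cluster ω u, (1 : ℝ≥0∞) ≤ ∑' v, walkSup (fun _ => 1) ω u v := by
    rw [tsum_subtype (cluster ω u) fun _ => (1 : ℝ≥0∞)]
    refine ENNReal.tsum_le_tsum fun v => ?_
    by_cases hv : v ∈ cluster ω u
    · rw [Set.indicator_of_mem hv,
        walkSup_of_reachable antitone_const (show (openGraph ω).Reachable u v from hv)]
    · rw [Set.indicator_of_notMem hv]
      exact zero_le
  rw [ENNReal.tsum_set_one, Set.encard_eq_top_iff.2 hinf] at this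
  exact absurd (this.trans_lt hω) (by simp)

/-- If the susceptibility were finite at `p`, it would be finite at some `p' > p`. Clusters would
then be almost surely finite at `p'`, so that `p' ≤ p_c`. -/
lemma genSup_one_eq_top_of_pc_le [G.LocallyFinite] {D : ℕ} (hD : ∀ v, G.degree v + 1 ≤ D) {p : I}
    (hp : p < 1) (hpc : pc G ≤ p) : genSup G p 1 = ∞ := by
  by_contra h
  obtain ⟨p', hlt, h'⟩ := exists_gt_genSup_one_lt_top hD hp (lt_top_iff_ne_top.2 h)
  exact absurd (le_pc_of_genSup_one_lt_top h') (not_le.2 (hpc.trans_lt hlt))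

lemma T_zero (u v : V) (h : u ≠ v) : T G 0 u v = 0 := by
  have hlaw : law G 0 = Measure.dirac fun _ => false := by
    unfold law
    simp only [bernoulliMeasure_zero]
    exact Measure.infinitePi_dirac _
  rw [T_eq_meanWeight, meanWeight, hlaw, lintegral_dirac' _ (measurable_walkSup _ u v)]
  refine walkSup_of_not_reachable _ fun ⟨q⟩ => ?_
  cases q with
  | nil => exact h rfl
  | cons hadj _ => simpa using openGraph_adj.1 hadj

lemma T_one (hconn : G.Connected) (u v : V) : T G 1 u v = 1 := by
  have hlaw : law G 1 = Measure.dirac fun _ => true := by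
    unfold law
    simp only [bernoulliMeasure_one]
    exact Measure.infinitePi_dirac _
  rw [T_eq_meanWeight, meanWeight, hlaw, lintegral_dirac' _ (measurable_walkSup _ u v)]
  obtain ⟨q⟩ := hconn u v
  obtain ⟨q', -⟩ := exists_walk_of_open le_rfl q (ω := fun _ : G.edgeSet => true) fun _ _ => rfl
  exact walkSup_of_reachable antitone_const ⟨q'⟩

/-- At `p = 0` the susceptibility is at most `1`, and its finiteness persists at some positive
parameter. -/
lemma pc_pos [G.LocallyFinite] {D : ℕ} (hD : ∀ v, G.degree v + 1 ≤ D) : 0 < pc G := by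
  have h : genSup G 0 1 < ∞ := by
    rw [genSup_one_eq]
    refine lt_of_le_of_lt (iSup_le fun u => ?_) ENNReal.one_lt_top
    rw [tsum_eq_single u fun v hv => T_zero u v hv.symm]
    exact prob_le_one
  obtain ⟨p', h0, h'⟩ := exists_gt_genSup_one_lt_top hD zero_lt_one h
  exact h0.trans_le (le_pc_of_genSup_one_lt_top h')

/-- At `p = 1` all entries of `T` are `1`, so the diagonal entries of `T^2 P^k T` are at least a row
sum of `P^k`, which is `1` for every `k`. -/
lemma one_notMem_INabla [G.LocallyFinite] (hconn : G.Connected) : (1 : I) ∉ INabla G := by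
  intro h
  obtain ⟨v⟩ := hconn.nonempty
  obtain ⟨k, hk⟩ := ((tendsto_order.1 h).2 1 one_pos).exists
  refine absurd hk (not_lt.2 (le_trans ?_ (le_iSup (fun v => mmul (mmul (mmul (T G 1) (T G 1))
    (mpow (srw G) k)) (T G 1) v v) v)))
  have h1 : 1 ≤ mmul (T G 1) (T G 1) v v := by
    refine le_trans ?_ (ENNReal.le_tsum v)
    rw [T_one hconn, one_mul]
  calc (1 : ℝ≥0∞) = ∑' w, mpow (srw G) k v w := (tsum_mpow_srw k v).symm
    _ ≤ _ := ENNReal.tsum_le_tsum fun w => by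
      rw [T_one hconn, mul_one]
      refine le_trans ?_ (ENNReal.le_tsum v)
      calc mpow (srw G) k v w = 1 * mpow (srw G) k v w := (one_mul _).symm
        _ ≤ _ := mul_le_mul_left h1 _

lemma genSup_one_eq_top [G.LocallyFinite] (hconn : G.Connected) {D : ℕ}
    (hD : ∀ v, G.degree v + 1 ≤ D) {p : I} (hp : p ∈ INabla G) (hpc : pc G ≤ p) :
    genSup G p 1 = ∞ :=
  genSup_one_eq_top_of_pc_le hD
    (lt_of_le_of_ne unitInterval.le_one' fun h => one_notMem_INabla hconn (h ▸ hp)) hpc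

end Critical

/-! ### From the differential inequality to the bound near `α_p` -/

section Divergence

/-- These are the first two terms of the binomial expansion. They turn the formal derivative into a
finite-difference bound, so nothing has to be differentiated. -/
lemma pow_add_mul_pow_le (a d : ℝ≥0∞) (n : ℕ) :
    a ^ n + d * (n * a ^ (n - 1)) ≤ (a + d) ^ n := by
  induction n with
  | zero => simp
  | succ n ih =>
    calc a ^ (n + 1) + d * ((n + 1 : ℕ) * a ^ (n + 1 - 1))
        ≤ (a ^ n + d * (n * a ^ (n - 1))) * a + a ^ n * d := by
          rw [Nat.add_sub_cancel]
          cases n with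
          | zero => simp
          | succ n =>
            rw [Nat.add_sub_cancel]
            push_cast
            exact le_of_eq (by ring)
      _ ≤ (a ^ n + d * (n * a ^ (n - 1))) * a + (a ^ n + d * (n * a ^ (n - 1))) * d :=
          add_le_add le_rfl (mul_le_mul_left le_self_add _)
      _ = (a ^ n + d * (n * a ^ (n - 1))) * (a + d) := (mul_add _ _ _).symm
      _ ≤ (a + d) ^ (n + 1) := by
          rw [pow_succ]
          exact mul_le_mul_left ih _

variable {V : Type*} {G : SimpleGraph V}

lemma gen_add_mul_derivGen_le (p : I) (α δ : ℝ≥0) (u : V) :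
    gen G p α u + δ * derivGen G p α u ≤ gen G p (α + δ) u := by
  refine (add_le_add le_rfl (lintegral_const_mul_le _ _)).trans ((le_lintegral_add _ _).trans ?_)
  refine lintegral_mono fun ω => ?_
  simp only [← ENNReal.tsum_mul_left, ← ENNReal.tsum_add]
  refine ENNReal.tsum_le_tsum fun v => ?_
  rw [ENNReal.coe_add]
  exact pow_add_mul_pow_le _ _ _

/-- A function whose growth rate is at least `c` times its square explodes. -/
lemma mul_sub_le_two_of_forall_add_le {F : ℝ → ℝ} {a b c : ℝ} (hc : 0 < c) (ha : 0 ≤ F a)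
    (h : ∀ x y, a ≤ x → x ≤ y → y ≤ b → F x + (y - x) * (c * F x ^ 2) ≤ F y) :
    c * F a * (b - a) ≤ 2 := by
  by_contra! hlt
  have hF : 0 < F a := lt_of_le_of_ne ha fun h0 => by rw [← h0] at hlt; norm_num at hlt
  have hcF : 0 < c * F a := mul_pos hc hF
  -- The steps `1 / (c F(a) 2 ^ n)` are just long enough for `F` to double each time, while their
  -- total length `2 / (c F(a))` stays inside `[a, b]`. Then `F` would be unbounded below `F(b)`.
  set x : ℕ → ℝ := fun n => a + 2 / (c * F a) * (1 - (1 / 2) ^ n) with hx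
  have hxa : ∀ n, a ≤ x n := fun n => le_add_of_nonneg_right (mul_nonneg (by positivity)
    (sub_nonneg.2 (pow_le_one₀ (by norm_num) (by norm_num))))
  have hxb : ∀ n, x n ≤ b := fun n => by
    have h1 : 2 / (c * F a) ≤ b - a := by rw [div_le_iff₀ hcF]; linarith
    have h2 : 2 / (c * F a) * (1 - (1 / 2) ^ n) ≤ 2 / (c * F a) :=
      mul_le_of_le_one_right (by positivity) (by linarith [pow_pos (one_half_pos (α := ℝ)) n])
    simp only [hx]
    linarith
  have hstep : ∀ n, x (n + 1) - x n = 1 / (c * F a * 2 ^ n) := fun n => by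
    simp only [hx, one_div, inv_pow, pow_succ]
    field_simp
    ring
  have hgrow : ∀ n, 2 ^ n * F a ≤ F (x n) := fun n => by
    induction n with
    | zero => simp [hx]
    | succ n ih =>
      have hs := h (x n) (x (n + 1)) (hxa n)
        (sub_nonneg.1 (by rw [hstep]; positivity)) (hxb _)
      rw [hstep] at hs
      have h0 : 0 < 2 ^ n * F a := by positivity
      have : F (x n) ≤ 1 / (c * F a * 2 ^ n) * (c * F (x n) ^ 2) := by
        rw [one_div_mul_eq_div, le_div_iff₀ (by positivity)]
        nlinarith [mul_le_mul_of_nonneg_left ih (mul_nonneg hc.le (h0.le.trans ih))]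
      rw [pow_succ]
      linarith
  have hbound : ∀ n, F (x n) ≤ F b := fun n => by
    have := h (x n) b (hxa n) (hxb n) le_rfl
    have h1 := mul_nonneg (sub_nonneg.2 (hxb n)) (mul_nonneg hc.le (sq_nonneg (F (x n))))
    linarith
  obtain ⟨n, hn⟩ := pow_unbounded_of_one_lt (F b / F a) (one_lt_two (α := ℝ))
  rw [div_lt_iff₀ hF] at hn
  linarith [hgrow n, hbound n]

lemma genSup_lt_top_of_lt_alphaCrit {p : I} {α : ℝ≥0} (h : (α : ℝ≥0∞) < alphaCrit G p) :
    genSup G p α < ∞ := by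
  obtain ⟨β, hβ⟩ := lt_iSup_iff.1 h
  obtain ⟨hfin, hlt⟩ := lt_iSup_iff.1 hβ
  exact (genSup_mono p (by exact_mod_cast hlt.le)).trans_lt hfin

/-- The explosion bound applies on `[α, b]` for each `b < a`, where the generating function is
finite; the endpoint `a` itself is reached only as a limit. -/
lemma genSup_le_div {p : I} {α : ℝ≥0} {a c : ℝ} (hc : 0 < c) (ha : a ≤ 1)
    (hcrit : alphaCrit G p = ENNReal.ofReal a) (hα : (α : ℝ) < a)
    (h : ∀ β : ℝ≥0, α ≤ β → β ≤ 1 → genSup G p β < ∞ → ∀ u,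
      ENNReal.ofReal c * gen G p β u ^ 2 ≤ derivGen G p β u) :
    genSup G p α ≤ ENNReal.ofReal (2 / c / (a - α)) := by
  have hfin : ∀ x : ℝ, 0 ≤ x → x < a → genSup G p x.toNNReal < ∞ := fun x hx hxa =>
    genSup_lt_top_of_lt_alphaCrit (by
      rw [hcrit]
      exact (ENNReal.ofReal_lt_ofReal_iff (hx.trans_lt hxa)).2 hxa)
  refine iSup_le fun u => ?_
  have hfinu : ∀ x : ℝ, 0 ≤ x → x < a → gen G p x.toNNReal u ≠ ∞ := fun x hx hxa =>
    ((le_iSup (fun u => gen G p x.toNNReal u) u).trans_lt (hfin x hx hxa)).ne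
  set F : ℝ → ℝ := fun x => (gen G p x.toNNReal u).toReal with hF
  have hα0 : (0 : ℝ) ≤ α := α.coe_nonneg
  have hkey : ∀ b < a, c * F α * (b - α) ≤ 2 := fun b hb =>
    mul_sub_le_two_of_forall_add_le hc ENNReal.toReal_nonneg fun x y hax hxy hyb => by
      have hx0 := hα0.trans hax
      have hy := hfinu y (hx0.trans hxy) (hyb.trans_lt hb)
      have hxf := hfinu x hx0 ((hxy.trans hyb).trans_lt hb)
      have h1 := gen_add_mul_derivGen_le (G := G) p x.toNNReal (y - x).toNNReal u
      rw [← Real.toNNReal_add hx0 (sub_nonneg.2 hxy), add_sub_cancel] at h1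
      have h2 := h x.toNNReal (by rwa [Real.le_toNNReal_iff_coe_le hx0])
        (by
          rw [Real.toNNReal_le_one]
          exact (hxy.trans (hyb.trans hb.le)).trans ha)
        (hfin x hx0 ((hxy.trans hyb).trans_lt hb)) u
      have h3 := (add_le_add le_rfl (mul_le_mul_right h2 _)).trans h1
      have h4 := ENNReal.toReal_mono hy h3
      have hne : ((y - x).toNNReal : ℝ≥0∞) * (ENNReal.ofReal c * gen G p x.toNNReal u ^ 2) ≠ ∞ :=
        ENNReal.mul_ne_top ENNReal.coe_ne_top
          (ENNReal.mul_ne_top ENNReal.ofReal_ne_top (ENNReal.pow_ne_top hxf))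
      rwa [ENNReal.toReal_add hxf hne, ENNReal.toReal_mul, ENNReal.toReal_mul, ENNReal.toReal_pow,
        ENNReal.coe_toReal, ENNReal.toReal_ofReal hc.le,
        Real.coe_toNNReal _ (sub_nonneg.2 hxy)] at h4
  have hlim : c * F α * (a - α) ≤ 2 := by
    have ht : Tendsto (fun b : ℝ => c * F α * (b - α)) (𝓝[<] a) (𝓝 (c * F α * (a - α))) :=
      (Continuous.tendsto (by fun_prop) a).mono_left nhdsWithin_le_nhds
    exact le_of_tendsto ht (eventually_nhdsWithin_of_forall hkey)
  have hle : F α ≤ 2 / c / (a - α) := by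
    rw [div_div, le_div_iff₀ (mul_pos hc (sub_pos.2 hα))]
    linarith
  have hα' := hfinu α hα0 hα
  simp only [hF, Real.toNNReal_coe] at hle hα'
  exact (ENNReal.le_ofReal_iff_toReal_le hα' (ENNReal.toReal_nonneg.trans hle)).2 hle

lemma exists_continuousOn_genSup_le [Countable V] [G.LocallyFinite] (hconn : G.Connected)
    (hqt : QuasiTransitive G) :
    ∃ κ : I → ℝ, ContinuousOn κ (INabla G) ∧ (∀ p ∈ INabla G, 0 < κ p) ∧
      ∀ p ∈ INabla G, pc G ≤ p → ∀ α : ℝ≥0, α < 1 → (α : ℝ≥0∞) < alphaCrit G p →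
        genSup G p α ≤ ENNReal.ofReal (κ p) / (alphaCrit G p - α) := by
  obtain ⟨D, hD⟩ := exists_degree_bound hqt
  have := hconn.nonempty
  obtain ⟨v₀⟩ := hconn.nonempty
  have hD0 : (0 : ℝ) < D := by exact_mod_cast (Nat.succ_pos _).trans_le (hD v₀)
  have hpc := pc_pos (G := G) hD
  obtain ⟨f, hf, hft⟩ := exists_continuousOn_forall_mem (X := I) (A := INabla G)
    (t := fun p => {x : ℝ | 0 < x ∧ (p ∈ INabla G → pc G ≤ p → ∀ α : ℝ≥0,
      (α : ℝ≥0∞) < alphaCrit G p →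
        genSup G p α ≤ ENNReal.ofReal x / (alphaCrit G p - α))})
    (fun p => ⟨fun x hx y hy z hz => ⟨hx.1.trans_le hz.1, fun h1 h2 α h4 =>
      (hx.2 h1 h2 α h4).trans (ENNReal.div_le_div_right (ENNReal.ofReal_le_ofReal hz.1) _)⟩⟩)
    fun p₀ hp₀ => by
      obtain ⟨p₁, hp₁, hev⟩ := exists_eventually_le_of_mem G hp₀
      -- For `p ≥ p_c` one has `α_p ≥ 1 / D`, so `p β ≥ δ` whenever `β ≥ α_p / 2`. The constant then
      -- depends on `p` only through `p₁`.
      set δ : ℝ≥0 := toNNReal (pc G) * (1 / (2 * D)) with hδ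
      have hδ0 : 0 < δ := by
        have h1 : (0 : ℝ≥0) < D := by exact_mod_cast hD0
        have h2 : 0 < toNNReal (pc G) := hpc
        positivity
      obtain ⟨c, hc, -, H⟩ := exists_forall_mul_gen_sq_le hconn hqt hp₁ hδ0
      refine ⟨4 / c, ?_⟩
      filter_upwards [nhdsWithin_le_nhds hev] with p hle
      refine ⟨by positivity, fun hp hpcp α hα => ?_⟩
      have hcrit := alphaCrit_eq hD (genSup_one_eq_top hconn hD hp hpcp)
      set a := Real.exp (-gammaInt G p) with ha
      have ha1 : a ≤ 1 := Real.exp_le_one_iff.2 (neg_nonpos.2 (gammaInt_nonneg hD p))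
      have haD : 1 / D ≤ a := by
        rw [ha, Real.exp_neg, one_div]
        refine inv_anti₀ (Real.exp_pos _) ?_
        rw [← Real.le_log_iff_exp_le hD0]
        exact gammaInt_le_log hD p
      have ha0 : 0 < a := Real.exp_pos _
      have hαa : (α : ℝ) < a := by
        rw [hcrit, ← ENNReal.ofReal_coe_nnreal] at hα
        exact (ENNReal.ofReal_lt_ofReal_iff ha0).1 hα
      -- Small `α` are raised to `a / 2` by monotonicity. This at most halves the distance to `a`,
      -- whence `4 / c` instead of `2 / c`.
      set α' : ℝ≥0 := max α (a / 2).toNNReal with hα'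
      have hα'r : (α' : ℝ) = max (α : ℝ) (a / 2) := by
        rw [hα', NNReal.coe_max, Real.coe_toNNReal _ (by positivity)]
      have hα'a : (α' : ℝ) < a := by
        rw [hα'r]
        exact max_lt hαa (by linarith)
      have hbound := genSup_le_div (α := α') hc ha1 hcrit hα'a fun β hβ hβ1 hfin u =>
        H p (hle hp) β hβ1 (by
          rw [hδ]
          refine mul_le_mul' hpcp (le_trans ?_ hβ)
          rw [← NNReal.coe_le_coe, hα'r]
          refine le_trans ?_ (le_max_right _ _)
          push_cast
          rw [one_div, mul_inv, ← one_div (D : ℝ)]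
          linarith) hfin u
      refine (genSup_mono p (le_max_left _ _)).trans (hbound.trans ?_)
      rw [hcrit, ← ENNReal.ofReal_coe_nnreal, ← ENNReal.ofReal_sub _ α.coe_nonneg,
        ← ENNReal.ofReal_div_of_pos (sub_pos.2 hαa)]
      refine ENNReal.ofReal_le_ofReal ?_
      have hhalf : (a - α) / 2 ≤ a - α' := by
        rw [hα'r]
        rcases max_cases (α : ℝ) (a / 2) with h | h <;> rw [h.1] <;>
          linarith
      calc 2 / c / (a - α') ≤ 2 / c / ((a - α) / 2) :=
            div_le_div_of_nonneg_left (by positivity) (half_pos (sub_pos.2 hαa)) hhalf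
        _ = 4 / c / (a - α) := by
            have := (sub_pos.2 hαa).ne'
            field_simp
            norm_num
  exact ⟨f, hf, fun p hp => (hft p hp).1, fun p hp hpcp α _ hα => (hft p hp).2 hp hpcp α hα⟩

end Divergence

end Percolation

theorem mainTheorem6 {V : Type*} (G : SimpleGraph V) [G.LocallyFinite]
    (hconn : G.Connected) (hqt : Percolation.QuasiTransitive G) :
    -- the differential inequality
    (∃ η : I × ℝ≥0 → ℝ,
      ContinuousOn η ((Percolation.INabla G \ {0}) ×ˢ Set.Ioc 0 1) ∧
      (∀ z ∈ (Percolation.INabla G \ {0}) ×ˢ Set.Ioc (0 : ℝ≥0) 1, η z ∈ Set.Ioc (0 : ℝ) 1) ∧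
      ∀ p ∈ Percolation.INabla G, 0 < p → ∀ α : ℝ≥0, 0 < α → α ≤ 1 →
        Percolation.genSup G p α < ∞ → ∀ u : V,
          ENNReal.ofReal (η (p, α)) * Percolation.gen G p α u ^ 2
            ≤ Percolation.derivGen G p α u) ∧
    -- the identity for the critical value of the generating function
    (∀ p ∈ Percolation.INabla G, Percolation.pc G ≤ p →
      Percolation.alphaCrit G p = ENNReal.ofReal (Real.exp (-Percolation.gammaInt G p))) ∧
    -- the estimate on the generating function
    (∃ κ : I → ℝ,
      ContinuousOn κ (Percolation.INabla G) ∧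
      (∀ p ∈ Percolation.INabla G, 0 < κ p) ∧
      ∀ p ∈ Percolation.INabla G, Percolation.pc G ≤ p →
        ∀ α : ℝ≥0, α < 1 → (α : ℝ≥0∞) < Percolation.alphaCrit G p →
          Percolation.genSup G p α
            ≤ ENNReal.ofReal (κ p) / (Percolation.alphaCrit G p - α)) := by
  obtain ⟨D, hD⟩ := Percolation.exists_degree_bound hqt
  have := Percolation.countable_of_connected hconn hD
  have := hconn.nonempty
  exact ⟨Percolation.exists_continuousOn_mul_gen_sq_le hconn hqt,
    fun p hp hpc => Percolation.alphaCrit_eq hD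
      (Percolation.genSup_one_eq_top hconn hD hp hpc),
    Percolation.exists_continuousOn_genSup_le hconn hqt⟩
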